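/- All rings are commutative. A subset $S$ of a topological ring is bounded if for every neighbourhood $U$ of $0$ there is a neighbourhood $V$ of $0$ with $V\cdot S\subseteq U$; an element is power-bounded if the set of its powers is bounded. A Huber ring is a topological ring having an open subring $A_0$ whose topology is $I$-adic for a finitely generated ideal $I\subseteq A_0$; it is analytic if its topologically nilpotent elements generate the unit ideal, and uniform if its set of power-bounded elements is bounded. A Huber pair $(A,A^+)$ is a Huber ring $A$ with an open, integrally closed subring $A^+$ consisting of power-bounded elements. For $A$ complete, $A\langle T_1,\dots,T_n\rangle$ is the ring of power series over $A$ with coefficients tending to $0$, with the topology of uniform convergence of coefficients, and $(A,A^+)\langle T_1,\dots,T_n\rangle$ is the pair $(A\langle T_1,\dots,T_n\rangle, A^+\langle T_1,\dots,T_n\rangle)$. For $f,g\in A$ generating the unit ideal, $A\langle f/g\rangle$ is the quotient of $A\langle T\rangle$ by the closure of the ideal $(gT-f)$, and $A\langle f/g\rangle^+$ is the integral closure in it of the image of $A^+\langle T\rangle$. A morphism of Huber pairs $(A,A^+)\to(B,B^+)$ is a continuous ring homomorphism $A\to B$ carrying $A^+$ into $B^+$. **Lemma (Kedlaya).** Let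 $(A,A^+)\to(B,B^+)$ be a morphism of complete (Hausdorff) analytic uniform Huber pairs, and let $f,g\in A$ generate the unit ideal of $A$; write $f,g$ also for their images in $B$. Suppose that for some $n\ge 0$ there are surjective morphisms of Huber pairs over $(A,A^+)$ $$s_1:(A\langle f/g\rangle,A\langle f/g\rangle^+)\langle T_1,\dots,T_n\rangle\to (B\langle f/g\rangle,B\langle f/g\rangle^+),$$ $$s_2:(A\langle g/f\rangle,A\langle g/f\rangle^+)\langle T_1,\dots,T_n\rangle\to (B\langle g/f\rangle,B\langle g/f\rangle^+)$$ (surjective meaning surjective as maps of rings $A\langle f/g\rangle\langle T_1,\dots,T_n\rangle\to B\langle f/g\rangle$ and $A\langle g/f\rangle\langle T_1,\dots,T_n\rangle\to B\langle g/f\rangle$), whose kernels are finitely generated ideals. Then for some $n'\ge 0$ there is a morphism of Huber pairs over $(A,A^+)$ $$s:(A,A^+)\langle T_1,\dots,T_{n'}\rangle\to (B,B^+)$$ such that $A\langle T_1,\dots,T_{n'}\rangle\to B$ is surjective. -/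

import Mathlib

open Filter Topology
open scoped Pointwise

/-! ### Huber rings and Huber pairs -/

section HuberRings

variable (A : Type*) [CommRing A] [TopologicalSpace A]

/-- A subset `S` of a topological ring is bounded if for every neighbourhood `U` of `0` there is a
neighbourhood `V` of `0` with `V * S ⊆ U`. -/
def IsBoundedSubset {A : Type*} [CommRing A] [TopologicalSpace A] (S : Set A) : Prop :=
  ∀ U ∈ 𝓝 (0 : A), ∃ V ∈ 𝓝 (0 : A), V * S ⊆ U

/-- `a` is power-bounded if the set of its powers is bounded. -/
def IsPowerBoundedElement {A : Type*} [CommRing A] [TopologicalSpace A] (a : A) : Prop :=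
  IsBoundedSubset (Set.range fun k : ℕ => a ^ k)

/-- A Huber ring: a topological ring with an open subring `A₀` whose subspace topology is the
`I`-adic one for some finitely generated ideal `I` of `A₀`. (Such a ring is automatically
nonarchimedean; this is recorded as the parent class so that instances are found.) -/
class IsHuberRing : Prop extends NonarchimedeanRing A where
  exists_pair_of_definition :
    ∃ (A₀ : Subring A) (I : Ideal A₀), IsOpen (A₀ : Set A) ∧ I.FG ∧ IsAdic I

/-- Analytic: the topologically nilpotent elements generate the unit ideal. -/
def IsAnalyticRing : Prop :=
  Ideal.span {a : A | IsTopologicallyNilpotent a} = ⊤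

/-- Uniform: the set of power-bounded elements is bounded. -/
def IsUniformRing : Prop :=
  IsBoundedSubset {a : A | IsPowerBoundedElement a}

variable {A}

/-- `P` is a ring of integral elements of `A`: an open, integrally closed subring consisting of
power-bounded elements. For a Huber ring `A` this says that `(A, P)` is a Huber pair. -/
structure IsRingOfIntegralElements (P : Subring A) : Prop where
  isOpen : IsOpen (P : Set A)
  integrallyClosed : ∀ a : A, IsIntegral P a → a ∈ P
  powerBounded : ∀ a ∈ P, IsPowerBoundedElement a

end HuberRings

/-! ### The Tate algebra `A⟨T₁, …, Tₙ⟩` -/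

section TateAlgebra

variable (n : ℕ) (A : Type*) [CommRing A] [TopologicalSpace A] [NonarchimedeanRing A]

/-- The formal power series in `n` variables whose coefficients tend to `0`. -/
def restrictedSeries : Subalgebra A (MvPowerSeries (Fin n) A) where
  carrier := {F | Tendsto (fun m => MvPowerSeries.coeff m F) cofinite (𝓝 0)}
  algebraMap_mem' a := by
    classical
    refine tendsto_nhds_of_eventually_eq ?_
    filter_upwards [(Set.finite_singleton (0 : Fin n →₀ ℕ)).compl_mem_cofinite] with m hm
    have hm' : m ≠ 0 := hm
    simp [MvPowerSeries.algebraMap_apply, MvPowerSeries.coeff_C, hm']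
  add_mem' {F G} hF hG := by
    have h := Tendsto.add hF hG
    simpa using h
  mul_mem' {F G} hF hG := by
    classical
    intro U hU
    obtain ⟨W, hW⟩ := NonarchimedeanRing.is_nonarchimedean U hU
    obtain ⟨V, hV⟩ := NonarchimedeanRing.mul_subset W
    have fin : ∀ (H : MvPowerSeries (Fin n) A),
        Tendsto (fun m => MvPowerSeries.coeff m H) cofinite (𝓝 0) → ∀ V' : OpenAddSubgroup A,
        {m | MvPowerSeries.coeff m H ∉ V'}.Finite := fun H hH V' =>
      hH.eventually (V'.mem_nhds_zero)
    -- one open subgroup `V'` absorbed by the finitely many large coefficients of `H`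
    have absorb : ∀ (H : MvPowerSeries (Fin n) A),
        Tendsto (fun m => MvPowerSeries.coeff m H) cofinite (𝓝 0) →
        ∃ V' : OpenAddSubgroup A, ∀ m, ∀ a ∈ V', MvPowerSeries.coeff m H * a ∈ W := by
      intro H hH
      have h0 : ∀ s : Finset (Fin n →₀ ℕ), ∃ V' : OpenAddSubgroup A,
          ∀ m ∈ s, ∀ a ∈ V', MvPowerSeries.coeff m H * a ∈ W := by
        intro s
        induction s using Finset.induction_on with
        | empty => exact ⟨V, by simp⟩
        | insert m s _ ih =>
          obtain ⟨V₁, h₁⟩ := ih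
          obtain ⟨V₂, h₂⟩ := NonarchimedeanRing.left_mul_subset W (MvPowerSeries.coeff m H)
          refine ⟨V₁ ⊓ V₂, ?_⟩
          intro k hk a ha
          rcases Finset.mem_insert.1 hk with rfl | hk
          · exact h₂ (Set.smul_mem_smul_set ha.2)
          · exact h₁ k hk a ha.1
      obtain ⟨V₁, h₁⟩ := h0 (fin H hH V).toFinset
      refine ⟨V₁ ⊓ V, fun m a ha => ?_⟩
      by_cases hm : MvPowerSeries.coeff m H ∈ V
      · exact hV (Set.mul_mem_mul hm ha.2)
      · exact h₁ m (by simpa using hm) a ha.1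
    obtain ⟨VF, hVF⟩ := absorb F hF
    obtain ⟨VG, hVG⟩ := absorb G hG
    have hfin := ((fin F hF VG).add (fin G hG VF))
    refine Filter.mem_map.2 (Filter.mem_of_superset hfin.compl_mem_cofinite ?_)
    intro m hm
    refine hW ?_
    show MvPowerSeries.coeff m (F * G) ∈ W
    rw [MvPowerSeries.coeff_mul]
    refine sum_mem fun p hp => ?_
    by_cases h1 : MvPowerSeries.coeff p.1 F ∈ VG
    · rw [mul_comm]
      exact hVG _ _ h1
    · by_cases h2 : MvPowerSeries.coeff p.2 G ∈ VF
      · exact hVF _ _ h2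
      · exact absurd (Set.mem_add.2 ⟨p.1, h1, p.2, h2, Finset.HasAntidiagonal.mem_antidiagonal.1 hp⟩) hm

/-- The Tate algebra `A⟨T₁, …, Tₙ⟩` (used for complete `A`). -/
def TateAlgebra : Type _ := restrictedSeries n A

noncomputable instance : CommRing (TateAlgebra n A) :=
  inferInstanceAs (CommRing (restrictedSeries n A))

noncomputable instance {R : Type*} [CommRing R] [Algebra R A] : Algebra R (TateAlgebra n A) :=
  inferInstanceAs (Algebra R (restrictedSeries n A))

variable {n A}

/-- The coefficient of `T ^ m`. -/
noncomputable def TateAlgebra.coeff (m : Fin n →₀ ℕ) (F : TateAlgebra n A) : A :=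
  MvPowerSeries.coeff m F.1

/-- The variable `Tᵢ`. -/
noncomputable def TateAlgebra.var (i : Fin n) : TateAlgebra n A :=
  ⟨MvPowerSeries.X i, by
    classical
    refine tendsto_nhds_of_eventually_eq ?_
    filter_upwards [(Set.finite_singleton (Finsupp.single i 1)).compl_mem_cofinite] with m hm
    have hm' : m ≠ Finsupp.single i 1 := hm
    simp [MvPowerSeries.coeff_X, hm']⟩

variable (n A)

/-- The series all of whose coefficients lie in the open subgroup `U`. -/
noncomputable def TateAlgebra.basicSubgroup (U : OpenAddSubgroup A) :
    AddSubgroup (TateAlgebra n A) where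
  carrier := {F | ∀ m, F.coeff m ∈ U}
  zero_mem' m := by
    have h : (0 : TateAlgebra n A).coeff m = 0 := map_zero (MvPowerSeries.coeff m)
    rw [h]; exact zero_mem U
  add_mem' {F G} hF hG m := by
    have h : (F + G).coeff m = F.coeff m + G.coeff m :=
      map_add (MvPowerSeries.coeff m) F.1 G.1
    rw [h]; exact add_mem (hF m) (hG m)
  neg_mem' {F} hF m := by
    have h : (-F).coeff m = - F.coeff m := map_neg (MvPowerSeries.coeff m) F.1
    rw [h]; exact neg_mem (hF m)

theorem TateAlgebra.coeff_mul (F G : TateAlgebra n A) (m : Fin n →₀ ℕ) :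
    (F * G).coeff m = ∑ p ∈ Finset.HasAntidiagonal.antidiagonal m, F.coeff p.1 * G.coeff p.2 :=
  MvPowerSeries.coeff_mul m F.1 G.1

theorem TateAlgebra.isBasis : RingSubgroupsBasis (TateAlgebra.basicSubgroup n A) := by
  refine RingSubgroupsBasis.of_comm _ ?_ ?_ ?_
  · exact fun U V => ⟨U ⊓ V, fun F hF => ⟨fun m => (hF m).1, fun m => (hF m).2⟩⟩
  · intro U
    obtain ⟨V, hV⟩ := NonarchimedeanRing.mul_subset U
    refine ⟨V, ?_⟩
    rintro _ ⟨F, hF, G, hG, rfl⟩ m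
    rw [TateAlgebra.coeff_mul]
    exact sum_mem fun p _ => hV (Set.mul_mem_mul (hF p.1) (hG p.2))
  · intro F U
    obtain ⟨V, hV⟩ := NonarchimedeanRing.mul_subset U
    have hfin : {m | F.coeff m ∉ V}.Finite := F.2.eventually V.mem_nhds_zero
    have h0 : ∀ s : Finset (Fin n →₀ ℕ), ∃ V' : OpenAddSubgroup A,
        ∀ m ∈ s, ∀ a ∈ V', F.coeff m * a ∈ U := by
      classical
      intro s
      induction s using Finset.induction_on with
      | empty => exact ⟨V, by simp⟩
      | insert m s _ ih =>
        obtain ⟨V₁, h₁⟩ := ih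
        obtain ⟨V₂, h₂⟩ := NonarchimedeanRing.left_mul_subset U (F.coeff m)
        refine ⟨V₁ ⊓ V₂, ?_⟩
        intro k hk a ha
        rcases Finset.mem_insert.1 hk with rfl | hk
        · exact h₂ (Set.smul_mem_smul_set ha.2)
        · exact h₁ k hk a ha.1
    obtain ⟨V₁, h₁⟩ := h0 hfin.toFinset
    refine ⟨V₁ ⊓ V, fun G hG m => ?_⟩
    rw [TateAlgebra.coeff_mul]
    refine sum_mem fun p _ => ?_
    by_cases hm : F.coeff p.1 ∈ V
    · exact hV (Set.mul_mem_mul hm (hG p.2).2)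
    · exact h₁ p.1 (by simpa using hm) _ (hG p.2).1

/-- The topology of uniform convergence of the coefficients: a basis of neighbourhoods of `0` is
given by the sets of all series with coefficients in `U`, for `U` an open subgroup of `A`. -/
noncomputable instance : TopologicalSpace (TateAlgebra n A) :=
  (TateAlgebra.isBasis n A).topology

instance : NonarchimedeanRing (TateAlgebra n A) :=
  (TateAlgebra.isBasis n A).nonarchimedean

variable {A}

/-- For a subring `P` of `A` (the ring of integral elements of a Huber pair `(A, P)`), the subring
`P⟨T₁, …, Tₙ⟩` of `A⟨T₁, …, Tₙ⟩` of all series with coefficients in `P`. -/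
noncomputable def TateAlgebra.plus (P : Subring A) : Subring (TateAlgebra n A) where
  carrier := {F | ∀ m, F.coeff m ∈ P}
  zero_mem' m := by
    have h : (0 : TateAlgebra n A).coeff m = 0 := map_zero (MvPowerSeries.coeff m)
    rw [h]; exact zero_mem P
  one_mem' m := by
    classical
    have h : (1 : TateAlgebra n A).coeff m = if m = 0 then 1 else 0 :=
      MvPowerSeries.coeff_one (n := m)
    rw [h]; split_ifs
    · exact one_mem P
    · exact zero_mem P
  add_mem' {F G} hF hG m := by
    have h : (F + G).coeff m = F.coeff m + G.coeff m :=
      map_add (MvPowerSeries.coeff m) F.1 G.1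
    rw [h]; exact add_mem (hF m) (hG m)
  neg_mem' {F} hF m := by
    have h : (-F).coeff m = - F.coeff m := map_neg (MvPowerSeries.coeff m) F.1
    rw [h]; exact neg_mem (hF m)
  mul_mem' {F G} hF hG m := by
    rw [TateAlgebra.coeff_mul]
    exact sum_mem fun p _ => mul_mem (hF p.1) (hG p.2)

end TateAlgebra

/-! ### The rational localization `A⟨f/g⟩` -/

section RationalLocalization

variable {A : Type*} [CommRing A] [TopologicalSpace A] [NonarchimedeanRing A]

/-- The closure of the ideal `(g T - f)` of `A⟨T⟩`. -/
noncomputable def rationalIdeal (f g : A) : Ideal (TateAlgebra 1 A) :=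
  (Ideal.span {algebraMap A (TateAlgebra 1 A) g * TateAlgebra.var 0
    - algebraMap A (TateAlgebra 1 A) f}).closure

/-- The rational localization `A⟨f/g⟩ = A⟨T⟩ / closure of (g T - f)`, with the quotient topology
(used for complete `A` and `f`, `g` generating the unit ideal). -/
def RationalLocalization (f g : A) : Type _ := TateAlgebra 1 A ⧸ rationalIdeal f g

noncomputable instance (f g : A) : CommRing (RationalLocalization f g) :=
  inferInstanceAs (CommRing (TateAlgebra 1 A ⧸ rationalIdeal f g))

noncomputable instance (f g : A) {R : Type*} [CommRing R] [Algebra R A] :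
    Algebra R (RationalLocalization f g) :=
  inferInstanceAs (Algebra R (TateAlgebra 1 A ⧸ rationalIdeal f g))

instance (f g : A) : TopologicalSpace (RationalLocalization f g) :=
  inferInstanceAs (TopologicalSpace (TateAlgebra 1 A ⧸ rationalIdeal f g))

/-- The quotient map `A⟨T⟩ → A⟨f/g⟩`, `T ↦ f/g`. -/
noncomputable def RationalLocalization.mk (f g : A) : TateAlgebra 1 A →+* RationalLocalization f g :=
  Ideal.Quotient.mk (rationalIdeal f g)

instance (f g : A) : NonarchimedeanRing (RationalLocalization f g) where
  toIsTopologicalRing :=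
    inferInstanceAs (IsTopologicalRing (TateAlgebra 1 A ⧸ rationalIdeal f g))
  is_nonarchimedean U hU := by
    have hc : Continuous (RationalLocalization.mk f g) := continuous_quot_mk
    have ho : IsOpenMap (RationalLocalization.mk f g) :=
      QuotientRing.isOpenMap_coe (rationalIdeal f g)
    obtain ⟨V, hV⟩ := NonarchimedeanRing.is_nonarchimedean (RationalLocalization.mk f g ⁻¹' U)
      (hc.continuousAt.preimage_mem_nhds (by simpa using hU))
    refine ⟨⟨V.toAddSubgroup.map (RationalLocalization.mk f g).toAddMonoidHom, ?_⟩, ?_⟩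
    · exact ho _ V.isOpen
    · rintro _ ⟨x, hx, rfl⟩
      exact hV hx

/-- The ring of integral elements of the rational localization of the pair `(A, P)`: the integral
closure in `A⟨f/g⟩` of the image of `P⟨T⟩`. -/
noncomputable def RationalLocalization.plus (f g : A) (P : Subring A) :
    Subring (RationalLocalization f g) :=
  (integralClosure ((TateAlgebra.plus 1 P).map (RationalLocalization.mk f g))
    (RationalLocalization f g)).toSubring

end RationalLocalization

/-!
The surjection `A⟨T₁, …, Tₘ⟩ → B` is evaluation at a finite family `e` of elements of `Bplus`. Any
such family gives a morphism of pairs (`TateAlgebra.map_mem_of_mem_plus`), so the point is to choose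
`e` so large that evaluation is surjective. This is done in two steps.

*Over the pieces.* Put `C = B⟨f/g⟩` and let `Cb` be the image of `Bplus⟨T⟩`, a bounded open subring
of `C` in which the ring generated by `f/g` and `Bplus` is dense. As `s₁` respects the rings of
integral elements, the images `xᵢ` of the variables are integral over `Cb`. The coefficients of
their integral equations can be approximated by polynomials in finitely many elements of `Bplus`,
and since the monomials in the `xᵢ` generate a finite module over the approximations, an
approximation argument shows that all families `e` that contain certain finitely many elements of
`Bplus` give surjections `A⟨T₁, …, Tₘ⟩⟨f/g⟩ → C` (`exists_finite_forall_surjective`). After a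
further enlargement of the family the integral equations lift exactly. Adjoining their roots to `X =
A⟨T₁, …, Tₘ⟩⟨f/g⟩` gives a finite free `X`-algebra `D` with a surjection to `C`; its kernel is the
image of the kernel of `A⟨f/g⟩⟨X₁, …, Xₙ⟩⟨S₁, …, Sₘ⟩ → C`, which is finitely generated because the
kernel of `s₁` is. So `C` is finitely presented over `X`, and the kernel of `X → C` is finitely
generated (`ker_fg_of_isIntegral`, `exists_finite_evalPiece`).

*Gluing.* It remains to show that a map `R → B` is surjective if it is so, with finitely generated
kernel, on `R⟨f/g⟩` and `R⟨g/f⟩` (`surjective_of_surjective_map`). The input from uniformity is that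
multiplication by `g U - f` on Laurent series is strict over `A` and over `B`
(`strictPair_of_isUniformRing`), and over `R = A⟨T₁, …, Tₘ⟩` coefficient by coefficient. Strictness
makes the Čech complexes `0 → R → R⟨f/g⟩ × R⟨g/f⟩ → R⟨f/g, g/f⟩ → 0` of `R` and of `B` exact. The
kernel over the overlap is the ideal generated by the kernel over either piece
(`Overlap.mem_span_fst_of_map_eq_zero`), and an approximation in the style of Cartan's lemma writes
each of its elements as a sum of elements of the kernels over the two pieces
(`exists_add_of_mem_span`). So two lifts of the restrictions of an element of `B` can be corrected
until they agree on the overlap.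

Noetherian hypotheses play no role: that the relevant maps are open, and hence that null families
lift along them, follows from the open mapping theorem for modules over a ring in which every
neighbourhood of `0` generates the unit ideal (`NhdsSpanTop.isOpenMap`), a property of analytic
rings. Completeness is used throughout in the form that null families are summable (`NullComplete`).
-/

/-! ### Complete nonarchimedean groups and null families -/

section NullComplete

/-- A complete, Hausdorff, first countable nonarchimedean group. Completeness is expressed without
a uniform structure, by summability of all countable families that tend to `0`. -/
class NullComplete (M : Type*) [AddCommGroup M] [TopologicalSpace M] : Prop
    extends NonarchimedeanAddGroup M, T2Space M, FirstCountableTopology M where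
  summable_of_null : ∀ {ι : Type} [Countable ι] (u : ι → M), Tendsto u cofinite (𝓝 0) → Summable u

variable {M N : Type*} [AddCommGroup M] [TopologicalSpace M] [AddCommGroup N] [TopologicalSpace N]

theorem nhds_zero_hasBasis_openAddSubgroup (M : Type*) [AddCommGroup M] [TopologicalSpace M]
    [NonarchimedeanAddGroup M] :
    (𝓝 (0 : M)).HasBasis (fun _ : OpenAddSubgroup M => True) (fun W => (W : Set M)) := by
  refine ⟨fun t => ⟨fun ht => ?_, fun ⟨W, _, hW⟩ => mem_of_superset W.mem_nhds_zero hW⟩⟩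
  obtain ⟨W, hW⟩ := NonarchimedeanAddGroup.is_nonarchimedean t ht
  exact ⟨W, trivial, hW⟩

theorem null_iff {ι : Type*} [NonarchimedeanAddGroup M] {l : Filter ι} {u : ι → M} :
    Tendsto u l (𝓝 0) ↔ ∀ W : OpenAddSubgroup M, ∀ᶠ i in l, u i ∈ W := by
  rw [(nhds_zero_hasBasis_openAddSubgroup M).tendsto_right_iff]
  simp

/-- A decreasing sequence of open subgroups that is a basis of neighbourhoods of `0`. -/
theorem exists_antitone_openAddSubgroup_basis (M : Type*) [AddCommGroup M] [TopologicalSpace M]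
    [NonarchimedeanAddGroup M] [FirstCountableTopology M] :
    ∃ W : ℕ → OpenAddSubgroup M, Antitone W ∧
      (𝓝 (0 : M)).HasBasis (fun _ => True) (fun n => (W n : Set M)) := by
  obtain ⟨x, hx⟩ := (𝓝 (0 : M)).exists_antitone_basis
  choose W hW using fun n => NonarchimedeanAddGroup.is_nonarchimedean (x n) (hx.mem n)
  refine ⟨fun n => (Finset.range (n + 1)).inf' ⟨0, by simp⟩ W, ?_, ?_⟩
  · intro m n hmn
    exact Finset.inf'_mono _ (Finset.range_mono (by omega)) _
  · refine ⟨fun t => ⟨fun ht => ?_, fun ⟨n, _, hn⟩ => ?_⟩⟩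
    · obtain ⟨n, _, hn⟩ := hx.toHasBasis.mem_iff.1 ht
      refine ⟨n, trivial, fun y hy => hn (hW n ?_)⟩
      exact (Finset.inf'_le W (by simp : n ∈ Finset.range (n + 1)) :
        (Finset.range (n + 1)).inf' ⟨0, by simp⟩ W ≤ W n) hy
    · exact mem_of_superset (OpenAddSubgroup.mem_nhds_zero _) hn

theorem HasSum.mem_openAddSubgroup {ι : Type*} [ContinuousAdd M] {u : ι → M} {x : M}
    (W : OpenAddSubgroup M) (h : HasSum u x) (hu : ∀ i, u i ∈ W) : x ∈ W :=
  W.isClosed.mem_of_tendsto h (Eventually.of_forall fun _ => sum_mem fun i _ => hu i)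

theorem NullComplete.summable {ι : Type*} [Countable ι] [NullComplete M] {u : ι → M}
    (hu : Tendsto u cofinite (𝓝 0)) : Summable u := by
  obtain ⟨e, he⟩ := Countable.exists_injective_nat ι
  have : Countable (Set.range e) := inferInstance
  let E := Equiv.ofInjective e he
  rw [← E.symm.summable_iff]
  exact NullComplete.summable_of_null _ (hu.comp E.symm.injective.tendsto_cofinite)

theorem NullComplete.hasSum {ι : Type*} [Countable ι] [NullComplete M] {u : ι → M}
    (hu : Tendsto u cofinite (𝓝 0)) : HasSum u (∑' i, u i) :=
  (NullComplete.summable hu).hasSum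

/-- The map `T` is open onto its image at `0`. -/
def OpenOntoRange (T : M →+ N) : Prop :=
  ∀ W : OpenAddSubgroup M, ∃ W' ∈ 𝓝 (0 : N), ∀ y ∈ W', y ∈ T.range → ∃ x ∈ W, T x = y

/-- Null families in the image of a map that is open onto its image lift to null families. -/
theorem OpenOntoRange.exists_null_lift [NonarchimedeanAddGroup M] [FirstCountableTopology M]
    {T : M →+ N} (hT : OpenOntoRange T) {ι : Type*} [Countable ι] {y : ι → N}
    (hy : Tendsto y cofinite (𝓝 0)) (hyT : ∀ i, y i ∈ T.range) :
    ∃ x : ι → M, Tendsto x cofinite (𝓝 0) ∧ ∀ i, T (x i) = y i := by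
  classical
  obtain ⟨W, hWa, hW⟩ := exists_antitone_openAddSubgroup_basis M
  obtain ⟨e, he⟩ := Countable.exists_injective_nat ι
  -- lift `y i` into `W k` for the largest `k ≤ e i` for which this is possible
  let p : ι → ℕ → Prop := fun i k => ∃ x ∈ W k, T x = y i
  have hx : ∀ i, ∃ x : M, T x = y i ∧ ∀ k, k ≤ e i → p i k → x ∈ W k := by
    intro i
    by_cases hp : ∃ k ≤ e i, p i k
    · obtain ⟨k₀, hk₀, hpk₀⟩ := hp
      have hs := Nat.findGreatest_spec (P := p i) hk₀ hpk₀
      obtain ⟨x, hxW, hxy⟩ := hs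
      refine ⟨x, hxy, fun k hk hpk => hWa (Nat.le_findGreatest hk hpk) hxW⟩
    · obtain ⟨x, hx⟩ := hyT i
      exact ⟨x, hx, fun k hk hpk => absurd ⟨k, hk, hpk⟩ hp⟩
  choose x hxT hxW using hx
  refine ⟨x, hW.tendsto_right_iff.2 fun k _ => ?_, hxT⟩
  obtain ⟨W', hW', hWW'⟩ := hT (W k)
  have h1 : ∀ᶠ i in cofinite, k ≤ e i := by
    have := he.tendsto_cofinite.eventually
      (Nat.cofinite_eq_atTop ▸ eventually_ge_atTop k : ∀ᶠ n in cofinite, k ≤ n)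
    exact this
  filter_upwards [hy.eventually hW', h1] with i hi hki
  exact hxW i k hki (hWW' _ hi (hyT i))

theorem OpenOntoRange.of_isOpenMap {T : M →+ N} (hT : IsOpenMap T) : OpenOntoRange T := by
  intro W
  refine ⟨T '' W, (hT _ W.isOpen).mem_nhds ⟨0, zero_mem W, map_zero T⟩, ?_⟩
  rintro _ ⟨x, hx, rfl⟩ _
  exact ⟨x, hx, rfl⟩

theorem NullComplete.of_surjective [NullComplete M] [NonarchimedeanAddGroup N] [T2Space N]
    (T : M →+ N) (hc : Continuous T) (ho : IsOpenMap T) (hs : Function.Surjective T) :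
    NullComplete N where
  toFirstCountableTopology := ⟨fun y => by
    obtain ⟨x, rfl⟩ := hs y
    rw [← ho.map_nhds_eq hc.continuousAt]
    infer_instance⟩
  summable_of_null {ι} _ u hu := by
    obtain ⟨x, hx, hxu⟩ := (OpenOntoRange.of_isOpenMap ho).exists_null_lift hu
      (fun i => by obtain ⟨x, hx⟩ := hs (u i); exact ⟨x, hx⟩)
    have := (NullComplete.hasSum hx).map T hc
    exact ⟨_, by simpa [Function.comp_def, hxu] using this⟩

/-- A topological group isomorphism transports completeness. -/
theorem NullComplete.of_continuousAddEquiv [NullComplete M] [IsTopologicalAddGroup N]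
    (e : M ≃+ N) (h1 : Continuous e) (h2 : Continuous e.symm) : NullComplete N := by
  have : NonarchimedeanAddGroup N := ⟨fun U hU => by
    obtain ⟨V, hV⟩ := NonarchimedeanAddGroup.is_nonarchimedean (e ⁻¹' U)
      (h1.continuousAt.preimage_mem_nhds (by simpa using hU))
    refine ⟨V.comap e.symm.toAddMonoidHom h2, fun x hx => ?_⟩
    have := hV hx
    simpa using this⟩
  have : T2Space N := T2Space.of_injective_continuous e.symm.injective h2
  exact NullComplete.of_surjective e.toAddMonoidHom h1
    (Homeomorph.mk e.toEquiv h1 h2).isOpenMap e.surjective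

theorem NullComplete.of_isClosedEmbedding [NullComplete M] [IsTopologicalAddGroup N]
    (j : N →+ M) (hj : IsClosedEmbedding j) : NullComplete N where
  is_nonarchimedean U hU := by
    rw [hj.nhds_eq_comap, map_zero] at hU
    obtain ⟨t, ht, htU⟩ := hU
    obtain ⟨V, hV⟩ := NonarchimedeanAddGroup.is_nonarchimedean t ht
    exact ⟨V.comap j hj.continuous, fun x hx => htU (hV hx)⟩
  toT2Space := hj.isEmbedding.t2Space
  toFirstCountableTopology := hj.isInducing.firstCountableTopology
  summable_of_null {ι} _ u hu := by
    have h1 : HasSum (fun i => j (u i)) (∑' i, j (u i)) := NullComplete.hasSum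
      (by simpa [Function.comp_def] using (hj.continuous.tendsto 0).comp hu)
    have h2 : ∑' i, j (u i) ∈ Set.range j := by
      refine hj.isClosed_range.mem_of_tendsto h1 (Eventually.of_forall fun s => ?_)
      exact ⟨∑ i ∈ s, u i, map_sum j u s⟩
    obtain ⟨x, hx⟩ := h2
    refine ⟨x, ?_⟩
    rw [← hx] at h1
    simpa [HasSum, hj.tendsto_nhds_iff, Function.comp_def] using h1

instance [NullComplete M] [NullComplete N] : NullComplete (M × N) where
  summable_of_null {ι} _ u hu := by
    have h1 := NullComplete.hasSum ((continuous_fst.tendsto (0 : M × N)).comp hu)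
    have h2 := NullComplete.hasSum ((continuous_snd.tendsto (0 : M × N)).comp hu)
    exact ⟨_, h1.prodMk h2⟩

instance {r : Type*} [Finite r] [NonarchimedeanAddGroup M] : NonarchimedeanAddGroup (r → M) where
  is_nonarchimedean U hU := by
    have := Fintype.ofFinite r
    rw [nhds_pi, Filter.mem_pi] at hU
    obtain ⟨I, _, t, ht, htU⟩ := hU
    choose W hW using fun i => NonarchimedeanAddGroup.is_nonarchimedean (t i) (ht i)
    refine ⟨⟨AddSubgroup.pi Set.univ fun i => (W i).toAddSubgroup, ?_⟩, fun x hx => htU ?_⟩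
    · exact isOpen_set_pi Set.finite_univ fun i _ => (W i).isOpen
    · exact fun i _ => hW i (hx i trivial)

instance {r : Type*} [Finite r] [NullComplete M] : NullComplete (r → M) where
  summable_of_null {ι} _ u hu := by
    refine ⟨fun k => ∑' i, u i k, Pi.hasSum.2 fun k => NullComplete.hasSum ?_⟩
    exact ((continuous_apply k).tendsto (0 : r → M)).comp hu

/-- Completeness in the sense of uniform spaces. -/
theorem NullComplete.of_completeSpace (M : Type*) [AddCommGroup M] [UniformSpace M]
    [IsUniformAddGroup M] [CompleteSpace M] [T2Space M] [FirstCountableTopology M]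
    [NonarchimedeanAddGroup M] : NullComplete M where
  summable_of_null _ hu := NonarchimedeanAddGroup.summable_of_tendsto_cofinite_zero hu

theorem NullComplete.baireSpace [NullComplete M] : BaireSpace M := by
  let := IsTopologicalAddGroup.rightUniformSpace M
  have : IsUniformAddGroup M := isUniformAddGroup_of_addCommGroup
  have : (uniformity M).IsCountablyGenerated := IsUniformAddGroup.uniformity_countably_generated
  have : CompleteSpace M := by
    obtain ⟨W, hWa, hW⟩ := exists_antitone_openAddSubgroup_basis M
    refine UniformSpace.complete_of_convergent_controlled_sequences
      (fun n => {p | p.2 - p.1 ∈ W n}) (fun n => ?_) (fun u hu => ?_)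
    · rw [uniformity_eq_comap_nhds_zero M]
      exact ⟨W n, hW.mem_of_mem trivial, fun p hp => hp⟩
    · have hnull : Tendsto (fun n => u (n + 1) - u n) cofinite (𝓝 0) := by
        rw [Nat.cofinite_eq_atTop]
        refine hW.tendsto_right_iff.2 fun k _ => ?_
        filter_upwards [eventually_ge_atTop k] with n hn
        exact hWa hn (hu n n (n + 1) le_rfl (by omega))
      have h := (NullComplete.hasSum hnull).tendsto_sum_nat
      refine ⟨_, (h.add_const (u 0)).congr fun n => ?_⟩
      rw [Finset.sum_range_sub]; abel
  infer_instance

end NullComplete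

/-! ### The group of null families with the topology of uniform convergence -/

section C0

variable (ι : Type*) (M : Type*) [AddCommGroup M] [TopologicalSpace M] [NonarchimedeanAddGroup M]

/-- The group of families `ι → M` that tend to `0` along the cofinite filter. -/
def nullFamilies : AddSubgroup (ι → M) where
  carrier := {u | Tendsto u cofinite (𝓝 0)}
  zero_mem' := tendsto_const_nhds
  add_mem' {u v} hu hv := by simpa [Pi.add_def] using Tendsto.add hu hv
  neg_mem' {u} hu := by simpa [Pi.neg_def] using Tendsto.neg hu

/-- The group of null families `ι → M`; it carries the topology of uniform convergence. -/
def C0 : Type _ := nullFamilies ι M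

noncomputable instance : AddCommGroup (C0 ι M) := inferInstanceAs (AddCommGroup (nullFamilies ι M))

instance : FunLike (C0 ι M) ι M where
  coe u := u.1
  coe_injective _ _ h := Subtype.ext h

variable {ι M}

namespace C0

/-- The null family with the given terms. -/
def mk (u : ι → M) (hu : Tendsto u cofinite (𝓝 0)) : C0 ι M := ⟨u, hu⟩

@[simp] theorem mk_apply (u : ι → M) (hu : Tendsto u cofinite (𝓝 0)) (i : ι) : mk u hu i = u i := rfl

theorem null (u : C0 ι M) : Tendsto u cofinite (𝓝 0) := u.2

@[ext] theorem ext {u v : C0 ι M} (h : ∀ i, u i = v i) : u = v := DFunLike.ext _ _ h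

@[simp] theorem add_apply (u v : C0 ι M) (i : ι) : (u + v) i = u i + v i := rfl
@[simp] theorem neg_apply (u : C0 ι M) (i : ι) : (-u) i = -u i := rfl
@[simp] theorem sub_apply (u v : C0 ι M) (i : ι) : (u - v) i = u i - v i :=
  congrFun (AddSubgroup.coe_sub (nullFamilies ι M) u v) i
@[simp] theorem zero_apply (i : ι) : (0 : C0 ι M) i = 0 := rfl

/-- Evaluation at an index. -/
def evalHom (i : ι) : C0 ι M →+ M where
  toFun u := u i
  map_zero' := rfl
  map_add' _ _ := rfl

@[simp] theorem evalHom_apply (i : ι) (u : C0 ι M) : evalHom i u = u i := rfl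

@[simp] theorem sum_apply {κ : Type*} (s : Finset κ) (u : κ → C0 ι M) (i : ι) :
    (∑ k ∈ s, u k) i = ∑ k ∈ s, u k i := map_sum (evalHom i) u s

variable (ι) in
/-- The families all of whose terms lie in the open subgroup `W`. -/
def basic (W : OpenAddSubgroup M) : AddSubgroup (C0 ι M) where
  carrier := {u | ∀ i, u i ∈ W}
  zero_mem' _ := zero_mem W
  add_mem' hu hv i := add_mem (hu i) (hv i)
  neg_mem' hu i := neg_mem (hu i)

theorem mem_basic {W : OpenAddSubgroup M} {u : C0 ι M} : u ∈ basic ι W ↔ ∀ i, u i ∈ W := Iff.rfl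

/-- The filter basis of the topology of uniform convergence. -/
@[reducible] def filterBasis : AddGroupFilterBasis (C0 ι M) where
  sets := Set.range fun W : OpenAddSubgroup M => (basic ι W : Set (C0 ι M))
  nonempty := ⟨_, ⟨⊤, rfl⟩⟩
  inter_sets := by
    rintro _ _ ⟨W, rfl⟩ ⟨W', rfl⟩
    exact ⟨_, ⟨W ⊓ W', rfl⟩, fun u hu => ⟨fun i => (hu i).1, fun i => (hu i).2⟩⟩
  zero' := by
    rintro _ ⟨W, rfl⟩
    exact zero_mem (basic ι W)
  add' := by
    rintro _ ⟨W, rfl⟩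
    exact ⟨_, ⟨W, rfl⟩, by rintro _ ⟨a, ha, b, hb, rfl⟩; exact add_mem (S := AddSubgroup _) ha hb⟩
  neg' := by
    rintro _ ⟨W, rfl⟩
    exact ⟨_, ⟨W, rfl⟩, fun u hu => neg_mem (S := AddSubgroup _) hu⟩
  conj' := by
    rintro u _ ⟨W, rfl⟩
    exact ⟨_, ⟨W, rfl⟩, fun v hv => by simpa using hv⟩

noncomputable instance : TopologicalSpace (C0 ι M) := filterBasis.topology

instance : IsTopologicalAddGroup (C0 ι M) := filterBasis.isTopologicalAddGroup

theorem nhds_hasBasis : (𝓝 (0 : C0 ι M)).HasBasis (fun _ : OpenAddSubgroup M => True)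
    (fun W => (basic ι W : Set (C0 ι M))) := by
  refine (filterBasis (ι := ι) (M := M)).nhds_zero_hasBasis.to_hasBasis ?_ ?_
  · rintro _ ⟨W, rfl⟩; exact ⟨W, trivial, subset_rfl⟩
  · intro W _; exact ⟨_, ⟨W, rfl⟩, subset_rfl⟩

theorem basic_mem_nhds (W : OpenAddSubgroup M) : (basic ι W : Set (C0 ι M)) ∈ 𝓝 0 :=
  nhds_hasBasis.mem_of_mem trivial

instance : NonarchimedeanAddGroup (C0 ι M) where
  is_nonarchimedean U hU := by
    obtain ⟨W, _, hW⟩ := nhds_hasBasis.mem_iff.1 hU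
    exact ⟨⟨basic ι W, AddSubgroup.isOpen_of_mem_nhds _ (basic_mem_nhds W)⟩, hW⟩

theorem continuous_evalHom (i : ι) : Continuous (evalHom i : C0 ι M →+ M) := by
  refine continuous_of_continuousAt_zero _ ?_
  rw [ContinuousAt, map_zero, (nhds_zero_hasBasis_openAddSubgroup M).tendsto_right_iff]
  intro W _
  filter_upwards [basic_mem_nhds W] with u hu
  exact hu i

instance [T2Space M] : T2Space (C0 ι M) :=
  T2Space.of_injective_continuous (f := fun (u : C0 ι M) i => u i) DFunLike.coe_injective
    (continuous_pi continuous_evalHom)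

theorem tendsto_iff {κ : Type*} {l : Filter κ} {u : κ → C0 ι M} :
    Tendsto u l (𝓝 0) ↔ ∀ W : OpenAddSubgroup M, ∀ᶠ k in l, ∀ i, u k i ∈ W := by
  rw [nhds_hasBasis.tendsto_right_iff]
  simp [mem_basic]

instance [NullComplete M] : NullComplete (C0 ι M) where
  nhds_generated_countable u := by
    obtain ⟨W, hWa, hW⟩ := exists_antitone_openAddSubgroup_basis M
    have h : (𝓝 (0 : C0 ι M)).HasBasis (fun _ : ℕ => True)
        (fun n => (basic ι (W n) : Set (C0 ι M))) := by
      refine nhds_hasBasis.to_hasBasis (fun V _ => ?_) (fun n _ => ⟨W n, trivial, subset_rfl⟩)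
      obtain ⟨n, _, hn⟩ := hW.mem_iff.1 V.mem_nhds_zero
      exact ⟨n, trivial, fun v hv i => hn (hv i)⟩
    have : (𝓝 (0 : C0 ι M)).IsCountablyGenerated := h.isCountablyGenerated
    rw [← map_add_left_nhds_zero]
    infer_instance
  summable_of_null {κ} _ u hu := by
    have h1 : ∀ i, HasSum (fun k => u k i) (∑' k, u k i) := fun i => NullComplete.hasSum
      (by simpa [Function.comp_def] using ((continuous_evalHom i).tendsto 0).comp hu)
    have key : ∀ W : OpenAddSubgroup M, ∃ s₀ : Finset κ, ∀ s, s₀ ⊆ s → ∀ i,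
        (∑ k ∈ s, u k i) - ∑' k, u k i ∈ W := by
      intro W
      classical
      have hfin : {k | ¬ ∀ i, u k i ∈ W}.Finite := tendsto_iff.1 hu W
      refine ⟨hfin.toFinset, fun s hs i => ?_⟩
      have h2 := (h1 i).sub (hasSum_sum_of_ne_finset_zero (f := fun k => if k ∈ s then u k i else 0)
        (s := s) (by simp +contextual))
      have h3 : ∑ k ∈ s, (if k ∈ s then u k i else 0) = ∑ k ∈ s, u k i :=
        Finset.sum_congr rfl (by simp +contextual)
      rw [h3] at h2
      rw [← neg_sub]
      refine neg_mem (h2.mem_openAddSubgroup W fun k => ?_)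
      by_cases hk : k ∈ s
      · simp [hk, zero_mem]
      · have : k ∉ hfin.toFinset := fun h => hk (hs h)
        simp only [hk, if_false, sub_zero]
        simp only [Set.Finite.mem_toFinset, Set.mem_ofPred_eq, not_not] at this
        exact this i
    have hnull : Tendsto (fun i => ∑' k, u k i) cofinite (𝓝 0) := by
      refine null_iff.2 fun W => ?_
      obtain ⟨s, hs⟩ := key W
      have h2 := null_iff.1 (∑ k ∈ s, u k).null W
      filter_upwards [h2] with i hi
      have h3 := sub_mem hi (hs s subset_rfl i)
      simpa using h3
    refine ⟨mk _ hnull, ?_⟩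
    rw [HasSum, ← tendsto_sub_nhds_zero_iff]
    refine tendsto_iff.2 fun W => ?_
    obtain ⟨s₀, hs₀⟩ := key W
    simp only [SummationFilter.unconditional_filter]
    filter_upwards [eventually_ge_atTop s₀] with s hs i
    simpa using hs₀ s hs i

open Classical in
/-- The family with a single nonzero term. -/
noncomputable def single (i : ι) : M →+ C0 ι M where
  toFun m := ⟨fun j => if j = i then m else 0, tendsto_nhds_of_eventually_eq <| by
    filter_upwards [(Set.finite_singleton i).compl_mem_cofinite] with j hj
    exact if_neg hj⟩
  map_zero' := C0.ext fun j => by change (if j = i then (0 : M) else 0) = 0; simp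
  map_add' a b := C0.ext fun j => by
    change (if j = i then a + b else 0) = (if j = i then a else 0) + (if j = i then b else 0)
    split_ifs <;> simp

open Classical in
theorem single_apply (i j : ι) (m : M) : single i m j = if j = i then m else 0 := rfl

@[simp] theorem single_same (i : ι) (m : M) : single i m i = m := by simp [single_apply]

theorem single_of_ne {i j : ι} (h : j ≠ i) (m : M) : single i m j = 0 := by simp [single_apply, h]

theorem hasSum_single (u : C0 ι M) : HasSum (fun i => single i (u i)) u := by
  classical
  rw [HasSum, ← tendsto_sub_nhds_zero_iff]
  refine tendsto_iff.2 fun W => ?_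
  have hfin : {i | u i ∉ W}.Finite := null_iff.1 u.null W
  simp only [SummationFilter.unconditional_filter]
  filter_upwards [eventually_ge_atTop hfin.toFinset] with s hs i
  simp only [sub_apply, sum_apply, single_apply]
  by_cases hi : i ∈ s
  · simp [hi, zero_mem]
  · have : u i ∈ W := by
      by_contra h
      exact hi (hs (by simpa using h))
    simpa [hi] using this

variable {X : Type*} [AddCommGroup X] [TopologicalSpace X]

/-- Continuous additive maps on null families are determined by the families with one term. -/
theorem hom_ext [T2Space X] {S T : C0 ι M →+ X} (hS : Continuous S) (hT : Continuous T)
    (h : ∀ i m, S (single i m) = T (single i m)) : S = T := by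
  ext u
  have h1 := u.hasSum_single.map S hS
  have h2 := u.hasSum_single.map T hT
  simp only [Function.comp_def, h] at h1 h2
  exact h1.unique h2

/-- A family of additive maps `M → X` is equicontinuous at `0`. -/
def Equicont (L : ι → M →+ X) : Prop :=
  ∀ W : OpenAddSubgroup X, ∃ W' : OpenAddSubgroup M, ∀ i, ∀ m ∈ W', L i m ∈ W

theorem Equicont.null [NonarchimedeanAddGroup X] {L : ι → M →+ X} (hL : Equicont L) (u : C0 ι M) :
    Tendsto (fun i => L i (u i)) cofinite (𝓝 0) := by
  refine null_iff.2 fun W => ?_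
  obtain ⟨W', hW'⟩ := hL W
  filter_upwards [null_iff.1 u.null W'] with i hi
  exact hW' i _ hi

variable [Countable ι] [NullComplete X]

/-- The map `u ↦ ∑ L i (u i)` for an equicontinuous family `L`. -/
noncomputable def lift (L : ι → M →+ X) (hL : Equicont L) : C0 ι M →+ X where
  toFun u := ∑' i, L i (u i)
  map_zero' := by simp
  map_add' u v := by
    have h1 := NullComplete.hasSum (hL.null u)
    have h2 := NullComplete.hasSum (hL.null v)
    simpa using (h1.add h2).tsum_eq

theorem hasSum_lift (L : ι → M →+ X) (hL : Equicont L) (u : C0 ι M) :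
    HasSum (fun i => L i (u i)) (lift L hL u) := NullComplete.hasSum (hL.null u)

theorem continuous_lift (L : ι → M →+ X) (hL : Equicont L) : Continuous (lift L hL) := by
  refine continuous_of_continuousAt_zero _ ?_
  rw [ContinuousAt, map_zero, (nhds_zero_hasBasis_openAddSubgroup X).tendsto_right_iff]
  intro W _
  obtain ⟨W', hW'⟩ := hL W
  filter_upwards [basic_mem_nhds W'] with u hu
  exact (hasSum_lift L hL u).mem_openAddSubgroup W fun i => hW' i _ (hu i)

@[simp] theorem lift_single (L : ι → M →+ X) (hL : Equicont L) (i : ι) (m : M) :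
    lift L hL (single i m) = L i m := by
  refine (hasSum_lift L hL _).unique ?_
  convert _root_.hasSum_single i (f := fun j => L j (single i m j)) ?_ using 1
  · simp
  · intro j hj
    simp [single_of_ne hj]

end C0

end C0

/-! ### Tate algebras -/

section TateAlgebraBasic

namespace TateAlgebra

variable {n : ℕ} {A Q E : Type*} [CommRing A]
  [CommRing Q] [TopologicalSpace Q] [NonarchimedeanRing Q] [Algebra A Q]
  [CommRing E] [TopologicalSpace E] [NonarchimedeanRing E] [Algebra A E]

@[ext] theorem ext {F G : TateAlgebra n Q} (h : ∀ m, F.coeff m = G.coeff m) : F = G :=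
  Subtype.ext (MvPowerSeries.ext h)

@[simp] theorem coeff_add (F G : TateAlgebra n Q) (m) :
    (F + G).coeff m = F.coeff m + G.coeff m := map_add (MvPowerSeries.coeff m) F.1 G.1

@[simp] theorem coeff_sub (F G : TateAlgebra n Q) (m) :
    (F - G).coeff m = F.coeff m - G.coeff m := map_sub (MvPowerSeries.coeff m) F.1 G.1

@[simp] theorem coeff_zero (m) : (0 : TateAlgebra n Q).coeff m = 0 := map_zero _

theorem coeff_null (F : TateAlgebra n Q) : Tendsto (fun m => F.coeff m) cofinite (𝓝 0) := F.2

variable (n Q) in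
/-- A restricted power series is the same thing as its null family of coefficients. -/
noncomputable def toC0 : TateAlgebra n Q ≃+ C0 (Fin n →₀ ℕ) Q where
  toFun F := C0.mk (fun m => F.coeff m) F.coeff_null
  invFun u := ⟨fun m => u m, u.null⟩
  left_inv _ := rfl
  right_inv _ := rfl
  map_add' F G := C0.ext fun m => coeff_add F G m

@[simp] theorem coeff_toC0_symm (u : C0 (Fin n →₀ ℕ) Q) (m) :
    ((toC0 n Q).symm u).coeff m = u m := rfl

theorem nhds_hasBasis : (𝓝 (0 : TateAlgebra n Q)).HasBasis (fun _ : OpenAddSubgroup Q => True)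
    (fun W => (basicSubgroup n Q W : Set (TateAlgebra n Q))) :=
  (isBasis n Q).hasBasis_nhds_zero

theorem basicSubgroup_mem_nhds (W : OpenAddSubgroup Q) :
    (basicSubgroup n Q W : Set (TateAlgebra n Q)) ∈ 𝓝 0 := nhds_hasBasis.mem_of_mem trivial

theorem continuous_toC0 : Continuous (toC0 n Q) := by
  refine continuous_of_continuousAt_zero (toC0 n Q) ?_
  rw [ContinuousAt, map_zero, C0.nhds_hasBasis.tendsto_right_iff]
  intro W _
  exact basicSubgroup_mem_nhds W

theorem continuous_toC0_symm : Continuous (toC0 n Q).symm := by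
  refine continuous_of_continuousAt_zero (toC0 n Q).symm ?_
  rw [ContinuousAt, map_zero, nhds_hasBasis.tendsto_right_iff]
  intro W _
  exact C0.basic_mem_nhds W

instance [NullComplete Q] : NullComplete (TateAlgebra n Q) :=
  NullComplete.of_continuousAddEquiv (toC0 n Q).symm continuous_toC0_symm continuous_toC0

/-- The series with a single term `a T ^ m`. -/
noncomputable def monomial (m : Fin n →₀ ℕ) : Q →+ TateAlgebra n Q :=
  (toC0 n Q).symm.toAddMonoidHom.comp (C0.single m)

theorem monomial_def (m : Fin n →₀ ℕ) (a : Q) : monomial m a = (toC0 n Q).symm (C0.single m a) := rfl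

open Classical in
theorem coeff_monomial (m k : Fin n →₀ ℕ) (a : Q) :
    (monomial m a).coeff k = if k = m then a else 0 := by
  rw [monomial_def, coeff_toC0_symm, C0.single_apply]
  split_ifs <;> rfl

theorem hasSum_monomial (F : TateAlgebra n Q) : HasSum (fun m => monomial m (F.coeff m)) F :=
  ((toC0 n Q F).hasSum_single.map (toC0 n Q).symm continuous_toC0_symm)

theorem coe_monomial (m : Fin n →₀ ℕ) (a : Q) :
    (monomial m a).1 = MvPowerSeries.monomial m a := by
  classical
  refine MvPowerSeries.ext fun k => ?_
  rw [MvPowerSeries.coeff_monomial]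
  exact coeff_monomial m k a

theorem monomial_mul (m k : Fin n →₀ ℕ) (a b : Q) :
    (monomial m a * monomial k b : TateAlgebra n Q) = monomial (m + k) (a * b) := by
  refine Subtype.ext ?_
  have : (monomial m a * monomial k b : TateAlgebra n Q).1 = (monomial m a).1 * (monomial k b).1 := rfl
  rw [this, coe_monomial, coe_monomial, coe_monomial, MvPowerSeries.monomial_mul_monomial]

theorem one_eq_monomial : (1 : TateAlgebra n Q) = monomial 0 1 := by
  refine Subtype.ext ?_
  rw [coe_monomial]; rfl

variable (n Q A) in
/-- The constant series. -/
noncomputable def constHom : Q →ₐ[A] TateAlgebra n Q where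
  toFun a := monomial 0 a
  map_one' := one_eq_monomial.symm
  map_mul' a b := by rw [monomial_mul, add_zero]
  map_zero' := map_zero _
  map_add' := map_add _
  commutes' a := by
    refine Subtype.ext ?_
    rw [coe_monomial]
    exact (MvPowerSeries.algebraMap_apply (R := A) (A := Q) (σ := Fin n) (r := a)).symm

theorem algebraMap_eq_const (a : A) :
    algebraMap A (TateAlgebra n Q) a = monomial 0 (algebraMap A Q a) :=
  ((constHom n A Q).commutes a).symm

theorem algebraMap_self_eq (a : Q) : algebraMap Q (TateAlgebra n Q) a = monomial 0 a :=
  algebraMap_eq_const a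

theorem var_eq_monomial (i : Fin n) :
    (var i : TateAlgebra n Q) = monomial (Finsupp.single i 1) 1 := by
  refine Subtype.ext ?_
  rw [coe_monomial]; rfl

theorem var_pow (i : Fin n) (k : ℕ) :
    (var i : TateAlgebra n Q) ^ k = monomial (Finsupp.single i k) 1 := by
  induction k with
  | zero => simp [one_eq_monomial]
  | succ k ih => rw [pow_succ, ih, var_eq_monomial, monomial_mul, one_mul, ← Finsupp.single_add]

theorem prod_var_pow (α : Fin n →₀ ℕ) :
    ∏ i, (var i : TateAlgebra n Q) ^ α i = monomial α 1 := by
  have h : ∀ s : Finset (Fin n), ∏ i ∈ s, (var i : TateAlgebra n Q) ^ α i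
      = monomial (∑ i ∈ s, Finsupp.single i (α i)) 1 := by
    intro s
    classical
    induction s using Finset.induction_on with
    | empty => simp [one_eq_monomial]
    | insert i s hi ih =>
      rw [Finset.prod_insert hi, Finset.sum_insert hi, ih, var_pow, monomial_mul, one_mul]
  rw [h, Finsupp.univ_sum_single]

theorem monomial_eq_mul (α : Fin n →₀ ℕ) (a : Q) :
    monomial α a = monomial 0 a * ∏ i, (var i : TateAlgebra n Q) ^ α i := by
  rw [prod_var_pow, monomial_mul, zero_add, mul_one]

theorem continuous_monomial (m : Fin n →₀ ℕ) : Continuous (monomial m : Q →+ TateAlgebra n Q) := by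
  classical
  refine continuous_of_continuousAt_zero _ ?_
  rw [ContinuousAt, map_zero, nhds_hasBasis.tendsto_right_iff]
  intro W _
  filter_upwards [W.mem_nhds_zero] with a ha k
  rw [coeff_monomial]
  split_ifs
  exacts [ha, zero_mem W]

theorem continuous_constHom : Continuous (constHom n A Q) := continuous_monomial 0

/-- The coefficient maps as additive homomorphisms. -/
noncomputable def coeffHom (m : Fin n →₀ ℕ) : TateAlgebra n Q →+ Q :=
  (C0.evalHom m).comp (toC0 n Q).toAddMonoidHom

@[simp] theorem coeffHom_apply (m : Fin n →₀ ℕ) (F : TateAlgebra n Q) :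
    coeffHom m F = F.coeff m := rfl

theorem continuous_coeff (m : Fin n →₀ ℕ) : Continuous fun F : TateAlgebra n Q => F.coeff m :=
  (C0.continuous_evalHom m).comp continuous_toC0

theorem addHom_ext {X : Type*} [AddCommGroup X] [TopologicalSpace X] [T2Space X]
    {S T : TateAlgebra n Q →+ X} (hS : Continuous S) (hT : Continuous T)
    (h : ∀ m a, S (monomial m a) = T (monomial m a)) : S = T := by
  ext F
  have h1 := F.hasSum_monomial.map S hS
  have h2 := F.hasSum_monomial.map T hT
  simp only [Function.comp_def, h] at h1 h2
  exact h1.unique h2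

section Eval

variable [NullComplete E]

/-- The monomials in the family `y`. -/
def monomials (y : Fin n → E) : Set E := Set.range fun α : Fin n →₀ ℕ => ∏ i, y i ^ α i

theorem equicont_of_bounded {ι : Type*} {φ : Q →+ E} (hφ : Continuous φ) {z : ι → E}
    (hz : IsBoundedSubset (Set.range z)) :
    C0.Equicont (fun i => (AddMonoidHom.mulRight (z i)).comp φ) := by
  intro W
  obtain ⟨V, hV, hVW⟩ := hz W W.mem_nhds_zero
  obtain ⟨W', hW'⟩ := NonarchimedeanAddGroup.is_nonarchimedean (φ ⁻¹' V)
    (hφ.continuousAt.preimage_mem_nhds (by simpa using hV))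
  exact ⟨W', fun i m hm => hVW (Set.mul_mem_mul (hW' hm) ⟨i, rfl⟩)⟩

/-- Evaluation of restricted power series, as an additive map: `∑ a_α T^α ↦ ∑ φ(a_α) y^α`. -/
noncomputable def evalAdd (φ : Q →+ E) (hφ : Continuous φ) (y : Fin n → E)
    (hy : IsBoundedSubset (monomials y)) : TateAlgebra n Q →+ E :=
  (C0.lift _ (equicont_of_bounded hφ hy)).comp (toC0 n Q).toAddMonoidHom

theorem continuous_evalAdd (φ : Q →+ E) (hφ : Continuous φ) (y : Fin n → E)
    (hy : IsBoundedSubset (monomials y)) : Continuous (evalAdd φ hφ y hy) :=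
  (C0.continuous_lift _ (equicont_of_bounded hφ hy)).comp continuous_toC0

theorem evalAdd_monomial (φ : Q →+ E) (hφ : Continuous φ) (y : Fin n → E)
    (hy : IsBoundedSubset (monomials y)) (m a) :
    evalAdd φ hφ y hy (monomial m a) = φ a * ∏ i, y i ^ m i := by
  change C0.lift _ (equicont_of_bounded hφ hy) (toC0 n Q ((toC0 n Q).symm (C0.single m a))) = _
  rw [AddEquiv.apply_symm_apply, C0.lift_single]
  rfl

theorem hasSum_evalAdd (φ : Q →+ E) (hφ : Continuous φ) (y : Fin n → E)
    (hy : IsBoundedSubset (monomials y)) (F : TateAlgebra n Q) :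
    HasSum (fun m => φ (F.coeff m) * ∏ i, y i ^ m i) (evalAdd φ hφ y hy F) :=
  C0.hasSum_lift _ (equicont_of_bounded hφ hy) _

theorem evalAdd_algHom_monomial (φ : Q →ₐ[A] E) (hφ : Continuous φ) (y : Fin n → E)
    (hy : IsBoundedSubset (monomials y)) (m a) :
    evalAdd (φ : Q →+ E) hφ y hy (monomial m a) = φ a * ∏ i, y i ^ m i :=
  evalAdd_monomial _ _ _ _ _ _

/-- Evaluation of restricted power series over `Q` at a family whose monomials are bounded:
the continuous algebra homomorphism `∑ a_α T^α ↦ ∑ φ(a_α) y^α`. -/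
noncomputable def eval (φ : Q →ₐ[A] E) (hφ : Continuous φ) (y : Fin n → E)
    (hy : IsBoundedSubset (monomials y)) : TateAlgebra n Q →ₐ[A] E where
  toFun := evalAdd (φ : Q →+ E) hφ y hy
  map_one' := by
    refine (congrArg _ one_eq_monomial).trans ((evalAdd_algHom_monomial φ hφ y hy 0 1).trans ?_)
    simp
  map_mul' F G := by
    obtain ⟨ev, hev⟩ : ∃ ev, ev = evalAdd (φ : Q →+ E) hφ y hy := ⟨_, rfl⟩
    have hc : Continuous ev := hev ▸ continuous_evalAdd _ _ _ _
    have hm : ∀ m a, ev (monomial m a) = φ a * ∏ i, y i ^ m i :=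
      hev ▸ evalAdd_algHom_monomial φ hφ y hy
    rw [← hev]
    have key : ∀ m a, ev (monomial m a * G)
        = ev (monomial m a) * ev G := by
      intro m a
      refine DFunLike.congr_fun (addHom_ext
        (S := (ev).comp (AddMonoidHom.mulLeft (monomial m a)))
        (T := (AddMonoidHom.mulLeft (ev (monomial m a))).comp
          (ev)) ?_ ?_ fun k b => ?_) G
      · exact hc.comp (continuous_const_mul _)
      · exact (continuous_const_mul _).comp hc
      · simp only [AddMonoidHom.comp_apply, AddMonoidHom.coe_mulLeft]
        rw [monomial_mul, hm, hm, hm]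
        simp only [map_mul, Finsupp.add_apply, pow_add,
          Finset.prod_mul_distrib]
        ring
    refine DFunLike.congr_fun (addHom_ext
      (S := (ev).comp (AddMonoidHom.mulRight G))
      (T := (AddMonoidHom.mulRight (ev G)).comp
        (ev)) ?_ ?_ fun k b => ?_) F
    · exact hc.comp (continuous_mul_const _)
    · exact (continuous_mul_const _).comp hc
    · simpa using key k b
  map_zero' := map_zero _
  map_add' := map_add _
  commutes' a := by
    refine (congrArg _ (algebraMap_eq_const a)).trans
      ((evalAdd_algHom_monomial φ hφ y hy 0 _).trans ?_)
    simp

variable (φ : Q →ₐ[A] E) (hφ : Continuous φ) (y : Fin n → E) (hy : IsBoundedSubset (monomials y))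

theorem continuous_eval : Continuous (eval φ hφ y hy) :=
  continuous_evalAdd (φ : Q →+ E) hφ y hy

theorem eval_monomial (m a) : eval φ hφ y hy (monomial m a) = φ a * ∏ i, y i ^ m i :=
  evalAdd_algHom_monomial φ hφ y hy m a

@[simp] theorem eval_monomial_zero (a) : eval φ hφ y hy (monomial 0 a) = φ a := by
  rw [eval_monomial]; simp

@[simp] theorem eval_var (i) : eval φ hφ y hy (var i) = y i := by
  classical
  rw [var_eq_monomial, eval_monomial, map_one, one_mul]
  rw [Finset.prod_eq_single i]
  · simp
  · intro j _ hj
    simp [Ne.symm hj]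
  · simp

theorem hasSum_eval (F : TateAlgebra n Q) :
    HasSum (fun m => φ (F.coeff m) * ∏ i, y i ^ m i) (eval φ hφ y hy F) :=
  hasSum_evalAdd (φ : Q →+ E) hφ y hy F

end Eval

/-- Continuous algebra homomorphisms out of a Tate algebra are determined by their restriction to
constants and by their values at the variables. -/
theorem algHom_ext [T2Space E] {s t : TateAlgebra n Q →ₐ[A] E} (hs : Continuous s)
    (ht : Continuous t) (h0 : ∀ a, s (monomial 0 a) = t (monomial 0 a))
    (h1 : ∀ i, s (var i) = t (var i)) : s = t := by
  have := addHom_ext (S := (s : TateAlgebra n Q →+ E)) (T := (t : TateAlgebra n Q →+ E)) hs ht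
    fun m a => by
      simp only [AddMonoidHom.coe_coe]
      rw [monomial_eq_mul, map_mul, map_mul, map_prod, map_prod, h0]
      simp [h1]
  exact AlgHom.ext fun F => DFunLike.congr_fun this F

instance [TopologicalSpace A] [IsTopologicalRing A] [ContinuousSMul A Q] :
    ContinuousSMul A (TateAlgebra n Q) := by
  refine continuousSMul_of_algebraMap _ _ ?_
  have : (algebraMap A (TateAlgebra n Q) : A → _) = fun a => monomial 0 (algebraMap A Q a) :=
    funext algebraMap_eq_const
  rw [this]
  exact (continuous_monomial 0).comp (continuous_algebraMap A Q)

theorem coeff_smul (a : A) (F : TateAlgebra n Q) (m) : (a • F).coeff m = a • F.coeff m := rfl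

theorem coeff_monomial_zero_mul (a : Q) (F : TateAlgebra n Q) (m) :
    (monomial 0 a * F).coeff m = a * F.coeff m := by
  have : monomial 0 a * F = a • F := by
    rw [Algebra.smul_def, algebraMap_self_eq]
  rw [this, coeff_smul, smul_eq_mul]

end TateAlgebra

end TateAlgebraBasic

/-! ### Rational localizations -/

section RationalLocalizationBasic

namespace RationalLocalization

variable {A X : Type*} [CommRing A] [CommRing X] [TopologicalSpace X] [NonarchimedeanRing X]
  [Algebra A X] (f g : X)

theorem continuous_mk : Continuous (mk f g) := continuous_quot_mk

theorem isOpenMap_mk : IsOpenMap (mk f g) := QuotientRing.isOpenMap_coe (rationalIdeal f g)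

theorem mk_surjective : Function.Surjective (mk f g) := Ideal.Quotient.mk_surjective

variable (A) in
/-- The quotient map as an algebra homomorphism. -/
noncomputable def mkₐ : TateAlgebra 1 X →ₐ[A] RationalLocalization f g :=
  { mk f g with commutes' := fun _ => rfl }

theorem mk_eq_zero_iff {F} : mk f g F = 0 ↔ F ∈ rationalIdeal f g := Ideal.Quotient.eq_zero_iff_mem

instance : T2Space (RationalLocalization f g) := by
  have : IsClosed (rationalIdeal f g : Set (TateAlgebra 1 X)) := by
    rw [rationalIdeal, Ideal.coe_closure]; exact isClosed_closure
  have h : IsClosed ((rationalIdeal f g).toAddSubgroup : Set (TateAlgebra 1 X)) := this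
  exact inferInstanceAs (T2Space (TateAlgebra 1 X ⧸ (rationalIdeal f g).toAddSubgroup))

instance [NullComplete X] : NullComplete (RationalLocalization f g) :=
  NullComplete.of_surjective (mk f g : TateAlgebra 1 X →+ RationalLocalization f g)
    (continuous_mk f g) (isOpenMap_mk f g) (mk_surjective f g)

instance [TopologicalSpace A] [IsTopologicalRing A] [ContinuousSMul A X] :
    ContinuousSMul A (RationalLocalization f g) := by
  refine continuousSMul_of_algebraMap _ _ ?_
  exact (continuous_mk f g).comp (continuous_algebraMap A _)

variable (A) in
/-- The canonical map `X → X⟨f/g⟩`. -/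
noncomputable def of : X →ₐ[A] RationalLocalization f g :=
  (mkₐ A f g).comp (TateAlgebra.constHom 1 A X)

theorem of_apply (x : X) : of A f g x = mk f g (TateAlgebra.monomial 0 x) := rfl

theorem continuous_of : Continuous (of A f g) :=
  (continuous_mk f g).comp (TateAlgebra.continuous_monomial 0)

/-- The element `f/g` of `X⟨f/g⟩`. -/
noncomputable def quot : RationalLocalization f g := mk f g (TateAlgebra.var 0)

theorem of_mul_quot : of A f g g * quot f g = of A f g f := by
  rw [← sub_eq_zero, of_apply, of_apply, quot, ← map_mul, ← map_sub, mk_eq_zero_iff, rationalIdeal]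
  rw [← TateAlgebra.algebraMap_self_eq, ← TateAlgebra.algebraMap_self_eq]
  exact subset_closure (Ideal.subset_span (Set.mem_singleton _))

end RationalLocalization

end RationalLocalizationBasic

/-! ### The open mapping theorem over analytic rings -/

section OpenMapping

/-- Every neighbourhood of `0` generates the unit ideal. -/
def NhdsSpanTop (A : Type*) [CommRing A] [TopologicalSpace A] : Prop :=
  ∀ V ∈ 𝓝 (0 : A), Ideal.span V = ⊤

theorem IsAnalyticRing.nhdsSpanTop {A : Type*} [CommRing A] [TopologicalSpace A]
    (h : IsAnalyticRing A) : NhdsSpanTop A := by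
  intro V hV
  have h1 : Ideal.radical (Ideal.span V) = ⊤ := by
    rw [eq_top_iff, ← h, Ideal.span_le]
    intro a ha
    obtain ⟨n, hn⟩ := (Tendsto.eventually ha hV).exists
    exact ⟨n, Ideal.subset_span hn⟩
  exact Ideal.radical_eq_top.1 h1

section Complete

variable {M N : Type*} [AddCommGroup M] [TopologicalSpace M] [AddCommGroup N] [TopologicalSpace N]

/-- The successive approximation half of the open mapping theorem: if the images of all open
subgroups are dense in neighbourhoods of `0`, then they are themselves neighbourhoods of `0`. -/
theorem image_mem_nhds_of_closure_image_mem_nhds [NullComplete M] [T2Space N]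
    [NonarchimedeanAddGroup N] (T : M →+ N) (hT : Continuous T)
    (h : ∀ U : OpenAddSubgroup M, closure (T '' U) ∈ 𝓝 (0 : N)) (U : OpenAddSubgroup M) :
    T '' U ∈ 𝓝 (0 : N) := by
  refine mem_of_superset (h U) fun y hy => ?_
  obtain ⟨W, hWa, hW⟩ := exists_antitone_openAddSubgroup_basis M
  -- successive approximations of `y` by images of elements of `U ⊓ W n`
  have step : ∀ n (z : N), z ∈ closure (T '' (U ⊓ W n : OpenAddSubgroup M)) →
      ∃ x ∈ U ⊓ W n, z - T x ∈ closure (T '' (U ⊓ W (n + 1) : OpenAddSubgroup M)) := by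
    intro n z hz
    have h1 : {w | z - w ∈ closure (T '' (U ⊓ W (n + 1) : OpenAddSubgroup M))} ∈ 𝓝 z := by
      have : Tendsto (fun w => z - w) (𝓝 z) (𝓝 0) := by
        simpa using (continuous_const.sub continuous_id).tendsto (x := z) (f := fun w => z - w)
      exact this (h _)
    obtain ⟨_, hw, x, hx, rfl⟩ := mem_closure_iff_nhds.1 hz _ h1
    exact ⟨x, hx, hw⟩
  have h0 : ∃ x ∈ U, y - T x ∈ closure (T '' (U ⊓ W 0 : OpenAddSubgroup M)) := by
    have h1 : {w | y - w ∈ closure (T '' (U ⊓ W 0 : OpenAddSubgroup M))} ∈ 𝓝 y := by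
      have : Tendsto (fun w => y - w) (𝓝 y) (𝓝 0) := by
        simpa using (continuous_const.sub continuous_id).tendsto (x := y) (f := fun w => y - w)
      exact this (h _)
    obtain ⟨_, hw, x, hx, rfl⟩ := mem_closure_iff_nhds.1 hy _ h1
    exact ⟨x, hx, hw⟩
  obtain ⟨x₀, hx₀, hy₀⟩ := h0
  choose! ξ hξ hξ' using step
  let z : ℕ → N := fun n => Nat.rec (y - T x₀) (fun n z => z - T (ξ n z)) n
  have hz : ∀ n, z n ∈ closure (T '' (U ⊓ W n : OpenAddSubgroup M)) := by
    intro n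
    induction n with
    | zero => exact hy₀
    | succ n ih => exact hξ' n _ ih
  have hnull : Tendsto (fun n => ξ n (z n)) cofinite (𝓝 0) := by
    rw [Nat.cofinite_eq_atTop]
    refine hW.tendsto_right_iff.2 fun k _ => ?_
    filter_upwards [eventually_ge_atTop k] with n hn
    exact hWa hn (hξ n _ (hz n)).2
  have hsum := NullComplete.hasSum hnull
  have hzn : ∀ n, z n = y - T x₀ - T (∑ i ∈ Finset.range n, ξ i (z i)) := by
    intro n
    induction n with
    | zero => simp [z]
    | succ n ih =>
      have : z (n + 1) = z n - T (ξ n (z n)) := rfl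
      rw [this, Finset.sum_range_succ, map_add, ← sub_sub, ← ih]
  have hlim : Tendsto z atTop (𝓝 (y - T x₀ - T (∑' n, ξ n (z n)))) := by
    have := tendsto_const_nhds (x := y - T x₀).sub
      ((hT.tendsto _).comp hsum.tendsto_sum_nat)
    exact this.congr fun n => (hzn n).symm
  have hlim0 : Tendsto z atTop (𝓝 0) := by
    refine null_iff.2 fun V => ?_
    obtain ⟨k, _, hk⟩ := hW.mem_iff.1 ((hT.tendsto' 0 0 (map_zero T)) V.mem_nhds_zero)
    filter_upwards [eventually_ge_atTop k] with n hn
    refine V.isClosed.closure_subset_iff.2 ?_ (hz n)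
    rintro _ ⟨x, hx, rfl⟩
    exact hk (hWa hn hx.2)
  have heq := tendsto_nhds_unique hlim hlim0
  refine ⟨x₀ + ∑' n, ξ n (z n), add_mem hx₀
    (hsum.mem_openAddSubgroup U fun n => (hξ n _ (hz n)).1), ?_⟩
  rw [map_add, eq_comm, ← sub_eq_zero, ← sub_sub]
  exact heq

/-- An additive map for which small values come only from small arguments has closed range. -/
theorem isClosed_range_of_strict [NullComplete M] [T2Space N] [NonarchimedeanAddGroup N]
    [FirstCountableTopology N] (T : M →+ N) (hT : Continuous T)
    (h : ∀ U : OpenAddSubgroup M, ∃ W : OpenAddSubgroup N, ∀ x, T x ∈ W → x ∈ U) :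
    IsClosed (T.range : Set N) := by
  refine isClosed_of_closure_subset fun y hy => ?_
  let T' : M →+ T.range.topologicalClosure :=
    T.codRestrict _ fun x => T.range.le_topologicalClosure ⟨x, rfl⟩
  have hT' : Continuous T' := hT.subtype_mk _
  have : NonarchimedeanAddGroup T.range.topologicalClosure := ⟨fun U hU => by
    rw [nhds_subtype, mem_comap] at hU
    obtain ⟨t, ht, htU⟩ := hU
    obtain ⟨V, hV⟩ := NonarchimedeanAddGroup.is_nonarchimedean t ht
    exact ⟨V.comap (AddSubgroup.subtype _) continuous_subtype_val, fun x hx => htU (hV hx)⟩⟩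
  have key := image_mem_nhds_of_closure_image_mem_nhds T' hT' (fun U => ?_) ⊤
  · have h1 : T'.range = ⊤ := by
      have ho : IsOpen (T'.range : Set T.range.topologicalClosure) :=
        AddSubgroup.isOpen_of_mem_nhds _ (mem_of_superset key fun x ⟨z, _, hz⟩ => ⟨z, hz⟩)
      have hc := AddSubgroup.isClosed_of_isOpen _ ho
      rw [eq_top_iff]
      rintro ⟨z, hz⟩ -
      refine hc.closure_subset ?_
      rw [closure_subtype]
      refine closure_mono ?_ hz
      rintro _ ⟨x, rfl⟩
      exact ⟨T' x, ⟨x, rfl⟩, rfl⟩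
    obtain ⟨x, hx⟩ := (h1 ▸ AddSubgroup.mem_top _ : (⟨y, hy⟩ : T.range.topologicalClosure) ∈ T'.range)
    exact ⟨x, congrArg Subtype.val hx⟩
  · obtain ⟨W, hW⟩ := h U
    rw [nhds_subtype, mem_comap]
    refine ⟨W, W.mem_nhds_zero, ?_⟩
    rintro ⟨z, hz⟩ hzW
    rw [closure_subtype]
    have h2 := mem_closure_iff_nhds.1 hz
    refine mem_closure_iff_nhds.2 fun t ht => ?_
    obtain ⟨_, ⟨hw1, hw2⟩, x, rfl⟩ := h2 (t ∩ W) (inter_mem ht (W.isOpen.mem_nhds hzW))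
    exact ⟨T x, hw1, T' x, ⟨x, hW x hw2, rfl⟩, rfl⟩

end Complete

variable {A : Type*} [CommRing A] [TopologicalSpace A] [IsTopologicalRing A]
variable {M N : Type*} [AddCommGroup M] [TopologicalSpace M] [AddCommGroup N] [TopologicalSpace N]
  [Module A M] [Module A N] [ContinuousSMul A M] [ContinuousSMul A N]

theorem NhdsSpanTop.mem_nhds_of_smul_subset (hA : NhdsSpanTop A) {V : Set A} (hV : V ∈ 𝓝 0)
    {S S' : AddSubgroup N} (hS : (S : Set N) ∈ 𝓝 0) (h : ∀ a ∈ V, ∀ x ∈ S, a • x ∈ S') :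
    (S' : Set N) ∈ 𝓝 0 := by
  have h1 : (1 : A) ∈ Ideal.span V := by rw [hA V hV]; trivial
  obtain ⟨n, u, t, hut⟩ := Submodule.mem_span_set'.1 h1
  have h2 : ∀ i, {x : N | u i • x ∈ S} ∈ 𝓝 (0 : N) := fun i =>
    ((continuous_const_smul (u i)).tendsto' (0 : N) 0 (smul_zero _)) hS
  filter_upwards [iInter_mem.2 h2] with x hx
  have h3 : x = ∑ i, (t i : A) • u i • x := by
    conv_lhs => rw [← one_smul A x, ← hut, Finset.sum_smul]
    exact Finset.sum_congr rfl fun i _ => by rw [smul_smul, smul_eq_mul, mul_comm]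
  change x ∈ S'
  rw [h3]
  exact sum_mem fun i _ => h _ (t i).2 _ (Set.mem_iInter.1 hx i)

theorem NhdsSpanTop.eq_top_of_mem_nhds (hA : NhdsSpanTop A) {S : Submodule A N}
    (hS : (S : Set N) ∈ 𝓝 0) : S = ⊤ := by
  rw [eq_top_iff]
  intro x _
  have h1 : {a : A | a • x ∈ S} ∈ 𝓝 (0 : A) :=
    ((continuous_id.smul continuous_const).tendsto' (0 : A) (0 : N) (zero_smul _ _)) hS
  have h2 : Ideal.span {a : A | a • x ∈ S} ≤ S.comap (LinearMap.toSpanSingleton A N x) :=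
    Ideal.span_le.2 fun a ha => ha
  have h3 : (1 : A) ∈ S.comap (LinearMap.toSpanSingleton A N x) := by
    refine h2 ?_
    rw [hA _ h1]; trivial
  simpa using h3

variable [FirstCountableTopology A]

/-- The open mapping theorem: a continuous linear surjection between complete modules over an
analytic ring is open. -/
theorem NhdsSpanTop.image_mem_nhds (hA : NhdsSpanTop A) [NullComplete M] [NullComplete N]
    (T : M →ₗ[A] N) (hT : Continuous T) (hs : Function.Surjective T) (U : OpenAddSubgroup M) :
    T '' U ∈ 𝓝 (0 : N) := by
  refine image_mem_nhds_of_closure_image_mem_nhds T.toAddMonoidHom hT (fun U => ?_) U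
  obtain ⟨V, hV⟩ := (𝓝 (0 : A)).exists_antitone_basis
  let W : ℕ → AddSubgroup M := fun k =>
    { carrier := {m | ∀ a ∈ V k, a • m ∈ U}
      zero_mem' := fun a _ => by simpa using zero_mem U
      add_mem' := fun hx hy a ha => by simpa using add_mem (hx a ha) (hy a ha)
      neg_mem' := fun hx a ha => by simpa using hx a ha }
  have hW : ∀ m, ∃ k, m ∈ W k := by
    intro m
    have h1 : {a : A | a • m ∈ U} ∈ 𝓝 (0 : A) :=
      ((continuous_id.smul continuous_const).tendsto' (0 : A) (0 : M) (zero_smul _ _)) U.mem_nhds_zero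
    obtain ⟨k, _, hk⟩ := hV.toHasBasis.mem_iff.1 h1
    exact ⟨k, hk⟩
  have := NullComplete.baireSpace (M := N)
  obtain ⟨k, hk⟩ := nonempty_interior_of_iUnion_of_closed
    (f := fun k => (((W k).map T.toAddMonoidHom).topologicalClosure : Set N))
    (fun k => AddSubgroup.isClosed_topologicalClosure _) (by
      refine Set.eq_univ_of_forall fun y => ?_
      obtain ⟨m, rfl⟩ := hs y
      obtain ⟨k, hk⟩ := hW m
      exact Set.mem_iUnion.2 ⟨k, AddSubgroup.le_topologicalClosure _ ⟨m, hk, rfl⟩⟩)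
  have ho : IsOpen (((W k).map T.toAddMonoidHom).topologicalClosure : Set N) := by
    obtain ⟨x, hx⟩ := hk
    exact AddSubgroup.isOpen_of_mem_nhds _ (mem_interior_iff_mem_nhds.1 hx)
  refine hA.mem_nhds_of_smul_subset (hV.mem k) (ho.mem_nhds (zero_mem _))
    (S' := (U.toAddSubgroup.map T.toAddMonoidHom).topologicalClosure) fun a ha x hx => ?_
  refine map_mem_closure (continuous_const_smul a) hx ?_
  rintro _ ⟨m, hm, rfl⟩
  exact ⟨a • m, hm a ha, map_smul T a m⟩

/-- A continuous linear map with closed range between complete modules over an analytic ring is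
open onto its image. -/
theorem NhdsSpanTop.openOntoRange (hA : NhdsSpanTop A) [NullComplete M] [NullComplete N]
    (T : M →ₗ[A] N) (hT : Continuous T) (hc : IsClosed (T.range : Set N)) :
    OpenOntoRange T.toAddMonoidHom := by
  have : NullComplete T.range := NullComplete.of_isClosedEmbedding T.range.subtype.toAddMonoidHom
    hc.isClosedEmbedding_subtypeVal
  intro W
  have h := hA.image_mem_nhds T.rangeRestrict (hT.subtype_mk _) T.surjective_rangeRestrict W
  rw [nhds_subtype, mem_comap] at h
  obtain ⟨t, ht, htW⟩ := h
  refine ⟨t, ht, ?_⟩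
  rintro _ hy ⟨x, rfl⟩
  obtain ⟨z, hz, hzx⟩ := htW (show (⟨T x, ⟨x, rfl⟩⟩ : T.range) ∈ _ from hy)
  exact ⟨z, hz, congrArg Subtype.val hzx⟩

theorem NhdsSpanTop.isOpenMap (hA : NhdsSpanTop A) [NullComplete M] [NullComplete N]
    (T : M →ₗ[A] N) (hT : Continuous T) (hs : Function.Surjective T) : IsOpenMap T := by
  have h := hA.image_mem_nhds T hT hs
  refine IsTopologicalAddGroup.isOpenMap_iff_nhds_zero (f := T.toAddMonoidHom) |>.2 ?_
  intro S hS
  obtain ⟨U, hU⟩ := NonarchimedeanAddGroup.is_nonarchimedean _ (mem_map.1 hS)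
  refine mem_of_superset (h U) ?_
  rintro _ ⟨x, hx, rfl⟩
  exact hU hx

end OpenMapping

/-! ### Bounded sets -/

section Bounded

/-- A subset of a topological module over `A` is bounded if it is absorbed by every neighbourhood
of `0` under multiplication by a neighbourhood of `0` in `A`. -/
def BddOver (A : Type*) {M : Type*} [CommRing A] [TopologicalSpace A] [AddCommGroup M]
    [TopologicalSpace M] [Module A M] (S : Set M) : Prop :=
  ∀ W ∈ 𝓝 (0 : M), ∃ V ∈ 𝓝 (0 : A), ∀ a ∈ V, ∀ s ∈ S, a • s ∈ W

variable {A : Type*} [CommRing A] [TopologicalSpace A]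
variable {M N : Type*} [AddCommGroup M] [TopologicalSpace M] [AddCommGroup N] [TopologicalSpace N]
  [Module A M] [Module A N]

theorem BddOver.mono {S S' : Set M} (h : BddOver A S) (hS : S' ⊆ S) : BddOver A S' := by
  intro W hW
  obtain ⟨V, hV, hVW⟩ := h W hW
  exact ⟨V, hV, fun a ha s hs => hVW a ha s (hS hs)⟩

theorem BddOver.image {S : Set M} (h : BddOver A S) (T : M →ₗ[A] N) (hT : Continuous T) :
    BddOver A (T '' S) := by
  intro W hW
  obtain ⟨V, hV, hVW⟩ := h (T ⁻¹' W) (hT.continuousAt.preimage_mem_nhds (by simpa using hW))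
  refine ⟨V, hV, ?_⟩
  rintro a ha _ ⟨s, hs, rfl⟩
  rw [← map_smul]
  exact hVW a ha s hs

theorem BddOver.pi {r : Type*} [Finite r] {S : Set M} (h : BddOver A S) :
    BddOver A {x : r → M | ∀ i, x i ∈ S} := by
  intro W hW
  rw [nhds_pi, Filter.mem_pi] at hW
  obtain ⟨I, _, t, ht, htW⟩ := hW
  choose V hV hVt using fun i => h (t i) (ht i)
  refine ⟨⋂ i, V i, iInter_mem.2 hV, fun a ha s hs => htW fun i _ => ?_⟩
  exact hVt i a (Set.mem_iInter.1 ha i) _ (hs i)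

theorem BddOver.prod {S : Set M} {S' : Set N} (h : BddOver A S) (h' : BddOver A S') :
    BddOver A (S ×ˢ S') := by
  intro W hW
  obtain ⟨U, hU, U', hU', hUW⟩ := mem_nhds_prod_iff.1 hW
  obtain ⟨V, hV, hVU⟩ := h U hU
  obtain ⟨V', hV', hVU'⟩ := h' U' hU'
  exact ⟨V ∩ V', inter_mem hV hV', fun a ha s hs =>
    hUW ⟨hVU a ha.1 _ hs.1, hVU' a ha.2 _ hs.2⟩⟩

section Ring

variable {X Y : Type*} [CommRing X] [TopologicalSpace X] [Algebra A X]
  [CommRing Y] [TopologicalSpace Y] [Algebra A Y]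

theorem IsBoundedSubset.mono {S S' : Set X} (h : IsBoundedSubset S) (hS : S' ⊆ S) :
    IsBoundedSubset S' := by
  intro W hW
  obtain ⟨V, hV, hVW⟩ := h W hW
  exact ⟨V, hV, (Set.mul_subset_mul_left hS).trans hVW⟩

theorem IsBoundedSubset.bddOver [IsTopologicalRing A] [ContinuousSMul A X] {S : Set X}
    (h : IsBoundedSubset S) : BddOver A S := by
  intro W hW
  obtain ⟨V, hV, hVW⟩ := h W hW
  refine ⟨algebraMap A X ⁻¹' V,
    (continuous_algebraMap A X).continuousAt.preimage_mem_nhds (by simpa using hV), ?_⟩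
  intro a ha s hs
  rw [Algebra.smul_def]
  exact hVW (Set.mul_mem_mul ha hs)

theorem BddOver.isBoundedSubset (hA : NhdsSpanTop A) [NonarchimedeanRing X] [ContinuousSMul A X]
    {S : Set X} (h : BddOver A S) : IsBoundedSubset S := by
  intro U hU
  obtain ⟨W, hW⟩ := NonarchimedeanRing.is_nonarchimedean U hU
  obtain ⟨O, hO⟩ := NonarchimedeanRing.mul_subset W
  obtain ⟨V, hV, hVO⟩ := h O O.mem_nhds_zero
  have h1 : (1 : A) ∈ Ideal.span V := by rw [hA V hV]; trivial
  obtain ⟨n, u, t, hut⟩ := Submodule.mem_span_set'.1 h1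
  have h2 : ∀ i, {x : X | u i • x ∈ O} ∈ 𝓝 (0 : X) := fun i =>
    ((continuous_const_smul (u i)).tendsto' (0 : X) 0 (smul_zero _)) O.mem_nhds_zero
  refine ⟨_, iInter_mem.2 h2, ?_⟩
  rintro _ ⟨x, hx, s, hs, rfl⟩
  refine hW ?_
  have h3 : x * s = ∑ i, (u i • x) * ((t i : A) • s) := by
    conv_lhs => rw [← one_smul A (x * s), ← hut, Finset.sum_smul]
    refine Finset.sum_congr rfl fun i _ => ?_
    rw [smul_mul_smul_comm, smul_eq_mul]
  change x * s ∈ W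
  rw [h3]
  exact sum_mem fun i _ => hO (Set.mul_mem_mul (Set.mem_iInter.1 hx i) (hVO _ (t i).2 _ hs))

theorem IsBoundedSubset.image (hA : NhdsSpanTop A) [IsTopologicalRing A] [NonarchimedeanRing X]
    [ContinuousSMul A X]
    [NonarchimedeanRing Y] [ContinuousSMul A Y] {S : Set X} (h : IsBoundedSubset S)
    (φ : X →ₐ[A] Y) (hφ : Continuous φ) : IsBoundedSubset (φ '' S) :=
  BddOver.isBoundedSubset hA ((h.bddOver (A := A)).image φ.toLinearMap hφ)

theorem isBoundedSubset_singleton [IsTopologicalRing X] (x : X) : IsBoundedSubset ({x} : Set X) := by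
  intro U hU
  refine ⟨{y | y * x ∈ U}, (continuous_mul_const x).continuousAt.preimage_mem_nhds
    (by simpa using hU), ?_⟩
  rw [Set.mul_singleton]
  rintro _ ⟨y, hy, rfl⟩
  exact hy

theorem IsBoundedSubset.mul {S S' : Set X} (h : IsBoundedSubset S) (h' : IsBoundedSubset S') :
    IsBoundedSubset (S * S') := by
  intro U hU
  obtain ⟨V, hV, hVU⟩ := h' U hU
  obtain ⟨V', hV', hVV⟩ := h V hV
  refine ⟨V', hV', ?_⟩
  rw [← mul_assoc]
  exact (Set.mul_subset_mul_right hVV).trans hVU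

theorem IsBoundedSubset.add [IsTopologicalRing X] {S S' : Set X} (h : IsBoundedSubset S)
    (h' : IsBoundedSubset S') : IsBoundedSubset (S + S') := by
  intro U hU
  obtain ⟨W, hW, hWU⟩ := exists_nhds_zero_half hU
  obtain ⟨V, hV, hVU⟩ := h W hW
  obtain ⟨V', hV', hVU'⟩ := h' W hW
  refine ⟨V ∩ V', inter_mem hV hV', ?_⟩
  rintro _ ⟨v, hv, _, ⟨s, hs, s', hs', rfl⟩, rfl⟩
  simp only [mul_add]
  exact hWU _ (hVU (Set.mul_mem_mul hv.1 hs)) _ (hVU' (Set.mul_mem_mul hv.2 hs'))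

theorem IsBoundedSubset.union {S S' : Set X} (h : IsBoundedSubset S) (h' : IsBoundedSubset S') :
    IsBoundedSubset (S ∪ S') := by
  intro U hU
  obtain ⟨V, hV, hVU⟩ := h U hU
  obtain ⟨V', hV', hVU'⟩ := h' U hU
  refine ⟨V ∩ V', inter_mem hV hV', ?_⟩
  rintro _ ⟨v, hv, s, hs | hs, rfl⟩
  · exact hVU (Set.mul_mem_mul hv.1 hs)
  · exact hVU' (Set.mul_mem_mul hv.2 hs)

/-- The additive subgroup generated by a bounded set is bounded. -/
theorem IsBoundedSubset.addClosure [NonarchimedeanRing X] {S : Set X} (h : IsBoundedSubset S) :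
    IsBoundedSubset (AddSubgroup.closure S : Set X) := by
  intro U hU
  obtain ⟨W, hW⟩ := NonarchimedeanRing.is_nonarchimedean U hU
  obtain ⟨V, hV, hVW⟩ := h W W.mem_nhds_zero
  refine ⟨V, hV, ?_⟩
  rintro _ ⟨v, hv, s, hs, rfl⟩
  refine hW ?_
  have : AddSubgroup.closure S ≤ W.toAddSubgroup.comap (AddMonoidHom.mulLeft v) :=
    (AddSubgroup.closure_le _).2 fun s hs => hVW (Set.mul_mem_mul hv hs)
  exact this hs

/-- The closure of a bounded set is bounded. -/
theorem IsBoundedSubset.closure [NonarchimedeanRing X] {S : Set X} (h : IsBoundedSubset S) :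
    IsBoundedSubset (_root_.closure S) := by
  intro U hU
  obtain ⟨W, hW⟩ := NonarchimedeanRing.is_nonarchimedean U hU
  obtain ⟨V, hV, hVW⟩ := h W W.mem_nhds_zero
  refine ⟨V, hV, ?_⟩
  rintro _ ⟨v, hv, s, hs, rfl⟩
  refine hW ?_
  have := map_mem_closure (continuous_const_mul v) hs (t := (W : Set X))
    fun s hs => hVW (Set.mul_mem_mul hv hs)
  rwa [W.isClosed.closure_eq] at this

theorem Submodule.span_le_addClosure (P : Subring X) (S : Set X) :
    (Submodule.span P S : Set X) ⊆ AddSubgroup.closure ((P : Set X) * S) := by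
  intro x hx
  induction hx using Submodule.span_induction with
  | mem x hx => exact AddSubgroup.subset_closure ⟨1, one_mem P, x, hx, one_mul x⟩
  | zero => exact zero_mem _
  | add x y _ _ hx hy => exact add_mem hx hy
  | smul p x _ hx =>
    have : AddSubgroup.closure ((P : Set X) * S) ≤
        (AddSubgroup.closure ((P : Set X) * S)).comap (AddMonoidHom.mulLeft (p : X)) := by
      rw [AddSubgroup.closure_le]
      rintro _ ⟨q, hq, s, hs, rfl⟩
      exact AddSubgroup.subset_closure ⟨p * q, mul_mem p.2 hq, s, hs, mul_assoc _ _ _⟩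
    exact this hx

/-- The module over a bounded subring generated by a bounded set is bounded. -/
theorem IsBoundedSubset.span [NonarchimedeanRing X] {P : Subring X}
    (hP : IsBoundedSubset (P : Set X)) {S : Set X} (hS : IsBoundedSubset S) :
    IsBoundedSubset (Submodule.span P S : Set X) :=
  (hP.mul hS).addClosure.mono (Submodule.span_le_addClosure P S)

theorem isBoundedSubset_finite [NonarchimedeanRing X] {S : Set X} (hS : S.Finite) :
    IsBoundedSubset S := by
  induction S, hS using Set.Finite.induction_on with
  | empty => exact fun U _ => ⟨Set.univ, univ_mem, by simp⟩
  | @insert a S _ _ ih => exact (isBoundedSubset_singleton a).union ih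

/-- Adjoining finitely many integral elements to a bounded subring yields a bounded subring. -/
theorem IsBoundedSubset.adjoin [NonarchimedeanRing X] {P : Subring X}
    (hP : IsBoundedSubset (P : Set X)) {S : Set X} (hS : S.Finite) (hi : ∀ x ∈ S, IsIntegral P x) :
    IsBoundedSubset (Algebra.adjoin P S : Set X) := by
  obtain ⟨t, ht⟩ := fg_adjoin_of_finite hS hi
  have := hP.span (isBoundedSubset_finite t.finite_toSet)
  rw [ht] at this
  exact this

/-- A null family in a nonarchimedean ring is bounded. -/
theorem isBoundedSubset_range_of_null {ι : Type*} [NonarchimedeanRing X] {u : ι → X}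
    (hu : Tendsto u cofinite (𝓝 0)) : IsBoundedSubset (Set.range u) := by
  intro U hU
  obtain ⟨W, hW⟩ := NonarchimedeanRing.is_nonarchimedean U hU
  obtain ⟨O, hO⟩ := NonarchimedeanRing.mul_subset W
  have hfin : {i | u i ∉ O}.Finite := null_iff.1 hu O
  obtain ⟨V, hV, hVU⟩ := isBoundedSubset_finite (hfin.image u) U hU
  refine ⟨V ∩ O, inter_mem hV O.mem_nhds_zero, ?_⟩
  rintro _ ⟨v, hv, _, ⟨i, rfl⟩, rfl⟩
  by_cases hi : u i ∈ O
  · exact hW (hO (Set.mul_mem_mul hv.2 hi))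
  · exact hVU (Set.mul_mem_mul hv.1 ⟨i, hi, rfl⟩)

end Ring

end Bounded

/-! ### Surjectivity by approximation -/

section Approximation

variable {A : Type*} [CommRing A] [TopologicalSpace A]

/-- An open ideal `J` of a subring `P` of `A` whose powers tend to `0`. -/
structure IsAdicPair (P : Subring A) (J : Ideal P) : Prop where
  image_mem_nhds : ((↑) '' (J : Set P) : Set A) ∈ 𝓝 0
  pow_small : ∀ W ∈ 𝓝 (0 : A), ∃ n, ∀ p ∈ J ^ n, (p : A) ∈ W

/-- Every open subring of a Huber ring contains a subring with an adic pair. -/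
theorem exists_isAdicPair [IsHuberRing A] (P₀ : Subring A) (hP₀ : IsOpen (P₀ : Set A)) :
    ∃ (P : Subring A) (J : Ideal P), P ≤ P₀ ∧ IsAdicPair P J := by
  obtain ⟨A₀, I, ho, _, hI⟩ := IsHuberRing.exists_pair_of_definition (A := A)
  have hb : ∀ W ∈ 𝓝 (0 : A), ∃ n, ∀ p ∈ I ^ n, (p : A) ∈ W := by
    intro W hW
    have h1 : ((↑) : A₀ → A) ⁻¹' W ∈ 𝓝 (0 : A₀) :=
      continuous_subtype_val.continuousAt.preimage_mem_nhds (by simpa using hW)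
    obtain ⟨n, _, hn⟩ := hI.hasBasis_nhds_zero.mem_iff.1 h1
    exact ⟨n, fun p hp => hn hp⟩
  obtain ⟨n, hn, hnpos⟩ : ∃ n, (∀ p ∈ I ^ n, (p : A) ∈ P₀) ∧ 0 < n := by
    obtain ⟨n, hn⟩ := hb _ (hP₀.mem_nhds (zero_mem P₀))
    exact ⟨n + 1, fun p hp => hn p (Ideal.pow_le_pow_right n.le_succ hp), n.succ_pos⟩
  let ι : (A₀ ⊓ P₀ : Subring A) →+* A₀ := Subring.inclusion inf_le_left
  refine ⟨A₀ ⊓ P₀, (I ^ n).comap ι, inf_le_right, ?_, ?_⟩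
  · have h1 : ((I ^ n : Ideal A₀) : Set A₀) ∈ 𝓝 (0 : A₀) := hI.hasBasis_nhds_zero.mem_of_mem trivial
    have h2 : ((↑) '' ((I ^ n : Ideal A₀) : Set A₀) : Set A) ∈ 𝓝 (0 : A) := by
      exact ho.isOpenMap_subtype_val.image_mem_nhds h1
    refine mem_of_superset h2 ?_
    rintro _ ⟨p, hp, rfl⟩
    exact ⟨⟨p, p.2, hn p hp⟩, hp, rfl⟩
  · intro W hW
    obtain ⟨m, hm⟩ := hb W hW
    refine ⟨m, fun p hp => hm (ι p) ?_⟩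
    have h1 : ι p ∈ (I ^ n) ^ m := Ideal.le_comap_pow ι m hp
    rw [← pow_mul] at h1
    exact Ideal.pow_le_pow_right (Nat.le_mul_of_pos_left m hnpos) h1

variable [IsTopologicalRing A]
variable {M N : Type*} [AddCommGroup M] [TopologicalSpace M] [AddCommGroup N] [TopologicalSpace N]
  [Module A M] [Module A N] [ContinuousSMul A M] [ContinuousSMul A N]

theorem IsAdicPair.smul_mem_nhds {P : Subring A} {J : Ideal P} (hJ : IsAdicPair P J)
    (hA : NhdsSpanTop A) {V : Submodule P N} (hV : (V : Set N) ∈ 𝓝 0) :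
    ((J • V : Submodule P N) : Set N) ∈ 𝓝 0 := by
  refine hA.mem_nhds_of_smul_subset hJ.image_mem_nhds (S := V.toAddSubgroup)
    (S' := (J • V).toAddSubgroup) hV ?_
  rintro _ ⟨p, hp, rfl⟩ x hx
  exact Submodule.smul_mem_smul hp hx

theorem IsAdicPair.pow_smul_mem_nhds {P : Subring A} {J : Ideal P} (hJ : IsAdicPair P J)
    (hA : NhdsSpanTop A) {V : Submodule P N} (hV : (V : Set N) ∈ 𝓝 0) (n : ℕ) :
    ((J ^ n • V : Submodule P N) : Set N) ∈ 𝓝 0 := by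
  induction n with
  | zero => simpa using hV
  | succ n ih =>
    rw [pow_succ', mul_smul]
    exact hJ.smul_mem_nhds hA ih

theorem IsAdicPair.exists_pow_smul_le {P : Subring A} {J : Ideal P} (hJ : IsAdicPair P J)
    {V : Submodule P N} (hV : BddOver A (V : Set N)) (W : OpenAddSubgroup N) :
    ∃ n, ∀ x ∈ J ^ n • V, x ∈ W := by
  obtain ⟨U, hU, hUW⟩ := hV W W.mem_nhds_zero
  obtain ⟨n, hn⟩ := hJ.pow_small U hU
  refine ⟨n, fun x hx => ?_⟩
  induction hx using Submodule.smul_induction_on' with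
  | smul p hp v hv => exact hUW p (hn p hp) v hv
  | add x _ y _ hx hy => exact add_mem hx hy

/-- A linear map is surjective once, up to a topologically nilpotent error, a bounded open
submodule `V` is contained in the image of a bounded submodule `Q`. -/
theorem IsAdicPair.surjective_of_le_sup {P : Subring A} {J : Ideal P} (hJ : IsAdicPair P J)
    (hA : NhdsSpanTop A) [NullComplete M] [T2Space N] [NonarchimedeanAddGroup N]
    (T : M →ₗ[A] N) (hT : Continuous T) (V : Submodule P N) (hV : (V : Set N) ∈ 𝓝 0)
    (hVb : BddOver A (V : Set N)) (Q : Submodule P M) (hQb : BddOver A (Q : Set M))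
    (h : V ≤ Q.map (T.restrictScalars P) ⊔ J • V) : Function.Surjective T := by
  set T' := T.restrictScalars P
  have h1 : ∀ n, V ≤ Q.map T' ⊔ J ^ n • V := by
    intro n
    induction n with
    | zero => simp
    | succ n ih =>
      refine h.trans (sup_le le_sup_left ?_)
      refine (smul_mono_right J ih).trans ?_
      rw [Submodule.smul_sup, pow_succ', mul_smul]
      exact sup_le_sup_right Submodule.smul_le_right _
  have h2 : ∀ U : OpenAddSubgroup M, closure (T '' U) ∈ 𝓝 (0 : N) := by
    intro U
    obtain ⟨n, hn⟩ := hJ.exists_pow_smul_le hQb U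
    refine mem_of_superset (hJ.pow_smul_mem_nhds hA hV n) fun x hx => ?_
    refine mem_closure_iff_nhds.2 fun t ht => ?_
    have ht' : {y | x - y ∈ t} ∈ 𝓝 (0 : N) :=
      ((continuous_const.sub continuous_id).tendsto' (0 : N) x (sub_zero x)) ht
    obtain ⟨W, hW⟩ := NonarchimedeanAddGroup.is_nonarchimedean _ ht'
    obtain ⟨k, hk⟩ := hJ.exists_pow_smul_le hVb W
    have h3 : J ^ n • V ≤ (J ^ n • Q).map T' ⊔ J ^ k • V := by
      refine (smul_mono_right _ (h1 k)).trans ?_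
      rw [Submodule.smul_sup, Submodule.map_smul'']
      exact sup_le_sup_left Submodule.smul_le_right _
    obtain ⟨_, ⟨q, hq, rfl⟩, e, he, hqe⟩ := Submodule.mem_sup.1 (h3 hx)
    refine ⟨T q, ?_, q, hn q hq, rfl⟩
    have := hW (hk e he)
    have h4 : x - e = T q := by rw [← hqe]; exact add_sub_cancel_right _ _
    change x - e ∈ t at this
    rwa [h4] at this
  have h3 := image_mem_nhds_of_closure_image_mem_nhds T.toAddMonoidHom hT h2 ⊤
  refine LinearMap.range_eq_top.1 (hA.eq_top_of_mem_nhds (mem_of_superset h3 ?_))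
  rintro _ ⟨x, _, rfl⟩
  exact ⟨x, rfl⟩

end Approximation

/-! ### Strictness of multiplication by `g U - f` on Laurent series -/

section Strict

variable {X : Type*} [CommRing X] [TopologicalSpace X] [NonarchimedeanRing X]

/-- Multiplication by `g U - f` on convergent Laurent series `∑ G n U ^ n`, `n ∈ ℤ`. -/
noncomputable def laurentMul (f g : X) : C0 ℤ X →+ C0 ℤ X where
  toFun G := C0.mk (fun n => g * G (n - 1) - f * G n) (by
    have h1 : Tendsto (fun n : ℤ => G (n - 1)) cofinite (𝓝 0) :=
      G.null.comp (sub_left_injective (b := (1 : ℤ))).tendsto_cofinite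
    simpa using (h1.const_mul g).sub (G.null.const_mul f))
  map_zero' := by ext n; simp
  map_add' G H := by ext n; simp; ring

@[simp] theorem laurentMul_apply (f g : X) (G : C0 ℤ X) (n : ℤ) :
    laurentMul f g G n = g * G (n - 1) - f * G n := rfl

theorem continuous_laurentMul (f g : X) : Continuous (laurentMul f g) := by
  refine continuous_of_continuousAt_zero _ ?_
  rw [ContinuousAt, map_zero]
  refine C0.tendsto_iff.2 fun W => ?_
  obtain ⟨V, hV⟩ := NonarchimedeanRing.left_mul_subset W g
  obtain ⟨V', hV'⟩ := NonarchimedeanRing.left_mul_subset W f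
  filter_upwards [C0.basic_mem_nhds (V ⊓ V')] with G hG n
  exact sub_mem (hV (Set.smul_mem_smul_set (hG (n - 1)).1)) (hV' (Set.smul_mem_smul_set (hG n).2))

/-- Multiplication by `g U - f` on Laurent series is strict: if the product is small, then so is
the Laurent series. -/
def StrictPair (f g : X) : Prop :=
  ∀ W : OpenAddSubgroup X, ∃ W' : OpenAddSubgroup X, ∀ G : C0 ℤ X,
    (∀ n, laurentMul f g G n ∈ W') → ∀ n, G n ∈ W

/-- If `(g U - f) F` has coefficients in a bounded open subring `P`, then every coefficient of `F`
is a combination, with the fixed coefficients `a` and `b`, of power-bounded elements. This is the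
Dedekind–Mertens argument: `f F i F j` agrees with `f F (i - 1) F (j + 1)` modulo the `P`-module `N`
generated by the coefficients, so that `f F i` and `g F i` stabilise the closure of `N`. -/
theorem coeff_mem_of_laurentMul_mem (P : Subring X) (hPb : IsBoundedSubset (P : Set X))
    {f g a b : X} (hab : a * f + b * g = 1) (F : C0 ℤ X) (hF : ∀ n, laurentMul f g F n ∈ P) (i : ℤ) :
    ∃ x y : X, IsPowerBoundedElement x ∧ IsPowerBoundedElement y ∧ F i = a * x + b * y := by
  let N : Submodule P X := Submodule.span P (Set.range F)
  let Nc : AddSubgroup X := N.toAddSubgroup.topologicalClosure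
  have hNb : IsBoundedSubset (Nc : Set X) :=
    (hPb.span (isBoundedSubset_range_of_null F.null)).closure
  have hFN : ∀ j, F j ∈ N := fun j => Submodule.subset_span ⟨j, rfl⟩
  have hNNc : ∀ x ∈ N, x ∈ Nc := fun x hx => N.toAddSubgroup.le_topologicalClosure hx
  have hGN : ∀ n j, laurentMul f g F n * F j ∈ N := fun n j =>
    N.smul_mem ⟨_, hF n⟩ (hFN j)
  have step : ∀ i j, f * F i * F j - f * F (i - 1) * F (j + 1) ∈ N := by
    intro i j
    have := N.sub_mem (hGN (j + 1) (i - 1)) (hGN i j)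
    convert this using 1
    simp only [laurentMul_apply, add_sub_cancel_right]
    ring
  have steps : ∀ i j (k : ℕ), f * F i * F j - f * F (i - k) * F (j + k) ∈ N := by
    intro i j k
    induction k with
    | zero => simp
    | succ k ih =>
      have := N.add_mem ih (step (i - k) (j + k))
      convert this using 1
      push_cast
      rw [sub_add_sub_cancel, sub_sub, add_assoc]
  have hcl : ∀ i j, f * F i * F j ∈ Nc := by
    intro i j
    have hz : Tendsto (fun k : ℕ => f * F (i - k) * F (j + k)) atTop (𝓝 0) := by
      have h1 : Tendsto (fun k : ℕ => F (i - k)) atTop (𝓝 0) := by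
        rw [← Nat.cofinite_eq_atTop]
        refine F.null.comp (Function.Injective.tendsto_cofinite fun k l h => ?_)
        simpa using h
      have h2 : Tendsto (fun k : ℕ => F (j + k)) atTop (𝓝 0) := by
        rw [← Nat.cofinite_eq_atTop]
        refine F.null.comp (Function.Injective.tendsto_cofinite fun k l h => ?_)
        simpa using h
      simpa using (h1.const_mul f).mul h2
    have h3 : Tendsto (fun k : ℕ => f * F i * F j - f * F (i - k) * F (j + k)) atTop
        (𝓝 (f * F i * F j)) := by simpa using hz.const_sub (f * F i * F j)
    exact mem_closure_of_tendsto h3 (Eventually.of_forall fun k => steps i j k)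
  have hcl' : ∀ i j, g * F i * F j ∈ Nc := by
    intro i j
    have h1 := Nc.add_mem (hNNc _ (hGN (j + 1) i)) (hcl i (j + 1))
    convert h1 using 1
    simp only [laurentMul_apply, add_sub_cancel_right]
    ring
  -- an element that maps all coefficients into the closure of `N` stabilises it
  have stab : ∀ x, (∀ j, x * F j ∈ Nc) → ∀ y ∈ Nc, x * y ∈ Nc := by
    intro x hx y hy
    have h1 : ∀ y ∈ N, x * y ∈ Nc := by
      intro y hy
      induction hy using Submodule.span_induction with
      | mem y hy => obtain ⟨j, rfl⟩ := hy; exact hx j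
      | zero => simp [Nc.zero_mem]
      | add y z _ _ hy hz => rw [mul_add]; exact Nc.add_mem hy hz
      | smul p y _ hy =>
        have h2 : x * (p • y) = p.1 * (x * y) := by
          change x * (p.1 * y) = _
          ring
        rw [h2]
        exact map_mem_closure (continuous_const_mul p.1) hy fun z hz => N.smul_mem p hz
    have h2 := map_mem_closure (continuous_const_mul x) hy (t := (Nc : Set X)) fun z hz => h1 z hz
    rwa [(AddSubgroup.isClosed_topologicalClosure _).closure_eq] at h2
  have pb : ∀ c : X, (∀ i j, c * F i * F j ∈ Nc) → ∀ i, IsPowerBoundedElement (c * F i) := by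
    intro c hc i
    have h1 : ∀ k : ℕ, (c * F i) ^ k * F i ∈ Nc := by
      intro k
      induction k with
      | zero => simpa using hNNc _ (hFN i)
      | succ k ih =>
        rw [pow_succ', mul_assoc]
        exact stab _ (hc i) _ ih
    refine ((isBoundedSubset_singleton (1 : X)).union
      ((isBoundedSubset_singleton c).mul hNb)).mono ?_
    rintro _ ⟨k, rfl⟩
    rcases k with _ | k
    · left; simp
    · right
      refine ⟨c, rfl, _, h1 k, ?_⟩
      change c * ((c * F i) ^ k * F i) = (c * F i) ^ (k + 1)
      rw [pow_succ]; ring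
  refine ⟨f * F i, g * F i, pb f hcl i, pb g hcl' i, ?_⟩
  linear_combination (-F i) * hab

/-- In a uniform ring in which every neighbourhood of `0` generates the unit ideal, multiplication
by `g U - f` is strict as soon as `f` and `g` generate the unit ideal. -/
theorem strictPair_of_isUniformRing (hX : NhdsSpanTop X) (hu : IsUniformRing X) {P : Subring X}
    (hP : IsRingOfIntegralElements P) {f g : X} (hfg : Ideal.span {f, g} = (⊤ : Ideal X)) :
    StrictPair f g := by
  obtain ⟨a, b, hab⟩ : ∃ a b, a * f + b * g = 1 :=
    Ideal.mem_span_pair.1 (hfg ▸ Submodule.mem_top)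
  have hPb : IsBoundedSubset (P : Set X) := hu.mono hP.powerBounded
  intro W
  have hb : IsBoundedSubset
      ({a} * {x | IsPowerBoundedElement x} + {b} * {x | IsPowerBoundedElement x} : Set X) :=
    ((isBoundedSubset_singleton a).mul hu).add ((isBoundedSubset_singleton b).mul hu)
  obtain ⟨V, hV, hVW⟩ := hb W W.mem_nhds_zero
  have h1 : (1 : X) ∈ Ideal.span V := by rw [hX V hV]; trivial
  obtain ⟨n, u, t, hut⟩ := Submodule.mem_span_set'.1 h1
  obtain ⟨W', hW'⟩ := NonarchimedeanRing.is_nonarchimedean (⋂ i, {x : X | u i * x ∈ P})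
    (iInter_mem.2 fun i => (continuous_const_mul (u i)).tendsto' (0 : X) 0 (mul_zero _)
      (hP.isOpen.mem_nhds (zero_mem P)))
  refine ⟨W', fun G hG n => ?_⟩
  have h2 : ∀ i, (t i : X) * (u i * G n) ∈ W := by
    intro i
    let G' : C0 ℤ X := C0.mk (fun n => u i * G n) (by simpa using G.null.const_mul (u i))
    obtain ⟨x, y, hx, hy, hxy⟩ := coeff_mem_of_laurentMul_mem P hPb hab G' (fun m => by
      have := Set.mem_iInter.1 (hW' (hG m)) i
      have h3 : laurentMul f g G' m = u i * laurentMul f g G m := by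
        simp [G']; ring
      rw [h3]
      exact this) n
    have h4 : u i * G n = a * x + b * y := hxy
    rw [h4]
    exact hVW (Set.mul_mem_mul (t i).2 (Set.add_mem_add (Set.mul_mem_mul rfl hx)
      (Set.mul_mem_mul rfl hy)))
  have h3 : G n = ∑ i, (t i : X) * (u i * G n) := by
    conv_lhs => rw [← one_mul (G n), ← hut, Finset.sum_mul]
    refine Finset.sum_congr rfl fun i _ => ?_
    rw [smul_eq_mul]; ring
  rw [h3]
  exact sum_mem fun i _ => h2 i

/-- Strictness passes to Tate algebras, coefficient by coefficient. -/
theorem StrictPair.tateAlgebra {f g : X} (h : StrictPair f g) (m : ℕ) :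
    StrictPair (TateAlgebra.monomial 0 f : TateAlgebra m X) (TateAlgebra.monomial 0 g) := by
  intro W
  obtain ⟨W₁, _, hW₁⟩ := TateAlgebra.nhds_hasBasis.mem_iff.1 W.mem_nhds_zero
  obtain ⟨W₂, hW₂⟩ := h W₁
  refine ⟨⟨TateAlgebra.basicSubgroup m X W₂,
    AddSubgroup.isOpen_of_mem_nhds _ (TateAlgebra.basicSubgroup_mem_nhds W₂)⟩, fun G hG n => ?_⟩
  refine hW₁ fun k => ?_
  let G' : C0 ℤ X := C0.mk (fun n => (G n).coeff k) (by
    simpa [Function.comp_def] using ((TateAlgebra.continuous_coeff k).tendsto' 0 0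
      (TateAlgebra.coeff_zero k)).comp G.null)
  refine hW₂ G' (fun n => ?_) n
  have := hG n k
  rw [laurentMul_apply, TateAlgebra.coeff_sub, TateAlgebra.coeff_monomial_zero_mul,
    TateAlgebra.coeff_monomial_zero_mul] at this
  exact this

theorem StrictPair.injective [T2Space X] {f g : X} (h : StrictPair f g) :
    Function.Injective (laurentMul f g) := by
  rw [injective_iff_map_eq_zero]
  intro G hG
  ext n
  by_contra hn
  obtain ⟨W, hW⟩ := NonarchimedeanRing.is_nonarchimedean {G n}ᶜ
    (isOpen_compl_singleton.mem_nhds (by simpa using Ne.symm hn))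
  obtain ⟨W', hW'⟩ := h W
  exact hW (hW' G (fun n => by rw [hG]; exact zero_mem W') n) rfl

theorem StrictPair.isClosed_range [NullComplete X] {f g : X} (h : StrictPair f g) :
    IsClosed ((laurentMul f g).range : Set (C0 ℤ X)) := by
  refine isClosed_range_of_strict _ (continuous_laurentMul f g) fun U => ?_
  obtain ⟨W, _, hW⟩ := C0.nhds_hasBasis.mem_iff.1 U.mem_nhds_zero
  obtain ⟨W', hW'⟩ := h W
  exact ⟨⟨C0.basic ℤ W', AddSubgroup.isOpen_of_mem_nhds _ (C0.basic_mem_nhds W')⟩,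
    fun G hG => hW (hW' G hG)⟩

end Strict

/-! ### Power series as one-sided Laurent series -/

section OneSided

theorem C0.equicont_single {ι κ M : Type*} [AddCommGroup M] [TopologicalSpace M]
    [NonarchimedeanAddGroup M] (π : ι → κ) :
    C0.Equicont (fun i => (C0.single (π i) : M →+ C0 κ M)) := by
  intro W
  obtain ⟨W', _, hW'⟩ := C0.nhds_hasBasis.mem_iff.1 W.mem_nhds_zero
  refine ⟨W', fun i m hm => hW' fun k => ?_⟩
  rw [C0.single_apply]
  split_ifs
  exacts [hm, zero_mem W']

/-- Summation of a null family along the fibres of a map of index sets. -/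
noncomputable def C0.map {ι κ : Type*} {M : Type*} [AddCommGroup M] [TopologicalSpace M]
    [NullComplete M] [Countable ι] (π : ι → κ) : C0 ι M →+ C0 κ M :=
  C0.lift _ (C0.equicont_single π)

section C0map

variable {ι κ : Type*} {M : Type*} [AddCommGroup M] [TopologicalSpace M]
    [NullComplete M] [Countable ι]

@[simp] theorem C0.map_single (π : ι → κ) (i : ι) (m : M) :
    C0.map π (C0.single i m) = C0.single (π i) m := C0.lift_single _ _ _ _

theorem C0.continuous_map (π : ι → κ) : Continuous (C0.map π : C0 ι M →+ C0 κ M) :=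
  C0.continuous_lift _ (C0.equicont_single π)

theorem C0.map_apply_of_injective {π : ι → κ} (hπ : Function.Injective π) (u : C0 ι M) (i : ι) :
    C0.map π u (π i) = u i := by
  refine DFunLike.congr_fun (C0.hom_ext (S := (C0.evalHom (π i)).comp (C0.map π))
    (T := C0.evalHom i) ((C0.continuous_evalHom _).comp (C0.continuous_map π))
    (C0.continuous_evalHom _) fun j m => ?_) u
  classical
  simp [C0.single_apply, hπ.eq_iff]

theorem C0.map_apply_of_notMem {π : ι → κ} {k : κ} (hk : ∀ i, π i ≠ k) (u : C0 ι M) :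
    C0.map π u k = 0 := by
  refine DFunLike.congr_fun (C0.hom_ext (S := (C0.evalHom k).comp (C0.map π))
    (T := 0) ((C0.continuous_evalHom _).comp (C0.continuous_map π))
    continuous_const fun j m => ?_) u
  classical
  simp [C0.single_apply, (hk j).symm]

end C0map

variable {X : Type*} [CommRing X] [TopologicalSpace X] [NonarchimedeanRing X]

/-- Exponents of a single variable. -/
noncomputable def natEquivFinsupp : ℕ ≃ (Fin 1 →₀ ℕ) where
  toFun k := Finsupp.single 0 k
  invFun m := m 0
  left_inv k := by simp
  right_inv m := Finsupp.ext fun i => by fin_cases i; simp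

@[simp] theorem natEquivFinsupp_apply (k : ℕ) : natEquivFinsupp k = Finsupp.single 0 k := rfl
@[simp] theorem natEquivFinsupp_symm_apply (m : Fin 1 →₀ ℕ) : natEquivFinsupp.symm m = m 0 := rfl

/-- The power series in one variable with the given null sequence of coefficients. -/
noncomputable def TateAlgebra.ofSeq (u : ℕ → X) (hu : Tendsto u cofinite (𝓝 0)) : TateAlgebra 1 X :=
  (toC0 1 X).symm (C0.mk (fun m => u (m 0)) (hu.comp natEquivFinsupp.symm.injective.tendsto_cofinite))

@[simp] theorem TateAlgebra.coeff_ofSeq (u : ℕ → X) (hu : Tendsto u cofinite (𝓝 0)) (m) :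
    (ofSeq u hu).coeff m = u (m 0) := rfl

theorem TateAlgebra.var_mul_monomial (m : Fin 1 →₀ ℕ) (a : X) :
    (var 0 * monomial m a : TateAlgebra 1 X) = monomial (Finsupp.single 0 1 + m) a := by
  rw [var_eq_monomial, monomial_mul, one_mul]

theorem laurentMul_single (f g : X) (k : ℤ) (a : X) :
    laurentMul f g (C0.single k a) = C0.single (k + 1) (g * a) - C0.single k (f * a) := by
  classical
  ext n
  simp only [laurentMul_apply, C0.sub_apply, C0.single_apply, mul_ite, mul_zero,
    sub_eq_iff_eq_add (b := (1 : ℤ))]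
  congr

variable [NullComplete X]

/-- A power series in `U`, as a Laurent series. -/
noncomputable def posSeries : TateAlgebra 1 X →+ C0 ℤ X :=
  (C0.map fun m : Fin 1 →₀ ℕ => (m 0 : ℤ)).comp (TateAlgebra.toC0 1 X).toAddMonoidHom

/-- A power series in `V = U⁻¹`, as a Laurent series. -/
noncomputable def negSeries : TateAlgebra 1 X →+ C0 ℤ X :=
  (C0.map fun m : Fin 1 →₀ ℕ => -(m 0 : ℤ)).comp (TateAlgebra.toC0 1 X).toAddMonoidHom

/-- The product of `V = U⁻¹` and a power series in `V`, as a Laurent series. -/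
noncomputable def negSeries' : TateAlgebra 1 X →+ C0 ℤ X :=
  (C0.map fun m : Fin 1 →₀ ℕ => -(m 0 : ℤ) - 1).comp (TateAlgebra.toC0 1 X).toAddMonoidHom

theorem continuous_posSeries : Continuous (posSeries (X := X)) :=
  (C0.continuous_map _).comp TateAlgebra.continuous_toC0
theorem continuous_negSeries : Continuous (negSeries (X := X)) :=
  (C0.continuous_map _).comp TateAlgebra.continuous_toC0
theorem continuous_negSeries' : Continuous (negSeries' (X := X)) :=
  (C0.continuous_map _).comp TateAlgebra.continuous_toC0

@[simp] theorem posSeries_monomial (m) (a : X) :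
    posSeries (TateAlgebra.monomial m a) = C0.single (m 0 : ℤ) a := C0.map_single _ m a
@[simp] theorem negSeries_monomial (m) (a : X) :
    negSeries (TateAlgebra.monomial m a) = C0.single (-(m 0 : ℤ)) a := C0.map_single _ m a
@[simp] theorem negSeries'_monomial (m) (a : X) :
    negSeries' (TateAlgebra.monomial m a) = C0.single (-(m 0 : ℤ) - 1) a := C0.map_single _ m a

theorem fin_one_ext {m m' : Fin 1 →₀ ℕ} (h : m 0 = m' 0) : m = m' :=
  Finsupp.ext fun i => by fin_cases i; exact h

theorem posSeries_natCast (F : TateAlgebra 1 X) (m : Fin 1 →₀ ℕ) :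
    posSeries F (m 0 : ℤ) = F.coeff m :=
  C0.map_apply_of_injective (π := fun m : Fin 1 →₀ ℕ => (m 0 : ℤ))
    (fun _ _ h => fin_one_ext (by simpa using h)) _ m

theorem posSeries_of_neg (F : TateAlgebra 1 X) {k : ℤ} (hk : k < 0) : posSeries F k = 0 :=
  C0.map_apply_of_notMem (fun m => by omega) _

theorem negSeries_neg_natCast (F : TateAlgebra 1 X) (m : Fin 1 →₀ ℕ) :
    negSeries F (-(m 0 : ℤ)) = F.coeff m :=
  C0.map_apply_of_injective (π := fun m : Fin 1 →₀ ℕ => -(m 0 : ℤ))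
    (fun _ _ h => fin_one_ext (by simpa using h)) _ m

theorem negSeries_of_pos (F : TateAlgebra 1 X) {k : ℤ} (hk : 0 < k) : negSeries F k = 0 :=
  C0.map_apply_of_notMem (fun m => by omega) _

theorem negSeries'_neg_natCast (F : TateAlgebra 1 X) (m : Fin 1 →₀ ℕ) :
    negSeries' F (-(m 0 : ℤ) - 1) = F.coeff m :=
  C0.map_apply_of_injective (π := fun m : Fin 1 →₀ ℕ => -(m 0 : ℤ) - 1)
    (fun _ _ h => fin_one_ext (by simpa using h)) _ m

theorem negSeries'_of_nonneg (F : TateAlgebra 1 X) {k : ℤ} (hk : 0 ≤ k) : negSeries' F k = 0 :=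
  C0.map_apply_of_notMem (fun m => by omega) _

theorem posSeries_injective : Function.Injective (posSeries (X := X)) := fun F G h =>
  TateAlgebra.ext fun m => by rw [← posSeries_natCast, ← posSeries_natCast, h]

theorem negSeries_injective : Function.Injective (negSeries (X := X)) := fun F G h =>
  TateAlgebra.ext fun m => by rw [← negSeries_neg_natCast, ← negSeries_neg_natCast, h]

/-- Every Laurent series is the sum of a power series in `U` and `V` times a power series in `V`. -/
theorem exists_posSeries_add_negSeries' (G : C0 ℤ X) :
    ∃ H K : TateAlgebra 1 X, G = posSeries H + negSeries' K ∧
      (∀ m, H.coeff m = G (m 0)) ∧ (∀ m, K.coeff m = G (-(m 0 : ℤ) - 1)) := by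
  refine ⟨TateAlgebra.ofSeq (fun k => G (k : ℤ)) (G.null.comp
    (Nat.cast_injective (R := ℤ)).tendsto_cofinite),
    TateAlgebra.ofSeq (fun k => G (-(k : ℤ) - 1)) (G.null.comp
      (Function.Injective.tendsto_cofinite fun a b h => by simpa using h)), ?_,
      fun _ => rfl, fun _ => rfl⟩
  ext k
  rw [C0.add_apply]
  rcases lt_or_ge k 0 with hk | hk
  · obtain ⟨j, rfl⟩ : ∃ j : ℕ, k = -(j : ℤ) - 1 := ⟨(-k - 1).toNat, by omega⟩
    have := negSeries'_neg_natCast (TateAlgebra.ofSeq (fun k => G (-(k : ℤ) - 1)) (G.null.comp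
      (Function.Injective.tendsto_cofinite fun a b h => by simpa using h))) (Finsupp.single 0 j)
    simp only [Finsupp.single_eq_same, TateAlgebra.coeff_ofSeq] at this
    rw [posSeries_of_neg _ hk, this, zero_add]
  · obtain ⟨j, rfl⟩ := Int.eq_ofNat_of_zero_le hk
    have := posSeries_natCast (TateAlgebra.ofSeq (fun k => G (k : ℤ)) (G.null.comp
      (Nat.cast_injective (R := ℤ)).tendsto_cofinite)) (Finsupp.single 0 j)
    simp only [Finsupp.single_eq_same, TateAlgebra.coeff_ofSeq] at this
    rw [negSeries'_of_nonneg _ hk, this, add_zero]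

/-- The linear series `g T - f`. -/
noncomputable def linearSeries (f g : X) : TateAlgebra 1 X :=
  TateAlgebra.monomial 0 g * TateAlgebra.var 0 - TateAlgebra.monomial 0 f

theorem linearSeries_mul_monomial (f g : X) (m) (a : X) :
    linearSeries f g * TateAlgebra.monomial m a =
      TateAlgebra.monomial (Finsupp.single 0 1 + m) (g * a) - TateAlgebra.monomial m (f * a) := by
  rw [linearSeries, sub_mul, mul_assoc, TateAlgebra.var_mul_monomial, TateAlgebra.monomial_mul,
    TateAlgebra.monomial_mul, zero_add, zero_add]

theorem posSeries_linearSeries_mul (f g : X) (H : TateAlgebra 1 X) :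
    posSeries (linearSeries f g * H) = laurentMul f g (posSeries H) := by
  refine DFunLike.congr_fun (TateAlgebra.addHom_ext
    (S := posSeries.comp (AddMonoidHom.mulLeft (linearSeries f g)))
    (T := (laurentMul f g).comp posSeries)
    (continuous_posSeries.comp (continuous_const_mul _))
    ((continuous_laurentMul f g).comp continuous_posSeries) fun m a => ?_) H
  simp only [AddMonoidHom.comp_apply, AddMonoidHom.coe_mulLeft]
  rw [linearSeries_mul_monomial, map_sub, posSeries_monomial, posSeries_monomial, posSeries_monomial,
    laurentMul_single]
  congr 2
  simp [add_comm]

theorem negSeries_linearSeries_mul (f g : X) (H : TateAlgebra 1 X) :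
    negSeries (linearSeries g f * H) = -laurentMul f g (negSeries' H) := by
  refine DFunLike.congr_fun (TateAlgebra.addHom_ext
    (S := negSeries.comp (AddMonoidHom.mulLeft (linearSeries g f)))
    (T := -(laurentMul f g).comp negSeries')
    (continuous_negSeries.comp (continuous_const_mul _))
    ((continuous_laurentMul f g).comp continuous_negSeries').neg fun m a => ?_) H
  simp only [AddMonoidHom.comp_apply, AddMonoidHom.coe_mulLeft, AddMonoidHom.neg_apply]
  rw [linearSeries_mul_monomial, map_sub, negSeries_monomial, negSeries_monomial, negSeries'_monomial,
    laurentMul_single, neg_sub]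
  congr 3
  · simp [add_comm]; ring
  · ring

theorem StrictPair.symm {f g : X} (h : StrictPair f g) : StrictPair g f := by
  intro W
  obtain ⟨W', hW'⟩ := h W
  refine ⟨W', fun G hG n => ?_⟩
  let G' : C0 ℤ X := C0.mk (fun n => -G (-n - 1)) (by
    simpa using (G.null.comp (Function.Injective.tendsto_cofinite
      (f := fun n : ℤ => -n - 1) fun a b h => by simpa using h)).neg)
  have h1 := hW' G' (fun m => by
    have := hG (-m)
    rw [laurentMul_apply] at this ⊢
    convert this using 1
    simp only [G', C0.mk_apply]
    have e : -(m - 1) - 1 = -m := by ring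
    rw [e]; ring) (-n - 1)
  simp only [G', C0.mk_apply] at h1
  have e : -(-n - 1) - 1 = n := by ring
  rw [e] at h1
  simpa using neg_mem h1

/-- For a strict pair the ideal generated by `g T - f` is closed. -/
theorem StrictPair.mem_rationalIdeal_iff {f g : X} (h : StrictPair f g) {F : TateAlgebra 1 X} :
    F ∈ rationalIdeal f g ↔ ∃ H, F = linearSeries f g * H := by
  have hc := isClosed_range_of_strict (AddMonoidHom.mulLeft (linearSeries f g))
    (continuous_const_mul _) fun U => by
      obtain ⟨W, _, hW⟩ := TateAlgebra.nhds_hasBasis.mem_iff.1 U.mem_nhds_zero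
      obtain ⟨W', hW'⟩ := h W
      refine ⟨⟨TateAlgebra.basicSubgroup 1 X W',
        AddSubgroup.isOpen_of_mem_nhds _ (TateAlgebra.basicSubgroup_mem_nhds W')⟩,
        fun H hH => hW fun m => ?_⟩
      rw [← posSeries_natCast]
      refine hW' _ (fun n => ?_) _
      rw [← posSeries_linearSeries_mul]
      rcases lt_or_ge n 0 with hn | hn
      · rw [posSeries_of_neg _ hn]; exact zero_mem W'
      · obtain ⟨j, rfl⟩ := Int.eq_ofNat_of_zero_le hn
        have := hH (Finsupp.single 0 j)
        rw [← posSeries_natCast] at this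
        simpa using this
  have h1 : (Ideal.span {linearSeries f g} : Set (TateAlgebra 1 X))
      = (AddMonoidHom.mulLeft (linearSeries f g)).range := by
    ext F
    simp only [SetLike.mem_coe, Ideal.mem_span_singleton, AddMonoidHom.mem_range,
      AddMonoidHom.coe_mulLeft, Dvd.dvd]
    exact ⟨fun ⟨c, hc⟩ => ⟨c, hc.symm⟩, fun ⟨c, hc⟩ => ⟨c, hc.symm⟩⟩
  have h2 : rationalIdeal f g = Ideal.span {linearSeries f g} := by
    rw [rationalIdeal, TateAlgebra.algebraMap_self_eq, TateAlgebra.algebraMap_self_eq]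
    exact Ideal.closure_eq_of_isClosed _ (h1 ▸ hc)
  rw [h2, Ideal.mem_span_singleton]
  rfl

end OneSided

/-! ### The ring `X⟨f/g, g/f⟩` -/

section Overlap

variable {X : Type*} [CommRing X] [TopologicalSpace X] [NonarchimedeanRing X]

/-- Multiplication of Laurent series by `b U ^ k`. -/
noncomputable def laurentTwist (k : ℤ) (b : X) : C0 ℤ X →+ C0 ℤ X where
  toFun G := C0.mk (fun n => b * G (n - k)) (by
    have h1 : Tendsto (fun n : ℤ => G (n - k)) cofinite (𝓝 0) :=
      G.null.comp (sub_left_injective (b := k)).tendsto_cofinite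
    simpa using h1.const_mul b)
  map_zero' := by ext n; simp
  map_add' G H := by ext n; simp; ring

@[simp] theorem laurentTwist_apply (k : ℤ) (b : X) (G : C0 ℤ X) (n : ℤ) :
    laurentTwist k b G n = b * G (n - k) := rfl

theorem continuous_laurentTwist (k : ℤ) (b : X) : Continuous (laurentTwist k b) := by
  refine continuous_of_continuousAt_zero _ ?_
  rw [ContinuousAt, map_zero]
  refine C0.tendsto_iff.2 fun W => ?_
  obtain ⟨V, hV⟩ := NonarchimedeanRing.left_mul_subset W b
  filter_upwards [C0.basic_mem_nhds V] with G hG n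
  exact hV (Set.smul_mem_smul_set (hG _))

theorem laurentTwist_single (k l : ℤ) (a b : X) :
    laurentTwist k b (C0.single l a) = C0.single (l + k) (b * a) := by
  classical
  ext n
  simp only [laurentTwist_apply, C0.single_apply, mul_ite, mul_zero, sub_eq_iff_eq_add]
  congr

theorem laurentMul_twist (f g : X) (k : ℤ) (b : X) (G : C0 ℤ X) :
    laurentMul f g (laurentTwist k b G) = laurentTwist k b (laurentMul f g G) := by
  ext n
  simp only [laurentMul_apply, laurentTwist_apply]
  have : n - 1 - k = n - k - 1 := by ring
  rw [this]; ring

variable [NullComplete X]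

/-- The map `X⟨U, V⟩ → X⟨U, U⁻¹⟩`, `V ↦ U⁻¹`, as an additive map. -/
noncomputable def toLaurent : TateAlgebra 2 X →+ C0 ℤ X :=
  (C0.map fun m : Fin 2 →₀ ℕ => (m 0 : ℤ) - m 1).comp (TateAlgebra.toC0 2 X).toAddMonoidHom

theorem continuous_toLaurent : Continuous (toLaurent (X := X)) :=
  (C0.continuous_map _).comp TateAlgebra.continuous_toC0

@[simp] theorem toLaurent_monomial (m) (a : X) :
    toLaurent (TateAlgebra.monomial m a) = C0.single ((m 0 : ℤ) - m 1) a := C0.map_single _ m a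

theorem toLaurent_surjective : Function.Surjective (toLaurent (X := X)) := by
  intro G
  let σ : ℤ → (Fin 2 →₀ ℕ) := fun n => Finsupp.single 0 n.toNat + Finsupp.single 1 (-n).toNat
  refine ⟨(TateAlgebra.toC0 2 X).symm (C0.map σ G), ?_⟩
  refine DFunLike.congr_fun (C0.hom_ext
    (S := (toLaurent.comp (TateAlgebra.toC0 2 X).symm.toAddMonoidHom).comp (C0.map σ))
    (T := AddMonoidHom.id _)
    ((continuous_toLaurent.comp TateAlgebra.continuous_toC0_symm).comp (C0.continuous_map σ))
    continuous_id fun n a => ?_) G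
  have h1 : (((σ n) 0 : ℕ) : ℤ) - ((σ n) 1 : ℕ) = n := by
    simp [σ]
  simp only [AddMonoidHom.comp_apply, C0.map_single, AddMonoidHom.id_apply]
  exact (toLaurent_monomial (σ n) a).trans (by rw [h1])

theorem toLaurent_monomial_mul (m) (b : X) (F : TateAlgebra 2 X) :
    toLaurent (TateAlgebra.monomial m b * F) = laurentTwist ((m 0 : ℤ) - m 1) b (toLaurent F) := by
  refine DFunLike.congr_fun (TateAlgebra.addHom_ext
    (S := toLaurent.comp (AddMonoidHom.mulLeft (TateAlgebra.monomial m b)))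
    (T := (laurentTwist ((m 0 : ℤ) - m 1) b).comp toLaurent)
    (continuous_toLaurent.comp (continuous_const_mul _))
    ((continuous_laurentTwist _ _).comp continuous_toLaurent) fun k a => ?_) F
  simp only [AddMonoidHom.comp_apply, AddMonoidHom.coe_mulLeft]
  rw [TateAlgebra.monomial_mul, toLaurent_monomial, toLaurent_monomial, laurentTwist_single]
  congr 2
  simp only [Finsupp.add_apply, Nat.cast_add]
  ring

variable {f g : X}

/-- The kernel of `X⟨U, V⟩ → X⟨U, U⁻¹⟩ / (g U - f)`. -/
noncomputable def overlapIdeal (h : StrictPair f g) : Ideal (TateAlgebra 2 X) where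
  carrier := {F | toLaurent F ∈ (laurentMul f g).range}
  zero_mem' := ⟨0, by simp⟩
  add_mem' hF hG := by
    simp only [Set.mem_ofPred_eq, map_add]
    exact add_mem hF hG
  smul_mem' E F hF := by
    have hcl : IsClosed {E : TateAlgebra 2 X | toLaurent (E * F) ∈ (laurentMul f g).range} :=
      h.isClosed_range.preimage (continuous_toLaurent.comp (continuous_mul_const F))
    refine hcl.mem_of_tendsto E.hasSum_monomial (Eventually.of_forall fun s => ?_)
    simp only [Set.mem_ofPred_eq, Finset.sum_mul, map_sum]
    refine sum_mem fun m _ => ?_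
    obtain ⟨G, hG⟩ := hF
    refine ⟨laurentTwist ((m 0 : ℤ) - m 1) (E.coeff m) G, ?_⟩
    rw [laurentMul_twist, hG, toLaurent_monomial_mul]

theorem isClosed_overlapIdeal (h : StrictPair f g) :
    IsClosed (overlapIdeal h : Set (TateAlgebra 2 X)) :=
  h.isClosed_range.preimage continuous_toLaurent

/-- The ring `X⟨f/g, g/f⟩`, as the quotient of `X⟨U, V⟩` by the kernel of the map to
`X⟨U, U⁻¹⟩ / (g U - f)`; strictness makes this kernel closed. -/
def Overlap (h : StrictPair f g) : Type _ := TateAlgebra 2 X ⧸ overlapIdeal h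

namespace Overlap

variable {A : Type*} [CommRing A] [Algebra A X] (h : StrictPair f g)

noncomputable instance : CommRing (Overlap h) :=
  inferInstanceAs (CommRing (TateAlgebra 2 X ⧸ overlapIdeal h))

noncomputable instance {R : Type*} [CommRing R] [Algebra R X] : Algebra R (Overlap h) :=
  inferInstanceAs (Algebra R (TateAlgebra 2 X ⧸ overlapIdeal h))

instance : TopologicalSpace (Overlap h) :=
  inferInstanceAs (TopologicalSpace (TateAlgebra 2 X ⧸ overlapIdeal h))

/-- The quotient map `X⟨U, V⟩ → X⟨f/g, g/f⟩`. -/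
noncomputable def mk : TateAlgebra 2 X →+* Overlap h := Ideal.Quotient.mk (overlapIdeal h)

theorem mk_surjective : Function.Surjective (mk h) := Ideal.Quotient.mk_surjective

theorem continuous_mk : Continuous (mk h) := continuous_quot_mk

theorem isOpenMap_mk : IsOpenMap (mk h) := QuotientRing.isOpenMap_coe (overlapIdeal h)

theorem mk_eq_zero_iff {F} : mk h F = 0 ↔ toLaurent F ∈ (laurentMul f g).range :=
  Ideal.Quotient.eq_zero_iff_mem

instance : NonarchimedeanRing (Overlap h) where
  toIsTopologicalRing := inferInstanceAs (IsTopologicalRing (TateAlgebra 2 X ⧸ overlapIdeal h))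
  is_nonarchimedean U hU := by
    obtain ⟨V, hV⟩ := NonarchimedeanRing.is_nonarchimedean (mk h ⁻¹' U)
      ((continuous_mk h).continuousAt.preimage_mem_nhds (by simpa using hU))
    refine ⟨⟨V.toAddSubgroup.map (mk h).toAddMonoidHom, isOpenMap_mk h _ V.isOpen⟩, ?_⟩
    rintro _ ⟨x, hx, rfl⟩
    exact hV hx

instance : NullComplete (Overlap h) := by
  have : T2Space (Overlap h) := by
    have h' : IsClosed ((overlapIdeal h).toAddSubgroup : Set (TateAlgebra 2 X)) :=
      isClosed_overlapIdeal h
    exact inferInstanceAs (T2Space (TateAlgebra 2 X ⧸ (overlapIdeal h).toAddSubgroup))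
  exact NullComplete.of_surjective (mk h : TateAlgebra 2 X →+ Overlap h) (continuous_mk h)
    (isOpenMap_mk h) (mk_surjective h)

variable (A) in
/-- The quotient map as an algebra homomorphism. -/
noncomputable def mkₐ : TateAlgebra 2 X →ₐ[A] Overlap h := { mk h with commutes' := fun _ => rfl }

instance [TopologicalSpace A] [IsTopologicalRing A] [ContinuousSMul A X] :
    ContinuousSMul A (Overlap h) :=
  continuousSMul_of_algebraMap _ _ ((continuous_mk h).comp (continuous_algebraMap A _))

variable (A) in
/-- The canonical map `X → X⟨f/g, g/f⟩`. -/
noncomputable def of : X →ₐ[A] Overlap h := (mkₐ A h).comp (TateAlgebra.constHom 2 A X)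

theorem of_apply (x : X) : of A h x = mk h (TateAlgebra.monomial 0 x) := rfl

theorem continuous_of : Continuous (of A h) :=
  (continuous_mk h).comp (TateAlgebra.continuous_monomial 0)

theorem mk_var_mul : mk h (TateAlgebra.var 0) * mk h (TateAlgebra.var 1) = 1 := by
  rw [← map_mul, ← map_one (mk h), ← sub_eq_zero, ← map_sub, mk_eq_zero_iff, map_sub,
    TateAlgebra.var_eq_monomial, TateAlgebra.var_eq_monomial, TateAlgebra.monomial_mul,
    TateAlgebra.one_eq_monomial, toLaurent_monomial, toLaurent_monomial]
  simp [zero_mem]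

/-- The unit `f/g` of `X⟨f/g, g/f⟩`. -/
noncomputable def unit : (Overlap h)ˣ where
  val := mk h (TateAlgebra.var 0)
  inv := mk h (TateAlgebra.var 1)
  val_inv := mk_var_mul h
  inv_val := by rw [mul_comm]; exact mk_var_mul h

theorem of_mul_unit : of A h g * unit h = of A h f := by
  rw [← sub_eq_zero, of_apply, of_apply, unit, ← map_mul, ← map_sub, mk_eq_zero_iff]
  refine ⟨C0.single 0 1, ?_⟩
  rw [laurentMul_single, map_sub, TateAlgebra.var_eq_monomial, TateAlgebra.monomial_mul,
    toLaurent_monomial, toLaurent_monomial]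
  simp

theorem of_mul_unit_inv : of A h f * ((unit h)⁻¹ : (Overlap h)ˣ) = of A h g := by
  rw [← of_mul_unit, mul_assoc, Units.mul_inv, mul_one]

end Overlap

end Overlap

/-! ### Evaluation of Laurent series -/

section LaurentEval

theorem isBoundedSubset_monomials_var (n : ℕ) (X : Type*) [CommRing X] [TopologicalSpace X]
    [NonarchimedeanRing X] :
    IsBoundedSubset (TateAlgebra.monomials (TateAlgebra.var : Fin n → TateAlgebra n X)) := by
  classical
  intro U hU
  obtain ⟨W, _, hW⟩ := TateAlgebra.nhds_hasBasis.mem_iff.1 hU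
  refine ⟨_, TateAlgebra.basicSubgroup_mem_nhds W, ?_⟩
  rintro _ ⟨F, hF, _, ⟨α, rfl⟩, rfl⟩
  refine hW fun m => ?_
  simp only [TateAlgebra.prod_var_pow]
  rw [TateAlgebra.coeff_mul]
  refine sum_mem fun p _ => ?_
  rw [TateAlgebra.coeff_monomial]
  split_ifs
  · rw [mul_one]; exact hF _
  · rw [mul_zero]; exact zero_mem W

theorem IsBoundedSubset.image_of_isOpenMap {X Y : Type*} [CommRing X] [TopologicalSpace X]
    [CommRing Y] [TopologicalSpace Y] {S : Set X} (hS : IsBoundedSubset S) (φ : X →+* Y)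
    (hφ : Continuous φ) (ho : IsOpenMap φ) : IsBoundedSubset (φ '' S) := by
  intro U hU
  obtain ⟨V, hV, hVU⟩ := hS (φ ⁻¹' U) (hφ.continuousAt.preimage_mem_nhds (by simpa using hU))
  refine ⟨φ '' V, by simpa using ho.image_mem_nhds hV, ?_⟩
  rintro _ ⟨_, ⟨v, hv, rfl⟩, _, ⟨s, hs, rfl⟩, rfl⟩
  have := hVU (Set.mul_mem_mul hv hs)
  simpa using this

theorem TateAlgebra.monomials_fin_one {E : Type*} [CommRing E] (y : E) :
    TateAlgebra.monomials (fun _ : Fin 1 => y) = Set.range fun k : ℕ => y ^ k := by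
  ext x
  constructor
  · rintro ⟨α, rfl⟩
    exact ⟨α 0, by simp⟩
  · rintro ⟨k, rfl⟩
    exact ⟨Finsupp.single 0 k, by simp⟩

theorem RationalLocalization.isPowerBoundedElement_quot {X : Type*} [CommRing X]
    [TopologicalSpace X] [NonarchimedeanRing X] (f g : X) :
    IsPowerBoundedElement (quot f g) := by
  refine ((isBoundedSubset_monomials_var 1 X).image_of_isOpenMap _ (continuous_mk f g)
    (isOpenMap_mk f g)).mono ?_
  rintro _ ⟨k, rfl⟩
  refine ⟨_, ⟨Finsupp.single 0 k, rfl⟩, ?_⟩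
  simp [quot]

variable {X E : Type*} [CommRing X] [TopologicalSpace X] [NonarchimedeanRing X]
  [CommRing E] [TopologicalSpace E] [NonarchimedeanRing E] [NullComplete E]
  {A : Type*} [CommRing A] [Algebra A X] [Algebra A E]

/-- A unit all of whose powers, of negative exponent too, form a bounded set. -/
def IsPowerBoundedUnit (w : Eˣ) : Prop := IsBoundedSubset (Set.range fun n : ℤ => ((w ^ n : Eˣ) : E))

theorem Overlap.isPowerBoundedUnit_unit [NullComplete X] {f g : X} (h : StrictPair f g) :
    IsPowerBoundedUnit (unit h) := by
  refine ((isBoundedSubset_monomials_var 2 X).image_of_isOpenMap _ (continuous_mk h)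
    (isOpenMap_mk h)).mono ?_
  rintro _ ⟨n, rfl⟩
  rcases Int.eq_nat_or_neg n with ⟨k, rfl | rfl⟩
  · refine ⟨_, ⟨Finsupp.single 0 k, rfl⟩, ?_⟩
    simp [unit]
  · refine ⟨_, ⟨Finsupp.single 1 k, rfl⟩, ?_⟩
    simp [unit]

theorem IsPowerBoundedUnit.inv {w : Eˣ} (hw : IsPowerBoundedUnit w) : IsPowerBoundedUnit w⁻¹ := by
  refine hw.mono ?_
  rintro _ ⟨n, rfl⟩
  exact ⟨-n, by simp⟩

theorem IsPowerBoundedUnit.val {w : Eˣ} (hw : IsPowerBoundedUnit w) :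
    IsPowerBoundedElement (w : E) := by
  refine hw.mono ?_
  rintro _ ⟨n, rfl⟩
  exact ⟨n, by simp⟩

/-- Evaluation of Laurent series at a power-bounded unit. -/
noncomputable def laurentEval (φ : X →ₐ[A] E) (hφ : Continuous φ) (w : Eˣ)
    (hw : IsPowerBoundedUnit w) : C0 ℤ X →+ E :=
  C0.lift _ (TateAlgebra.equicont_of_bounded (φ := (φ : X →+ E)) hφ hw)

variable (φ : X →ₐ[A] E) (hφ : Continuous φ) (w : Eˣ) (hw : IsPowerBoundedUnit w)

theorem continuous_laurentEval : Continuous (laurentEval φ hφ w hw) :=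
  C0.continuous_lift _ (TateAlgebra.equicont_of_bounded (φ := (φ : X →+ E)) hφ hw)

theorem laurentEval_single (n : ℤ) (a : X) :
    laurentEval φ hφ w hw (C0.single n a) = φ a * (w ^ n : Eˣ) :=
  C0.lift_single _ (TateAlgebra.equicont_of_bounded (φ := (φ : X →+ E)) hφ hw) n a

theorem laurentEval_twist (k : ℤ) (G : C0 ℤ X) :
    laurentEval φ hφ w hw (laurentTwist k 1 G) = (w ^ k : Eˣ) * laurentEval φ hφ w hw G := by
  refine DFunLike.congr_fun (C0.hom_ext
    (S := (laurentEval φ hφ w hw).comp (laurentTwist k 1))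
    (T := (AddMonoidHom.mulLeft ((w ^ k : Eˣ) : E)).comp (laurentEval φ hφ w hw))
    ((continuous_laurentEval φ hφ w hw).comp (continuous_laurentTwist k 1))
    ((continuous_const_mul _).comp (continuous_laurentEval φ hφ w hw)) fun n a => ?_) G
  simp only [AddMonoidHom.comp_apply, AddMonoidHom.coe_mulLeft]
  rw [laurentTwist_single, laurentEval_single, laurentEval_single, one_mul, zpow_add, Units.val_mul]
  ring

variable {f g : X}

theorem laurentEval_laurentMul (hfg : φ g * w = φ f) (G : C0 ℤ X) :
    laurentEval φ hφ w hw (laurentMul f g G) = 0 := by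
  refine DFunLike.congr_fun (C0.hom_ext
    (S := (laurentEval φ hφ w hw).comp (laurentMul f g)) (T := 0)
    ((continuous_laurentEval φ hφ w hw).comp (continuous_laurentMul f g))
    continuous_const fun n a => ?_) G
  simp only [AddMonoidHom.comp_apply, AddMonoidHom.zero_apply]
  rw [laurentMul_single, map_sub, laurentEval_single, laurentEval_single, zpow_add_one,
    Units.val_mul, map_mul, map_mul, ← hfg]
  ring

/-- The universal property of `X⟨f/g⟩`. -/
noncomputable def RationalLocalization.lift (y : E) (hy : IsPowerBoundedElement y)
    (hfg : φ g * y = φ f) : RationalLocalization f g →ₐ[A] E :=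
  Ideal.Quotient.liftₐ (rationalIdeal f g)
    (TateAlgebra.eval φ hφ (fun _ => y) (by rw [TateAlgebra.monomials_fin_one]; exact hy)) <| by
    intro F hF
    set ev := TateAlgebra.eval φ hφ (fun _ : Fin 1 => y)
      (by rw [TateAlgebra.monomials_fin_one]; exact hy) with hev
    have hc : Continuous ev := TateAlgebra.continuous_eval _ _ _ _
    have h1 : ((Ideal.span {algebraMap X (TateAlgebra 1 X) g * TateAlgebra.var 0
        - algebraMap X (TateAlgebra 1 X) f} : Ideal _) : Set (TateAlgebra 1 X)) ⊆ ev ⁻¹' {0} := by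
      have : Ideal.span {algebraMap X (TateAlgebra 1 X) g * TateAlgebra.var 0
        - algebraMap X (TateAlgebra 1 X) f} ≤ RingHom.ker ev := by
        rw [Ideal.span_le, Set.singleton_subset_iff]
        change ev _ = 0
        rw [map_sub, map_mul, TateAlgebra.algebraMap_self_eq, TateAlgebra.algebraMap_self_eq, hev,
          TateAlgebra.eval_var, TateAlgebra.eval_monomial_zero, TateAlgebra.eval_monomial_zero, hfg,
          sub_self]
      exact this
    exact (isClosed_singleton.preimage hc).closure_subset_iff.2 h1 hF

section lift

variable (y : E) (hy : IsPowerBoundedElement y) (hfg : φ g * y = φ f)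

theorem RationalLocalization.lift_mk (F) :
    lift φ hφ y hy hfg (mk f g F) = TateAlgebra.eval φ hφ (fun _ => y)
      (by rw [TateAlgebra.monomials_fin_one]; exact hy) F := rfl

theorem RationalLocalization.continuous_lift : Continuous (lift φ hφ y hy hfg) :=
  continuous_quot_lift _ (TateAlgebra.continuous_eval φ hφ (fun _ : Fin 1 => y)
    (by rw [TateAlgebra.monomials_fin_one]; exact hy))

@[simp] theorem RationalLocalization.lift_of (x : X) :
    lift φ hφ y hy hfg (of A f g x) = φ x := by
  rw [of_apply, lift_mk, TateAlgebra.eval_monomial_zero]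

@[simp] theorem RationalLocalization.lift_quot : lift φ hφ y hy hfg (quot f g) = y := by
  rw [quot, lift_mk, TateAlgebra.eval_var]

theorem RationalLocalization.hasSum_lift (F : TateAlgebra 1 X) :
    HasSum (fun k : ℕ => φ (F.coeff (Finsupp.single 0 k)) * y ^ k)
      (lift φ hφ y hy hfg (mk f g F)) := by
  have := TateAlgebra.hasSum_eval φ hφ (fun _ : Fin 1 => y)
    (by rw [TateAlgebra.monomials_fin_one]; exact hy) F
  rw [← natEquivFinsupp.hasSum_iff] at this
  simpa [Function.comp_def, lift_mk] using this

end lift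

omit [NullComplete E] in
theorem RationalLocalization.algHom_ext [T2Space E] {s t : RationalLocalization f g →ₐ[A] E}
    (hs : Continuous s) (ht : Continuous t) (h0 : ∀ x, s (of A f g x) = t (of A f g x))
    (h1 : s (quot f g) = t (quot f g)) : s = t := by
  have := TateAlgebra.algHom_ext (s := s.comp (mkₐ A f g)) (t := t.comp (mkₐ A f g))
    (hs.comp (continuous_mk f g)) (ht.comp (continuous_mk f g)) h0
    (fun i => by fin_cases i; exact h1)
  ext z
  obtain ⟨F, rfl⟩ := mk_surjective f g z
  exact DFunLike.congr_fun this F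

/-- In an algebra in which `f` and `g` generate the unit ideal, an element `y` with `g y = f` is
unique. -/
theorem eq_of_mul_eq_of_isCoprime {R : Type*} [CommRing R] {f g y z : R} (hfg : IsCoprime f g)
    (hy : g * y = f) (hz : g * z = f) : y = z := by
  obtain ⟨a, b, hab⟩ := hfg
  linear_combination -(y - z) * hab + b * (hy - hz) + a * z * (hy - hz) - a * (y - z) * hz

end LaurentEval

/-! ### The Čech complex of the covering by `X⟨f/g⟩` and `X⟨g/f⟩` -/

section Cech

open RationalLocalization (quot isPowerBoundedElement_quot)

variable {X E : Type*} [CommRing X] [TopologicalSpace X] [NonarchimedeanRing X] [NullComplete X]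
  [CommRing E] [TopologicalSpace E] [NonarchimedeanRing E] [NullComplete E]
  {A : Type*} [CommRing A] [Algebra A X] [Algebra A E] {f g : X} (h : StrictPair f g)

namespace Overlap

variable (A) in
/-- The map from Laurent series to `X⟨f/g, g/f⟩`, `U ↦ f/g`. -/
noncomputable def ofLaurent : C0 ℤ X →+ Overlap h :=
  laurentEval (of A h) (continuous_of h) (unit h) (isPowerBoundedUnit_unit h)

theorem continuous_ofLaurent : Continuous (ofLaurent A h) := continuous_laurentEval _ _ _ _

theorem ofLaurent_single (n : ℤ) (a : X) :
    ofLaurent A h (C0.single n a) = of A h a * (unit h ^ n : (Overlap h)ˣ) :=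
  laurentEval_single _ _ _ _ _ _

theorem ofLaurent_toLaurent (F : TateAlgebra 2 X) : ofLaurent A h (toLaurent F) = mk h F := by
  refine DFunLike.congr_fun (TateAlgebra.addHom_ext
    (S := (ofLaurent A h).comp toLaurent) (T := (mk h : TateAlgebra 2 X →+ Overlap h))
    ((continuous_ofLaurent h).comp continuous_toLaurent) (continuous_mk h) fun m a => ?_) F
  simp only [AddMonoidHom.comp_apply, AddMonoidHom.coe_coe]
  rw [toLaurent_monomial, ofLaurent_single, TateAlgebra.monomial_eq_mul, map_mul,
    Fin.prod_univ_two, map_mul, map_pow, map_pow, zpow_sub, zpow_natCast, zpow_natCast,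
    Units.val_mul, Units.val_pow_eq_pow_val, ← inv_pow, Units.val_pow_eq_pow_val]
  rfl

theorem ofLaurent_surjective : Function.Surjective (ofLaurent A h) := fun x => by
  obtain ⟨F, rfl⟩ := mk_surjective h x
  exact ⟨_, ofLaurent_toLaurent h F⟩

theorem ofLaurent_eq_zero_iff {G : C0 ℤ X} :
    ofLaurent A h G = 0 ↔ G ∈ (laurentMul f g).range := by
  obtain ⟨F, rfl⟩ := toLaurent_surjective G
  rw [ofLaurent_toLaurent, mk_eq_zero_iff]

variable (A) in
/-- The restriction map `X⟨f/g⟩ → X⟨f/g, g/f⟩`. -/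
noncomputable def fst : RationalLocalization f g →ₐ[A] Overlap h :=
  RationalLocalization.lift (of A h) (continuous_of h) (unit h) (isPowerBoundedUnit_unit h).val
    (of_mul_unit h)

variable (A) in
/-- The restriction map `X⟨g/f⟩ → X⟨f/g, g/f⟩`. -/
noncomputable def snd : RationalLocalization g f →ₐ[A] Overlap h :=
  RationalLocalization.lift (of A h) (continuous_of h) ((unit h)⁻¹ : (Overlap h)ˣ)
    (isPowerBoundedUnit_unit h).inv.val (of_mul_unit_inv h)

theorem continuous_fst : Continuous (fst A h) := RationalLocalization.continuous_lift _ _ _ _ _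
theorem continuous_snd : Continuous (snd A h) := RationalLocalization.continuous_lift _ _ _ _ _

@[simp] theorem fst_of (x : X) : fst A h (RationalLocalization.of A f g x) = of A h x :=
  RationalLocalization.lift_of _ _ _ _ _ _
@[simp] theorem snd_of (x : X) : snd A h (RationalLocalization.of A g f x) = of A h x :=
  RationalLocalization.lift_of _ _ _ _ _ _
@[simp] theorem fst_quot : fst A h (quot f g) = unit h :=
  RationalLocalization.lift_quot _ _ _ _ _
@[simp] theorem snd_quot : snd A h (quot g f) = ((unit h)⁻¹ : (Overlap h)ˣ) :=
  RationalLocalization.lift_quot _ _ _ _ _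

theorem fst_mk (F : TateAlgebra 1 X) :
    fst A h (RationalLocalization.mk f g F) = ofLaurent A h (posSeries F) := by
  refine DFunLike.congr_fun (TateAlgebra.addHom_ext
    (S := (fst A h : RationalLocalization f g →+ Overlap h).comp
      (RationalLocalization.mk f g : TateAlgebra 1 X →+ RationalLocalization f g))
    (T := (ofLaurent A h).comp posSeries)
    (show Continuous (fst A h ∘ RationalLocalization.mk f g) from
      (continuous_fst h).comp (RationalLocalization.continuous_mk f g))
    ((continuous_ofLaurent h).comp continuous_posSeries) fun m a => ?_) F
  simp only [AddMonoidHom.comp_apply, AddMonoidHom.coe_coe]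
  rw [posSeries_monomial, ofLaurent_single, TateAlgebra.monomial_eq_mul, map_mul, map_mul,
    Fin.prod_univ_one, map_pow, map_pow, zpow_natCast, Units.val_pow_eq_pow_val]
  congr 1
  · exact fst_of h a
  · rw [← fst_quot (A := A) h]; rfl

theorem snd_mk (F : TateAlgebra 1 X) :
    snd A h (RationalLocalization.mk g f F) = ofLaurent A h (negSeries F) := by
  refine DFunLike.congr_fun (TateAlgebra.addHom_ext
    (S := (snd A h : RationalLocalization g f →+ Overlap h).comp
      (RationalLocalization.mk g f : TateAlgebra 1 X →+ RationalLocalization g f))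
    (T := (ofLaurent A h).comp negSeries)
    (show Continuous (snd A h ∘ RationalLocalization.mk g f) from
      (continuous_snd h).comp (RationalLocalization.continuous_mk g f))
    ((continuous_ofLaurent h).comp continuous_negSeries) fun m a => ?_) F
  simp only [AddMonoidHom.comp_apply, AddMonoidHom.coe_coe]
  rw [negSeries_monomial, ofLaurent_single, TateAlgebra.monomial_eq_mul, map_mul, map_mul,
    Fin.prod_univ_one, map_pow, map_pow, zpow_neg, zpow_natCast, ← inv_pow,
    Units.val_pow_eq_pow_val]
  congr 1
  · exact snd_of h a
  · rw [← snd_quot (A := A) h]; rfl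

/-- Every section over the overlap is a difference of sections over the two pieces. -/
theorem exists_fst_add_snd (x : Overlap h) :
    ∃ a b, x = fst A h a + snd A h b := by
  obtain ⟨G, rfl⟩ := ofLaurent_surjective (A := A) h x
  obtain ⟨H, K, hG, -, -⟩ := exists_posSeries_add_negSeries' G
  refine ⟨RationalLocalization.mk f g H, RationalLocalization.mk g f (TateAlgebra.var 0 * K), ?_⟩
  rw [fst_mk, snd_mk, ← map_add]
  congr 1
  rw [hG]
  congr 1
  refine (DFunLike.congr_fun (TateAlgebra.addHom_ext
    (S := negSeries.comp (AddMonoidHom.mulLeft (TateAlgebra.var 0)))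
    (T := negSeries') (continuous_negSeries.comp (continuous_const_mul _))
    continuous_negSeries' fun m a => ?_) K).symm
  simp only [AddMonoidHom.comp_apply, AddMonoidHom.coe_mulLeft]
  rw [TateAlgebra.var_mul_monomial, negSeries_monomial, negSeries'_monomial]
  congr 1
  simp [add_comm, sub_eq_add_neg]

/-- Sections over the two pieces that agree on the overlap come from a global section. -/
theorem exists_of_fst_eq_snd {a : RationalLocalization f g} {b : RationalLocalization g f}
    (hab : fst A h a = snd A h b) :
    ∃ x : X, RationalLocalization.of A f g x = a ∧ RationalLocalization.of A g f x = b := by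
  obtain ⟨F, rfl⟩ := RationalLocalization.mk_surjective f g a
  obtain ⟨F', rfl⟩ := RationalLocalization.mk_surjective g f b
  rw [fst_mk, snd_mk, ← sub_eq_zero, ← map_sub, ofLaurent_eq_zero_iff] at hab
  obtain ⟨G, hG⟩ := hab
  obtain ⟨H, K, rfl, -, -⟩ := exists_posSeries_add_negSeries' G
  have h1 : posSeries (F - linearSeries f g * H) = negSeries (F' - linearSeries g f * K) := by
    rw [map_sub, map_sub, posSeries_linearSeries_mul, negSeries_linearSeries_mul, sub_neg_eq_add,
      sub_eq_iff_eq_add, add_assoc, add_comm (laurentMul f g (negSeries' K)), ← map_add, hG]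
    abel
  set P := F - linearSeries f g * H with hP
  set N := F' - linearSeries g f * K with hN
  have h2 : posSeries P = C0.single 0 (posSeries P 0) := by
    classical
    ext n
    rw [C0.single_apply]
    split_ifs with hn
    · rw [hn]
    · rcases lt_or_gt_of_ne hn with hn | hn
      · exact posSeries_of_neg _ hn
      · rw [h1]; exact negSeries_of_pos _ hn
  have h3 : P = TateAlgebra.monomial 0 (posSeries P 0) := by
    refine posSeries_injective ?_
    rw [posSeries_monomial]
    exact h2
  have h4 : N = TateAlgebra.monomial 0 (posSeries P 0) := by
    refine negSeries_injective ?_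
    rw [negSeries_monomial, ← h1]
    simpa using h2
  refine ⟨posSeries P 0, ?_, ?_⟩
  · rw [RationalLocalization.of_apply, ← h3, hP, eq_comm, ← sub_eq_zero, ← map_sub,
      RationalLocalization.mk_eq_zero_iff, h.mem_rationalIdeal_iff]
    exact ⟨H, by abel⟩
  · rw [RationalLocalization.of_apply, ← h4, hN, eq_comm, ← sub_eq_zero, ← map_sub,
      RationalLocalization.mk_eq_zero_iff, h.symm.mem_rationalIdeal_iff]
    exact ⟨K, by abel⟩

include h in
/-- A global section vanishes if it vanishes on both pieces. -/
theorem eq_zero_of_of_eq_zero {x : X} (h1 : RationalLocalization.of A f g x = 0)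
    (h2 : RationalLocalization.of A g f x = 0) : x = 0 := by
  rw [RationalLocalization.of_apply, RationalLocalization.mk_eq_zero_iff] at h1 h2
  obtain ⟨H, hH⟩ := h.mem_rationalIdeal_iff.1 h1
  obtain ⟨K, hK⟩ := h.symm.mem_rationalIdeal_iff.1 h2
  have e1 : C0.single 0 x = laurentMul f g (posSeries H) := by
    rw [← posSeries_linearSeries_mul, ← hH, posSeries_monomial]; rfl
  have e2 : C0.single 0 x = -laurentMul f g (negSeries' K) := by
    rw [← negSeries_linearSeries_mul, ← hK, negSeries_monomial]; rfl
  have e3 : posSeries H + negSeries' K = 0 := by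
    refine h.injective ?_
    rw [map_add, map_zero, ← e1, e2, neg_add_cancel]
  have e4 : posSeries H = 0 := by
    ext n
    rcases lt_or_ge n 0 with hn | hn
    · exact posSeries_of_neg _ hn
    · have := DFunLike.congr_fun e3 n
      simpa [negSeries'_of_nonneg _ hn] using this
  rw [e4, map_zero] at e1
  have := DFunLike.congr_fun e1 0
  simpa using this

theorem algHom_ext {s t : Overlap h →ₐ[A] E} (hs : Continuous s) (ht : Continuous t)
    (h0 : ∀ x, s (of A h x) = t (of A h x)) (h1 : s (unit h) = t (unit h)) : s = t := by
  have h2 : s ((unit h)⁻¹ : (Overlap h)ˣ) = t ((unit h)⁻¹ : (Overlap h)ˣ) := by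
    have e1 : s (unit h) * s ((unit h)⁻¹ : (Overlap h)ˣ) = 1 := by rw [← map_mul]; simp
    have e2 : t (unit h) * t ((unit h)⁻¹ : (Overlap h)ˣ) = 1 := by rw [← map_mul]; simp
    rw [← h1] at e2
    calc s ((unit h)⁻¹ : (Overlap h)ˣ) = s ((unit h)⁻¹ : (Overlap h)ˣ) * 1 := (mul_one _).symm
      _ = (s (unit h) * s ((unit h)⁻¹ : (Overlap h)ˣ)) * t ((unit h)⁻¹ : (Overlap h)ˣ) := by
        rw [← e2]; ring
      _ = _ := by rw [e1, one_mul]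
  have := TateAlgebra.algHom_ext (s := s.comp (mkₐ A h)) (t := t.comp (mkₐ A h))
    (hs.comp (continuous_mk h)) (ht.comp (continuous_mk h)) h0
    (fun i => by
      fin_cases i
      · exact h1
      · exact h2)
  ext z
  obtain ⟨F, rfl⟩ := mk_surjective h z
  exact DFunLike.congr_fun this F

section lift

variable (φ : X →ₐ[A] E) (hφ : Continuous φ) (w : Eˣ) (hw : IsPowerBoundedUnit w)
  (hfg : φ g * w = φ f)

theorem _root_.IsPowerBoundedUnit.isBoundedSubset_monomials {w : Eˣ} (hw : IsPowerBoundedUnit w) :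
    IsBoundedSubset (TateAlgebra.monomials ![(w : E), (w⁻¹ : Eˣ)]) := by
  refine hw.mono ?_
  rintro _ ⟨m, rfl⟩
  refine ⟨(m 0 : ℤ) - m 1, ?_⟩
  simp [zpow_sub]

/-- The universal property of `X⟨f/g, g/f⟩`. -/
noncomputable def lift : Overlap h →ₐ[A] E :=
  Ideal.Quotient.liftₐ (overlapIdeal h)
    (TateAlgebra.eval φ hφ ![(w : E), (w⁻¹ : Eˣ)] hw.isBoundedSubset_monomials) <| by
    intro F hF
    obtain ⟨G, hG⟩ := hF
    have h1 : TateAlgebra.eval φ hφ ![(w : E), (w⁻¹ : Eˣ)] hw.isBoundedSubset_monomials F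
        = laurentEval φ hφ w hw (toLaurent F) := by
      refine DFunLike.congr_fun (TateAlgebra.addHom_ext
        (S := (TateAlgebra.eval φ hφ ![(w : E), (w⁻¹ : Eˣ)] hw.isBoundedSubset_monomials :
          TateAlgebra 2 X →+ E))
        (T := (laurentEval φ hφ w hw).comp toLaurent)
        (TateAlgebra.continuous_eval φ hφ _ hw.isBoundedSubset_monomials)
        ((continuous_laurentEval φ hφ w hw).comp continuous_toLaurent) fun m a => ?_) F
      simp only [AddMonoidHom.comp_apply, AddMonoidHom.coe_coe]
      rw [toLaurent_monomial, laurentEval_single, TateAlgebra.eval_monomial]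
      simp [zpow_sub]
    rw [h1, ← hG, laurentEval_laurentMul φ hφ w hw hfg]

theorem continuous_lift : Continuous (lift h φ hφ w hw hfg) :=
  continuous_quot_lift _ (TateAlgebra.continuous_eval φ hφ _ hw.isBoundedSubset_monomials)

@[simp] theorem lift_of (x : X) : lift h φ hφ w hw hfg (of A h x) = φ x := by
  have : lift h φ hφ w hw hfg (of A h x) = TateAlgebra.eval φ hφ ![(w : E), (w⁻¹ : Eˣ)]
    hw.isBoundedSubset_monomials (TateAlgebra.monomial 0 x) := rfl
  rw [this, TateAlgebra.eval_monomial_zero]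

@[simp] theorem lift_unit : lift h φ hφ w hw hfg (unit h) = w := by
  have : lift h φ hφ w hw hfg (unit h) = TateAlgebra.eval φ hφ ![(w : E), (w⁻¹ : Eˣ)]
    hw.isBoundedSubset_monomials (TateAlgebra.var 0) := rfl
  rw [this, TateAlgebra.eval_var]; rfl

@[simp] theorem lift_unit_inv : lift h φ hφ w hw hfg ((unit h)⁻¹ : (Overlap h)ˣ) = (w⁻¹ : Eˣ) := by
  have h1 : (w : E) * lift h φ hφ w hw hfg ((unit h)⁻¹ : (Overlap h)ˣ) = 1 := by
    rw [← lift_unit h φ hφ w hw hfg, ← map_mul, Units.mul_inv, map_one]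
  exact Units.eq_inv_of_mul_eq_one_left h1

end lift

variable (A) in
/-- The isomorphism `X⟨f/g, g/f⟩ → X⟨g/f, f/g⟩`. -/
noncomputable def swap : Overlap h →ₐ[A] Overlap h.symm :=
  lift h (of A h.symm) (continuous_of _) (unit h.symm)⁻¹ (isPowerBoundedUnit_unit _).inv
    (of_mul_unit_inv h.symm)

theorem continuous_swap : Continuous (swap A h) := continuous_lift _ _ _ _ _ _

@[simp] theorem swap_of (x : X) : swap A h (of A h x) = of A h.symm x := lift_of _ _ _ _ _ _ _

@[simp] theorem swap_unit : swap A h (unit h) = ((unit h.symm)⁻¹ : (Overlap h.symm)ˣ) :=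
  lift_unit _ _ _ _ _ _

@[simp] theorem swap_unit_inv : swap A h ((unit h)⁻¹ : (Overlap h)ˣ) = unit h.symm := by
  rw [swap, lift_unit_inv, inv_inv]

theorem swap_swap (x : Overlap h) : swap A h.symm (swap A h x) = x := by
  have : (swap A h.symm).comp (swap A h) = AlgHom.id A (Overlap h) := by
    refine algHom_ext h (s := (swap A h.symm).comp (swap A h)) (t := AlgHom.id A (Overlap h))
      (show Continuous (swap A h.symm ∘ swap A h) from
        (continuous_swap h.symm).comp (continuous_swap h)) continuous_id (fun x => ?_) ?_
    · rw [AlgHom.comp_apply, swap_of]; exact swap_of h.symm x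
    · rw [AlgHom.comp_apply, swap_unit]; exact swap_unit_inv h.symm
  exact DFunLike.congr_fun this x

theorem swap_fst (a : RationalLocalization f g) : swap A h (fst A h a) = snd A h.symm a := by
  have : (swap A h).comp (fst A h) = snd A h.symm := by
    refine RationalLocalization.algHom_ext ((continuous_swap _).comp (continuous_fst _))
      (continuous_snd _) (fun x => by simp) ?_
    simp [swap]
  exact DFunLike.congr_fun this a

end Overlap

end Cech

/-! ### Relations between the powers of `g/f` over `X⟨f/g⟩` -/

section Relations

open RationalLocalization (quot isPowerBoundedElement_quot)

variable {X : Type*} [CommRing X] [TopologicalSpace X] [NonarchimedeanRing X] [NullComplete X]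
  {A : Type*} [CommRing A] [Algebra A X] {f g : X} (h : StrictPair f g)

theorem laurentTwist_posSeries (k : ℕ) (F : TateAlgebra 1 X) :
    laurentTwist k 1 (posSeries F) = posSeries (TateAlgebra.var 0 ^ k * F) := by
  refine DFunLike.congr_fun (TateAlgebra.addHom_ext
    (S := (laurentTwist k 1).comp posSeries)
    (T := posSeries.comp (AddMonoidHom.mulLeft (TateAlgebra.var 0 ^ k)))
    ((continuous_laurentTwist _ _).comp continuous_posSeries)
    (continuous_posSeries.comp (continuous_const_mul _)) fun m a => ?_) F
  simp only [AddMonoidHom.comp_apply, AddMonoidHom.coe_mulLeft]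
  rw [TateAlgebra.var_pow, TateAlgebra.monomial_mul, posSeries_monomial, posSeries_monomial,
    laurentTwist_single]
  simp [add_comm]

theorem laurentTwist_laurentTwist (k l : ℤ) (G : C0 ℤ X) :
    laurentTwist k 1 (laurentTwist l 1 G) = laurentTwist (k + l) 1 G := by
  ext n
  simp only [laurentTwist_apply, one_mul]
  congr 1
  ring

/-- A null sequence `β` in `X⟨f/g⟩` with `∑ β n (g/f)ⁿ = 0` on the overlap comes from the relation
`(f/g) (g/f) = 1`: writing `β n = γ n - (f/g) γ (n - 1)`, the sequence `γ` is null. For the proof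
`∑ β n Uⁿ⁻ⁱ` is a multiple of `g U - f`, so that up to such multiples the part with nonnegative
exponents is the negative of the part with negative exponents, which tends to `0`. -/
theorem Overlap.tendsto_sum_quot_pow_mul {β : ℕ → RationalLocalization f g}
    (hβ : Tendsto β cofinite (𝓝 0))
    (hs : HasSum (fun n => fst A h (β n) * (((unit h)⁻¹ : (Overlap h)ˣ) : Overlap h) ^ n) 0) :
    Tendsto (fun n => ∑ i ∈ Finset.range (n + 1), quot f g ^ (n - i) * β i) atTop (𝓝 0) := by
  obtain ⟨b, hb, hbβ⟩ := (OpenOntoRange.of_isOpenMap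
    (T := (RationalLocalization.mk f g).toAddMonoidHom)
    (RationalLocalization.isOpenMap_mk f g)).exists_null_lift hβ
    (fun i => RationalLocalization.mk_surjective f g (β i))
  replace hbβ : ∀ i, RationalLocalization.mk f g (b i) = β i := hbβ
  have hpos : Tendsto (fun i => posSeries (b i)) cofinite (𝓝 0) := by
    simpa [Function.comp_def] using (continuous_posSeries.tendsto 0).comp hb
  have hnull : Tendsto (fun i : ℕ => laurentTwist (-i : ℤ) 1 (posSeries (b i))) cofinite (𝓝 0) := by
    refine C0.tendsto_iff.2 fun W => ?_
    filter_upwards [C0.tendsto_iff.1 hpos W] with i hi n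
    rw [laurentTwist_apply, one_mul]
    exact hi _
  obtain ⟨Γ, hΓ⟩ := NullComplete.summable hnull
  have hΓ0 : ofLaurent A h Γ = 0 := by
    refine (hΓ.map (ofLaurent A h) (continuous_ofLaurent h)).unique ?_
    convert hs using 1
    ext i
    rw [Function.comp_apply, ofLaurent, laurentEval_twist, ← ofLaurent, ← fst_mk, hbβ, mul_comm,
      zpow_neg, zpow_natCast, ← inv_pow, Units.val_pow_eq_pow_val]
  obtain ⟨G, hG⟩ := (ofLaurent_eq_zero_iff h).1 hΓ0
  have split : ∀ n : ℕ, ∃ H K, laurentTwist n 1 G = posSeries H + negSeries' K ∧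
      ∀ m, K.coeff m = G (-(m 0 : ℤ) - 1 - n) := fun n => by
    obtain ⟨H, K, h1, h2, h3⟩ := exists_posSeries_add_negSeries' (laurentTwist n 1 G)
    exact ⟨H, K, h1, fun m => by rw [h3, laurentTwist_apply, one_mul]⟩
  choose H K hHK hK using split
  let s : ℕ → TateAlgebra 1 X := fun n =>
    ∑ i ∈ Finset.range (n + 1), TateAlgebra.var 0 ^ (n - i) * b i
  have hsβ : ∀ n, RationalLocalization.mk f g (s n - linearSeries f g * H n)
      = ∑ i ∈ Finset.range (n + 1), quot f g ^ (n - i) * β i := fun n => by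
    have h1 : RationalLocalization.mk f g (linearSeries f g * H n) = 0 :=
      (RationalLocalization.mk_eq_zero_iff f g).2 (h.mem_rationalIdeal_iff.2 ⟨_, rfl⟩)
    rw [map_sub, h1, sub_zero, map_sum]
    refine Finset.sum_congr rfl fun i _ => ?_
    rw [map_mul, map_pow, hbβ]; rfl
  have hK0 : Tendsto (fun n => negSeries' (K n)) atTop (𝓝 0) := by
    refine C0.tendsto_iff.2 fun W => ?_
    have hfin : {k | G k ∉ W}.Finite := null_iff.1 G.null W
    obtain ⟨c, hc⟩ := hfin.bddBelow
    filter_upwards [eventually_ge_atTop (-c).toNat] with n hn k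
    rcases lt_or_ge k 0 with hk | hk
    · obtain ⟨j, rfl⟩ : ∃ j : ℕ, k = -(j : ℤ) - 1 := ⟨(-k - 1).toNat, by omega⟩
      have := negSeries'_neg_natCast (K n) (Finsupp.single 0 j)
      rw [Finsupp.single_eq_same] at this
      rw [this, hK]
      by_contra hkW
      have := hc hkW
      simp only [Finsupp.single_eq_same] at this
      omega
    · rw [negSeries'_of_nonneg _ hk]; exact zero_mem W
  -- the terms of index `> n` of the sum defining `Γ`
  have htail : ∀ W : OpenAddSubgroup X, ∀ᶠ n : ℕ in atTop, ∀ k,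
      (laurentTwist n 1 Γ - posSeries (s n)) k ∈ W := fun W => by
    have hfin : {i | ¬ ∀ k, posSeries (b i) k ∈ W}.Finite := C0.tendsto_iff.1 hpos W
    obtain ⟨c, hc⟩ := hfin.bddAbove
    filter_upwards [eventually_ge_atTop c] with n hn k
    have h1 := (hΓ.map (laurentTwist n 1) (continuous_laurentTwist n 1)).sub
      (hasSum_sum_of_ne_finset_zero (f := fun i => if i ∈ Finset.range (n + 1) then
        posSeries (TateAlgebra.var 0 ^ (n - i) * b i) else 0) (s := Finset.range (n + 1))
        (fun i hi => if_neg hi))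
    have h2 : ∑ i ∈ Finset.range (n + 1), (if i ∈ Finset.range (n + 1) then
        posSeries (TateAlgebra.var 0 ^ (n - i) * b i) else 0) = posSeries (s n) := by
      rw [map_sum]
      exact Finset.sum_congr rfl fun i hi => if_pos hi
    rw [h2] at h1
    refine (h1.map (C0.evalHom k) (C0.continuous_evalHom k)).mem_openAddSubgroup W fun i => ?_
    rw [Function.comp_apply, Function.comp_apply, laurentTwist_laurentTwist]
    split_ifs with hi
    · have h3 : (n : ℤ) + -i = (n - i : ℕ) := by
        have := Finset.mem_range.1 hi
        omega
      rw [h3, laurentTwist_posSeries, sub_self, map_zero]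
      exact zero_mem W
    · rw [sub_zero, C0.evalHom_apply, laurentTwist_apply, one_mul]
      by_contra hiW
      refine hi (Finset.mem_range.2 (Nat.lt_succ_of_le ((hc fun h4 => hiW (h4 _)).trans hn)))
  have hkey : ∀ n, posSeries (s n - linearSeries f g * H n)
      = laurentMul f g (negSeries' (K n)) - (laurentTwist n 1 Γ - posSeries (s n)) := fun n => by
    rw [map_sub, posSeries_linearSeries_mul, ← hG, ← laurentMul_twist, hHK, map_add]
    abel
  have hrem : Tendsto (fun n => s n - linearSeries f g * H n) atTop (𝓝 0) := by
    have h1 : Tendsto (fun n => posSeries (s n - linearSeries f g * H n)) atTop (𝓝 0) := by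
      simp only [hkey]
      have h2 : Tendsto (fun n => laurentMul f g (negSeries' (K n))) atTop (𝓝 0) := by
        simpa [Function.comp_def] using ((continuous_laurentMul f g).tendsto 0).comp hK0
      simpa using h2.sub (C0.tendsto_iff.2 htail)
    refine TateAlgebra.nhds_hasBasis.tendsto_right_iff.2 fun W _ => ?_
    filter_upwards [C0.tendsto_iff.1 h1 W] with n hn m
    have := hn (m 0)
    rwa [posSeries_natCast] at this
  have := ((RationalLocalization.continuous_mk f g).tendsto 0).comp hrem
  simpa [Function.comp_def, hsβ] using this

/-- A section over the overlap is a power series in `g/f` over `X⟨f/g⟩`. -/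
theorem Overlap.exists_hasSum (x : Overlap h) : ∃ a : ℕ → RationalLocalization f g,
    Tendsto a cofinite (𝓝 0) ∧
      HasSum (fun n => fst A h (a n) * (((unit h)⁻¹ : (Overlap h)ˣ) : Overlap h) ^ n) x := by
  obtain ⟨a, b, rfl⟩ := exists_fst_add_snd (A := A) h x
  obtain ⟨F, rfl⟩ := RationalLocalization.mk_surjective g f b
  have h1 := RationalLocalization.hasSum_lift (of A h) (continuous_of h)
    ((unit h)⁻¹ : (Overlap h)ˣ) (isPowerBoundedUnit_unit h).inv.val (of_mul_unit_inv h) F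
  have h2 : Tendsto (fun k : ℕ => F.coeff (Finsupp.single 0 k)) cofinite (𝓝 0) :=
    F.coeff_null.comp natEquivFinsupp.injective.tendsto_cofinite
  refine ⟨fun n => (if n = 0 then a else 0) +
    RationalLocalization.of A f g (F.coeff (Finsupp.single 0 n)), ?_, ?_⟩
  · have h3 : Tendsto (fun n : ℕ => if n = 0 then a else 0) cofinite (𝓝 0) :=
      tendsto_nhds_of_eventually_eq <| by
        filter_upwards [(Set.finite_singleton (0 : ℕ)).compl_mem_cofinite] with n hn
        exact if_neg hn
    have h4 := ((RationalLocalization.continuous_of (A := A) f g).tendsto 0).comp h2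
    rw [map_zero] at h4
    simpa using h3.add h4
  · have h3 : HasSum (fun n : ℕ => if n = 0 then fst A h a else 0) (fst A h a) :=
      hasSum_ite_eq 0 _
    have h4 := h3.add h1
    change HasSum _ (fst A h a + snd A h (RationalLocalization.mk g f F)) at h4
    convert h4 using 1
    ext n
    rw [map_add, add_mul, fst_of]
    split_ifs with hn <;> simp [hn]

end Relations

/-! ### Functoriality of the covering -/

section Functoriality

open RationalLocalization (quot isPowerBoundedElement_quot of_mul_quot)

variable {R B : Type*} [CommRing R] [TopologicalSpace R] [NonarchimedeanRing R] [NullComplete R]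
  [CommRing B] [TopologicalSpace B] [NonarchimedeanRing B] [NullComplete B]
  {A : Type*} [CommRing A] [Algebra A R] [Algebra A B] (φ : R →ₐ[A] B) (hφ : Continuous φ)
  {f g : R} {f' g' : B} (hf : φ f = f') (hg : φ g = g')

/-- The map `R⟨f/g⟩ → B⟨f/g⟩` induced by `φ : R → B`. -/
noncomputable def RationalLocalization.map :
    RationalLocalization f g →ₐ[A] RationalLocalization f' g' :=
  lift ((of A f' g').comp φ) ((continuous_of f' g').comp hφ) (quot f' g')
    (isPowerBoundedElement_quot f' g') (by
      rw [AlgHom.comp_apply, AlgHom.comp_apply, hf, hg, of_mul_quot])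

namespace RationalLocalization

theorem continuous_map : Continuous (map φ hφ hf hg) := continuous_lift _ _ _ _ _

@[simp] theorem map_of (x : R) : map φ hφ hf hg (of A f g x) = of A f' g' (φ x) :=
  lift_of _ _ _ _ _ _

@[simp] theorem map_quot : map φ hφ hf hg (quot f g) = quot f' g' := lift_quot _ _ _ _ _

end RationalLocalization

namespace Overlap

variable (h : StrictPair f g) (h' : StrictPair f' g')

/-- The map `R⟨f/g, g/f⟩ → B⟨f/g, g/f⟩` induced by `φ : R → B`. -/
noncomputable def map : Overlap h →ₐ[A] Overlap h' :=
  lift h ((of A h').comp φ) ((continuous_of h').comp hφ) (unit h') (isPowerBoundedUnit_unit h') (by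
      rw [AlgHom.comp_apply, AlgHom.comp_apply, hf, hg, of_mul_unit])

theorem continuous_map : Continuous (map φ hφ hf hg h h') := continuous_lift _ _ _ _ _ _

@[simp] theorem map_of (x : R) : map φ hφ hf hg h h' (of A h x) = of A h' (φ x) :=
  lift_of _ _ _ _ _ _ _

@[simp] theorem map_unit : map φ hφ hf hg h h' (unit h) = unit h' := lift_unit _ _ _ _ _ _

@[simp] theorem map_unit_inv :
    map φ hφ hf hg h h' ((unit h)⁻¹ : (Overlap h)ˣ) = ((unit h')⁻¹ : (Overlap h')ˣ) :=
  lift_unit_inv _ _ _ _ _ _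

theorem map_fst (a : RationalLocalization f g) :
    map φ hφ hf hg h h' (fst A h a) = fst A h' (RationalLocalization.map φ hφ hf hg a) := by
  have : (map φ hφ hf hg h h').comp (fst A h)
      = (fst A h').comp (RationalLocalization.map φ hφ hf hg) := by
    refine RationalLocalization.algHom_ext
      (show Continuous (map φ hφ hf hg h h' ∘ fst A h) from
        (continuous_map φ hφ hf hg h h').comp (continuous_fst h))
      (show Continuous (fst A h' ∘ RationalLocalization.map φ hφ hf hg) from
        (continuous_fst h').comp (RationalLocalization.continuous_map φ hφ hf hg))
      (fun x => by simp) (by simp)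
  exact DFunLike.congr_fun this a

theorem map_snd (a : RationalLocalization g f) :
    map φ hφ hf hg h h' (snd A h a) = snd A h' (RationalLocalization.map φ hφ hg hf a) := by
  have : (map φ hφ hf hg h h').comp (snd A h)
      = (snd A h').comp (RationalLocalization.map φ hφ hg hf) := by
    refine RationalLocalization.algHom_ext
      (show Continuous (map φ hφ hf hg h h' ∘ snd A h) from
        (continuous_map φ hφ hf hg h h').comp (continuous_snd h))
      (show Continuous (snd A h' ∘ RationalLocalization.map φ hφ hg hf) from
        (continuous_snd h').comp (RationalLocalization.continuous_map φ hφ hg hf))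
      (fun x => by simp) (by simp)
  exact DFunLike.congr_fun this a

theorem map_swap (x : Overlap h) :
    map φ hφ hg hf h.symm h'.symm (swap A h x) = swap A h' (map φ hφ hf hg h h' x) := by
  have : (map φ hφ hg hf h.symm h'.symm).comp (swap A h)
      = (swap A h').comp (map φ hφ hf hg h h') := by
    refine algHom_ext h
      (show Continuous (map φ hφ hg hf h.symm h'.symm ∘ swap A h) from
        (continuous_map φ hφ hg hf h.symm h'.symm).comp (continuous_swap h))
      (show Continuous (swap A h' ∘ map φ hφ hf hg h h') from
        (continuous_swap h').comp (continuous_map φ hφ hf hg h h'))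
      (fun x => by simp) (by simp)
  exact DFunLike.congr_fun this x

end Overlap

end Functoriality

/-! ### The kernel over the overlap is generated by the kernel over either piece -/

section KernelOverlap

open RationalLocalization (quot)

/-- The linear map `c ↦ ∑ c i * v i`. -/
noncomputable def sumMul (A : Type*) {S : Type*} [CommRing A] [CommRing S] [Algebra A S] {r : ℕ}
    (v : Fin r → S) : (Fin r → S) →ₗ[A] S where
  toFun c := ∑ i, c i * v i
  map_add' c d := by simp [add_mul, Finset.sum_add_distrib]
  map_smul' a c := by simp [Finset.smul_sum]

section sumMul

variable {A S : Type*} [CommRing A] [CommRing S] [Algebra A S] {r : ℕ} (v : Fin r → S)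

@[simp] theorem sumMul_apply (c : Fin r → S) : sumMul A v c = ∑ i, c i * v i := rfl

theorem sumMul_mem {I : Ideal S} {v : Fin r → S} (hv : ∀ i, v i ∈ I) (c : Fin r → S) :
    sumMul A v c ∈ I := by
  rw [sumMul_apply]
  exact sum_mem fun i _ => I.mul_mem_left _ (hv i)

theorem continuous_sumMul [TopologicalSpace S] [IsTopologicalRing S] : Continuous (sumMul A v) := by
  change Continuous fun c : Fin r → S => ∑ i, c i * v i
  fun_prop

theorem coe_range_sumMul : ((sumMul A v).range : Set S) = Ideal.span (Set.range v) := by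
  ext x
  simp only [LinearMap.coe_range, Set.mem_range, sumMul_apply, SetLike.mem_coe]
  rw [Ideal.mem_span_range_iff_exists_fun]

/-- A finitely generated closed ideal: null families in it have null families of coefficients. -/
theorem NhdsSpanTop.exists_null_coeff [TopologicalSpace A] [IsTopologicalRing A]
    [FirstCountableTopology A] [TopologicalSpace S] [NonarchimedeanRing S] [NullComplete S]
    [ContinuousSMul A S] (hA : NhdsSpanTop A) (hc : IsClosed (Ideal.span (Set.range v) : Set S))
    {ι : Type*} [Countable ι] {k : ι → S} (hk : Tendsto k cofinite (𝓝 0))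
    (hkv : ∀ n, k n ∈ Ideal.span (Set.range v)) :
    ∃ c : ι → Fin r → S, Tendsto c cofinite (𝓝 0) ∧ ∀ n, ∑ i, c n i * v i = k n := by
  rw [← coe_range_sumMul (A := A)] at hc
  refine (hA.openOntoRange (sumMul A v) (continuous_sumMul v) hc).exists_null_lift hk fun n => ?_
  have := hkv n
  rw [← SetLike.mem_coe, ← coe_range_sumMul (A := A)] at this
  exact this

end sumMul

variable {R B : Type*} [CommRing R] [TopologicalSpace R] [NonarchimedeanRing R] [NullComplete R]
  [CommRing B] [TopologicalSpace B] [NonarchimedeanRing B] [NullComplete B]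
  {A : Type*} [CommRing A] [TopologicalSpace A] [IsTopologicalRing A] [FirstCountableTopology A]
  [Algebra A R] [Algebra A B] [ContinuousSMul A R] [ContinuousSMul A B]
  (φ : R →ₐ[A] B) (hφ : Continuous φ)
  {f g : R} {f' g' : B} (hf : φ f = f') (hg : φ g = g')
  (h : StrictPair f g) (h' : StrictPair f' g')

namespace Overlap

/-- Write an element of the kernel as `∑ a n (g/f)ⁿ`. The null sequence expressing that
`∑ φ (a n) (g/f)ⁿ = 0` lifts to `R⟨f/g⟩`, and subtracting the relations it gives makes all
coefficients elements of the kernel of `R⟨f/g⟩ → B⟨f/g⟩`. -/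
theorem mem_span_fst_of_map_eq_zero (hA : NhdsSpanTop A)
    (hs : Function.Surjective (RationalLocalization.map φ hφ hf hg)) {r : ℕ}
    (v : Fin r → RationalLocalization f g)
    (hv : RingHom.ker (RationalLocalization.map φ hφ hf hg) = Ideal.span (Set.range v))
    {x : Overlap h} (hx : map φ hφ hf hg h h' x = 0) :
    x ∈ Ideal.span (Set.range fun i => fst A h (v i)) := by
  set φ₁ := RationalLocalization.map φ hφ hf hg with hφ₁
  have hc₁ : Continuous φ₁ := RationalLocalization.continuous_map φ hφ hf hg
  set u := quot f g
  set w : Overlap h := (((unit h)⁻¹ : (Overlap h)ˣ) : Overlap h) with hw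
  have huw : fst A h u * w = 1 := by rw [fst_quot, hw, Units.mul_inv]
  have hwb : IsBoundedSubset (Set.range fun n : ℕ => w ^ n) := (isPowerBoundedUnit_unit h).inv.val
  -- sums `∑ fst (c n) wⁿ` over null sequences `c`
  have hsum : ∀ c : ℕ → RationalLocalization f g, Tendsto c cofinite (𝓝 0) →
      Summable fun n => fst A h (c n) * w ^ n := fun c hc =>
    NullComplete.summable ((TateAlgebra.equicont_of_bounded
      (φ := (fst A h : RationalLocalization f g →+ Overlap h)) (continuous_fst h) hwb).null
        (C0.mk c hc))
  obtain ⟨a, ha, hax⟩ := exists_hasSum (A := A) h x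
  have hnull : Tendsto (fun n => φ₁ (a n)) cofinite (𝓝 0) := by
    simpa [Function.comp_def] using (hc₁.tendsto 0).comp ha
  let γ : ℕ → RationalLocalization f' g' := fun n =>
    ∑ i ∈ Finset.range (n + 1), quot f' g' ^ (n - i) * φ₁ (a i)
  have hγ : Tendsto γ cofinite (𝓝 0) := by
    rw [Nat.cofinite_eq_atTop]
    refine tendsto_sum_quot_pow_mul (A := A) h' hnull ?_
    rw [← hx]
    convert hax.map (map φ hφ hf hg h h') (continuous_map φ hφ hf hg h h') using 1
    ext n
    rw [Function.comp_apply, map_mul, map_fst, map_pow, map_unit_inv]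
  have hγ0 : γ 0 = φ₁ (a 0) := by simp [γ]
  have hγs : ∀ n, γ (n + 1) = φ₁ u * γ n + φ₁ (a (n + 1)) := fun n => by
    simp only [γ]
    rw [Finset.sum_range_succ _ (n + 1), Finset.mul_sum, hφ₁, RationalLocalization.map_quot,
      Nat.sub_self, pow_zero, one_mul]
    congr 1
    refine Finset.sum_congr rfl fun i hi => ?_
    have : n + 1 - i = n - i + 1 := by have := Finset.mem_range.1 hi; omega
    rw [this]; ring
  obtain ⟨d, hd, hdγ⟩ := (OpenOntoRange.of_isOpenMap (T := φ₁.toLinearMap.toAddMonoidHom)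
    (hA.isOpenMap φ₁.toLinearMap hc₁ hs)).exists_null_lift hγ (fun n => hs (γ n))
  replace hdγ : ∀ n, φ₁ (d n) = γ n := hdγ
  let d' : ℕ → RationalLocalization f g := fun n => Nat.casesOn n 0 d
  have hd'0 : d' 0 = 0 := rfl
  have hd's : ∀ n, d' (n + 1) = d n := fun _ => rfl
  have hd' : Tendsto d' cofinite (𝓝 0) := by
    rw [Nat.cofinite_eq_atTop] at hd ⊢
    exact (tendsto_add_atTop_iff_nat 1).1 hd
  have hud' : Tendsto (fun n => u * d' n) cofinite (𝓝 0) := by simpa using hd'.const_mul u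
  let k : ℕ → RationalLocalization f g := fun n => a n - d n + u * d' n
  have hk : Tendsto k cofinite (𝓝 0) := by simpa using (ha.sub hd).add hud'
  have hkv : ∀ n, k n ∈ Ideal.span (Set.range v) := fun n => by
    rw [← hv, RingHom.mem_ker]
    change φ₁ (k n) = 0
    cases n with
    | zero => simp only [k, hd'0, map_add, map_sub, map_mul, hdγ, hγ0, map_zero]; ring
    | succ n => simp only [k, hd's, map_add, map_sub, map_mul, hdγ, hγs]; ring
  have hkx : HasSum (fun n => fst A h (k n) * w ^ n) x := by
    obtain ⟨σ, h1⟩ := hsum d hd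
    have h2 : HasSum (fun n => fst A h (u * d' (n + 1)) * w ^ (n + 1)) σ := by
      convert h1 using 1
      ext n
      rw [hd's, map_mul]
      linear_combination fst A h (d n) * w ^ n * huw
    have h3 : HasSum (fun n => fst A h (u * d' n) * w ^ n) σ := by
      have h4 := (hasSum_nat_add_iff (f := fun n => fst A h (u * d' n) * w ^ n) 1).1 h2
      simpa [hd'0] using h4
    have h4 := (hax.sub h1).add h3
    rw [sub_add_cancel] at h4
    have h5 : (fun n => fst A h (k n) * w ^ n) = fun n =>
        fst A h (a n) * w ^ n - fst A h (d n) * w ^ n + fst A h (u * d' n) * w ^ n := by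
      ext n
      simp only [k, map_add, map_sub]; ring
    rw [h5]
    exact h4
  have hcl : IsClosed (Ideal.span (Set.range v) : Set (RationalLocalization f g)) := by
    rw [← hv]
    exact isClosed_singleton.preimage hc₁
  obtain ⟨c, hc, hck⟩ := hA.exists_null_coeff v hcl hk hkv
  have hci : ∀ i, HasSum (fun n => fst A h (c n i) * w ^ n) (∑' n, fst A h (c n i) * w ^ n) :=
    fun i => (hsum _ (((continuous_apply i).tendsto _).comp hc)).hasSum
  have hfin : HasSum (fun n => fst A h (k n) * w ^ n)
      (∑ i, (∑' n, fst A h (c n i) * w ^ n) * fst A h (v i)) := by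
    have h1 := hasSum_sum (s := Finset.univ) fun i _ => (hci i).mul_right (fst A h (v i))
    have h2 : (fun n => fst A h (k n) * w ^ n) = fun n =>
        ∑ i, fst A h (c n i) * w ^ n * fst A h (v i) := by
      ext n
      rw [← hck, map_sum, Finset.sum_mul]
      refine Finset.sum_congr rfl fun i _ => ?_
      rw [map_mul]; ring
    rw [h2]
    exact h1
  rw [hkx.unique hfin]
  exact sum_mem fun i _ => Ideal.mul_mem_left _ _ (Ideal.subset_span ⟨i, rfl⟩)

theorem mem_span_snd_of_map_eq_zero (hA : NhdsSpanTop A)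
    (hs : Function.Surjective (RationalLocalization.map φ hφ hg hf)) {r : ℕ}
    (v : Fin r → RationalLocalization g f)
    (hv : RingHom.ker (RationalLocalization.map φ hφ hg hf) = Ideal.span (Set.range v))
    {x : Overlap h} (hx : map φ hφ hf hg h h' x = 0) :
    x ∈ Ideal.span (Set.range fun i => snd A h (v i)) := by
  have h1 : map φ hφ hg hf h.symm h'.symm (swap A h x) = 0 := by rw [map_swap, hx, map_zero]
  have h2 := mem_span_fst_of_map_eq_zero φ hφ hg hf h.symm h'.symm hA hs v hv h1
  obtain ⟨c, hc⟩ := (Ideal.mem_span_range_iff_exists_fun).1 h2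
  refine (Ideal.mem_span_range_iff_exists_fun).2 ⟨fun i => swap A h.symm (c i), ?_⟩
  rw [← swap_swap (A := A) h x, ← hc, map_sum]
  refine Finset.sum_congr rfl fun i _ => ?_
  rw [map_mul]
  congr 1
  exact (swap_fst h.symm (v i)).symm

end Overlap

end KernelOverlap

/-! ### Splitting an ideal over the overlap -/

section Splitting

variable {A : Type*} [CommRing A] [TopologicalSpace A]

/-- A topological `A`-module is locally bounded over the subring `P` of `A` if it has a bounded open
`P`-submodule. -/
def LocallyBdd (P : Subring A) (M : Type*) [AddCommGroup M] [TopologicalSpace M] [Module A M] :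
    Prop :=
  ∃ Q : Submodule P M, (Q : Set M) ∈ 𝓝 0 ∧ BddOver A (Q : Set M)

theorem LocallyBdd.of_isOpenMap {P : Subring A} {M N : Type*} [AddCommGroup M] [TopologicalSpace M]
    [AddCommGroup N] [TopologicalSpace N] [Module A M] [Module A N] (hM : LocallyBdd P M)
    (T : M →ₗ[A] N) (hT : Continuous T) (ho : IsOpenMap T) : LocallyBdd P N := by
  obtain ⟨Q, hQ, hQb⟩ := hM
  refine ⟨Q.map (T.restrictScalars P), ?_, hQb.image T hT⟩
  have := ho.image_mem_nhds hQ
  rwa [map_zero] at this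

variable [IsTopologicalRing A] [FirstCountableTopology A] {S S₁ S₂ : Type*}
  [CommRing S] [TopologicalSpace S] [NonarchimedeanRing S] [NullComplete S]
  [CommRing S₁] [TopologicalSpace S₁] [NonarchimedeanRing S₁] [NullComplete S₁]
  [CommRing S₂] [TopologicalSpace S₂] [NonarchimedeanRing S₂] [NullComplete S₂]
  [Algebra A S] [Algebra A S₁] [Algebra A S₂]
  [ContinuousSMul A S] [ContinuousSMul A S₁] [ContinuousSMul A S₂]
  (j₁ : S₁ →ₐ[A] S) (hj₁ : Continuous j₁) (j₂ : S₂ →ₐ[A] S) (hj₂ : Continuous j₂)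

include hj₁ hj₂ in
/-- If every element of `S` is a sum of elements of `S₁` and `S₂`, and `S₂` becomes dense in `S`
after inverting `γ`, then a closed ideal generated both by `v` and by `w` consists of the sums of
an `S₁`-linear combination of `v` and an `S₂`-linear combination of `w`. The expression of `v` in
terms of `w` is approximated by one with coefficients in `S₂`, up to powers of `γ`; the error is
small with respect to the generators `γ ^ N * v i` uniformly in `N`. -/
theorem exists_add_of_mem_span {P : Subring A} {J : Ideal P} (hJ : IsAdicPair P J)
    (hA : NhdsSpanTop A) (hS₁ : LocallyBdd P S₁) (hS₂ : LocallyBdd P S₂)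
    (hadd : ∀ x, ∃ a b, x = j₁ a + j₂ b) {γ₁ : S₁} {γ : S} (hγ₁ : j₁ γ₁ = γ) (hγ : IsUnit γ)
    (hdense : ∀ x, ∀ W ∈ 𝓝 (0 : S), ∀ᶠ N in atTop, ∃ y, ∃ e ∈ W, γ ^ N * x = j₂ y + γ ^ N * e)
    {r q : ℕ} {v : Fin r → S} {w : Fin q → S}
    (hvw : Ideal.span (Set.range v) = Ideal.span (Set.range w))
    (hc : IsClosed (Ideal.span (Set.range v) : Set S)) {x : S} (hx : x ∈ Ideal.span (Set.range v)) :
    ∃ (d : Fin r → S₁) (e : Fin q → S₂), x = ∑ i, j₁ (d i) * v i + ∑ j, j₂ (e j) * w j := by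
  obtain ⟨X₁, hX₁, hX₁b⟩ := hS₁
  obtain ⟨X₂, hX₂, hX₂b⟩ := hS₂
  -- the bounded open submodule of `S` that controls all errors
  let D : (S₁ × S₂) →ₗ[A] S := j₁.toLinearMap.coprod j₂.toLinearMap
  have hD : Continuous D := (hj₁.comp continuous_fst).add (hj₂.comp continuous_snd)
  have hDo : IsOpenMap D := hA.isOpenMap D hD fun x => by
    obtain ⟨a, b, rfl⟩ := hadd x
    exact ⟨(a, b), rfl⟩
  let Y : Submodule P S := (X₁.prod X₂).map (D.restrictScalars P)
  have hY : (Y : Set S) ∈ 𝓝 0 := by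
    have := hDo.image_mem_nhds (x := 0) (prod_mem_nhds hX₁ hX₂)
    rwa [map_zero] at this
  have hYb : BddOver A (Y : Set S) := (hX₁b.prod hX₂b).image D hD
  -- the two families of generators in terms of each other
  have hv : ∀ i, ∃ a : Fin q → S, ∑ j, a j * w j = v i := fun i =>
    Ideal.mem_span_range_iff_exists_fun.1 (hvw ▸ Ideal.subset_span ⟨i, rfl⟩)
  have hw : ∀ j, ∃ b : Fin r → S, ∑ i, b i * v i = w j := fun j =>
    Ideal.mem_span_range_iff_exists_fun.1 (hvw.symm ▸ Ideal.subset_span ⟨j, rfl⟩)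
  choose a ha using hv
  choose b hb using hw
  have hW : ∃ W ∈ 𝓝 (0 : S), ∀ j l, ∀ t ∈ X₂, ∀ ω ∈ W, ω * (j₂ t * b j l) ∈ J • Y := by
    have h1 : ∀ j l, ∃ W ∈ 𝓝 (0 : S), ∀ t ∈ X₂, ∀ ω ∈ W, ω * (j₂ t * b j l) ∈ J • Y := by
      intro j l
      have h2 := (hX₂b.image ((LinearMap.mulRight A (b j l)).comp j₂.toLinearMap)
        (hj₂.mul continuous_const)).isBoundedSubset hA
      obtain ⟨W, hW, hWY⟩ := h2 _ (hJ.smul_mem_nhds hA hY)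
      exact ⟨W, hW, fun t ht ω hω => hWY (Set.mul_mem_mul hω ⟨t, ht, rfl⟩)⟩
    choose W hW hWY using h1
    exact ⟨⋂ j, ⋂ l, W j l, iInter_mem.2 fun j => iInter_mem.2 fun l => hW j l,
      fun j l t ht ω hω => hWY j l t ht ω (Set.mem_iInter.1 (Set.mem_iInter.1 hω j) l)⟩
  obtain ⟨W, hW, hWY⟩ := hW
  obtain ⟨N, hN⟩ := (eventually_all.2 fun i => eventually_all.2 fun j =>
    hdense (a i j) W hW).exists
  choose y ω hω hy using hN
  -- the ideal, as a complete module
  let K : Submodule A S := (Ideal.span (Set.range v)).restrictScalars A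
  have hKc : IsClosed (K : Set S) := hc
  have : NullComplete K := NullComplete.of_isClosedEmbedding K.subtype.toAddMonoidHom
    hKc.isClosedEmbedding_subtypeVal
  have hvK : ∀ i, v i ∈ Ideal.span (Set.range v) := fun i => Ideal.subset_span ⟨i, rfl⟩
  have hwK : ∀ j, w j ∈ Ideal.span (Set.range v) := fun j => hvw ▸ Ideal.subset_span ⟨j, rfl⟩
  let T' : (Fin r → S) →ₗ[A] K := (sumMul A fun i => γ ^ N * v i).codRestrict K fun c =>
    sumMul_mem (I := Ideal.span (Set.range v)) (fun i => Ideal.mul_mem_left _ _ (hvK i)) c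
  have hT'c : Continuous T' := (continuous_sumMul _).subtype_mk _
  have hT's : Function.Surjective T' := by
    rintro ⟨z, hz⟩
    obtain ⟨c, rfl⟩ := Ideal.mem_span_range_iff_exists_fun.1 hz
    obtain ⟨δ, hδ⟩ := (hγ.pow N).exists_left_inv
    refine ⟨fun i => c i * δ, Subtype.ext ?_⟩
    change ∑ i, c i * δ * (γ ^ N * v i) = ∑ i, c i * v i
    refine Finset.sum_congr rfl fun i _ => ?_
    linear_combination c i * v i * hδ
  let V : Submodule P K := (Submodule.pi Set.univ fun _ : Fin r => Y).map (T'.restrictScalars P)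
  have hV : (V : Set K) ∈ 𝓝 0 := by
    have h1 : {c : Fin r → S | ∀ i ∈ Set.univ, c i ∈ Y} ∈ 𝓝 0 := by
      have := set_pi_mem_nhds (x := (0 : Fin r → S)) (s := fun _ => (Y : Set S))
        (Set.toFinite (Set.univ : Set (Fin r))) fun i _ => hY
      exact this
    have := (hA.isOpenMap T' hT'c hT's).image_mem_nhds (x := 0) h1
    rwa [map_zero] at this
  have hVb : BddOver A (V : Set K) := by
    refine BddOver.image (BddOver.mono (hYb.pi (r := Fin r)) ?_) T' hT'c
    exact fun c hc i => hc i trivial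
  let T : ((Fin r → S₁) × (Fin q → S₂)) →ₗ[A] K :=
    LinearMap.codRestrict K (((sumMul A v).comp (j₁.toLinearMap.compLeft (Fin r))).coprod
      ((sumMul A w).comp (j₂.toLinearMap.compLeft (Fin q)))) fun c =>
      K.add_mem (sumMul_mem (A := A) (I := Ideal.span (Set.range v)) hvK fun i => j₁ (c.1 i))
        (sumMul_mem (A := A) (I := Ideal.span (Set.range v)) hwK fun j => j₂ (c.2 j))
  have hT_apply : ∀ d e, (T (d, e) : S) = ∑ i, j₁ (d i) * v i + ∑ j, j₂ (e j) * w j :=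
    fun _ _ => rfl
  have hTc : Continuous T := by
    refine Continuous.subtype_mk (Continuous.add ?_ ?_) _
    · exact (continuous_sumMul (A := A) v).comp (continuous_pi fun i =>
        hj₁.comp ((continuous_apply i).comp continuous_fst))
    · exact (continuous_sumMul (A := A) w).comp (continuous_pi fun i =>
        hj₂.comp ((continuous_apply i).comp continuous_snd))
  let L : ((Fin r → S₁) × (Fin r → S₂)) →ₗ[A] ((Fin r → S₁) × (Fin q → S₂)) :=
    ((LinearMap.mulLeft A (γ₁ ^ N)).compLeft (Fin r)).prodMap
      (LinearMap.pi fun j => sumMul A fun i => y i j)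
  have hL_apply : ∀ d e, L (d, e) = (fun i => γ₁ ^ N * d i, fun j => ∑ i, e i * y i j) :=
    fun _ _ => rfl
  have hLc : Continuous L := by
    refine Continuous.prodMk (continuous_pi fun i => ?_) (continuous_pi fun j => ?_)
    · exact continuous_const.mul ((continuous_apply i).comp continuous_fst)
    · exact (continuous_sumMul (A := A) _).comp continuous_snd
  let Q : Submodule P ((Fin r → S₁) × (Fin q → S₂)) :=
    ((Submodule.pi Set.univ fun _ : Fin r => X₁).prod
      (Submodule.pi Set.univ fun _ : Fin r => X₂)).map (L.restrictScalars P)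
  have hQb : BddOver A (Q : Set ((Fin r → S₁) × (Fin q → S₂))) := by
    refine BddOver.image (BddOver.mono ((hX₁b.pi (r := Fin r)).prod (hX₂b.pi (r := Fin r))) ?_) L hLc
    exact fun c hc => ⟨fun i => hc.1 i trivial, fun i => hc.2 i trivial⟩
  have hsmall : ∀ c : Fin r → S, (∀ l, c l ∈ J • Y) → T' c ∈ J • V := by
    classical
    intro c hc
    have h1 : c = ∑ l, Pi.single l (c l) := (Finset.univ_sum_single c).symm
    rw [h1, map_sum]
    refine sum_mem fun l _ => ?_
    have h2 : (J • Y).map ((T'.comp (LinearMap.single A (fun _ => S) l)).restrictScalars P)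
        ≤ J • V := by
      rw [Submodule.map_smul'']
      refine smul_mono_right _ ?_
      rintro _ ⟨z, hz, rfl⟩
      refine ⟨Pi.single l z, fun i _ => ?_, rfl⟩
      by_cases hi : i = l
      · subst hi; simpa using hz
      · simp [Pi.single_eq_of_ne hi]
    exact h2 ⟨c l, hc l, rfl⟩
  have hVle : V ≤ Q.map (T.restrictScalars P) ⊔ J • V := by
    rintro _ ⟨c, hc, rfl⟩
    have h1 : ∀ i, ∃ s ∈ X₁, ∃ t ∈ X₂, c i = j₁ s + j₂ t := fun i => by
      obtain ⟨⟨s, t⟩, ⟨hs, ht⟩, hst⟩ := hc i trivial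
      exact ⟨s, hs, t, ht, hst.symm⟩
    choose s hs t ht hst using h1
    let c' : Fin r → S := fun l => ∑ i, ∑ j, ω i j * (j₂ (t i) * b j l)
    have hc' : T' c' ∈ J • V := hsmall c' fun l =>
      sum_mem fun i _ => sum_mem fun j _ => hWY j l _ (ht i) _ (hω i j)
    have hLQ : L (s, t) ∈ Q := ⟨(s, t), ⟨fun i _ => hs i, fun i _ => ht i⟩, rfl⟩
    refine Submodule.mem_sup.2 ⟨T (L (s, t)), ⟨_, hLQ, rfl⟩, T' c', hc', Subtype.ext ?_⟩
    change (T (L (s, t)) : S) + ∑ l, c' l * (γ ^ N * v l) = ∑ i, c i * (γ ^ N * v i)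
    rw [hL_apply, hT_apply]
    have e1 : ∑ l, c' l * (γ ^ N * v l) = ∑ i, ∑ j, j₂ (t i) * (γ ^ N * ω i j) * w j := by
      simp only [c', Finset.sum_mul]
      rw [Finset.sum_comm]
      refine Finset.sum_congr rfl fun i _ => ?_
      rw [Finset.sum_comm]
      refine Finset.sum_congr rfl fun j _ => ?_
      rw [← hb j, Finset.mul_sum]
      exact Finset.sum_congr rfl fun l _ => by ring
    have e2 : ∑ j, j₂ (∑ i, t i * y i j) * w j = ∑ i, ∑ j, j₂ (t i) * j₂ (y i j) * w j := by
      simp only [map_sum, map_mul, Finset.sum_mul]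
      rw [Finset.sum_comm]
    rw [e1, e2, add_assoc, ← Finset.sum_add_distrib, ← Finset.sum_add_distrib]
    refine Finset.sum_congr rfl fun i _ => ?_
    rw [← Finset.sum_add_distrib, hst, map_mul, map_pow, hγ₁]
    have e3 : ∑ j, (j₂ (t i) * j₂ (y i j) * w j + j₂ (t i) * (γ ^ N * ω i j) * w j)
        = j₂ (t i) * γ ^ N * v i := by
      rw [← ha i, Finset.mul_sum]
      refine Finset.sum_congr rfl fun j _ => ?_
      linear_combination -(j₂ (t i) * w j) * hy i j
    rw [e3]; ring
  obtain ⟨⟨d, e⟩, hde⟩ := hJ.surjective_of_le_sup hA T hTc V hV hVb Q hQb hVle ⟨x, hx⟩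
  exact ⟨d, e, by rw [← hT_apply, hde]⟩

end Splitting

/-! ### Gluing surjectivity -/

section Gluing

open RationalLocalization (quot)

variable {A : Type*} [CommRing A] [TopologicalSpace A]
  {R : Type*} [CommRing R] [TopologicalSpace R] [NonarchimedeanRing R] [NullComplete R]
  [Algebra A R] {f g : R}

/-- Sections over `X⟨g/f⟩` are dense in the sections over the overlap after inverting `g`: if `x` is
a series in `f/g` then `g ^ N` clears the denominators of its partial sums. -/
theorem Overlap.eventually_exists_snd_add (h : StrictPair f g) (x : Overlap h) {W : Set (Overlap h)}
    (hW : W ∈ 𝓝 0) : ∀ᶠ N in atTop, ∃ y, ∃ e ∈ W,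
      of A h g ^ N * x = snd A h y + of A h g ^ N * e := by
  obtain ⟨a, b, rfl⟩ := exists_fst_add_snd (A := A) h x
  obtain ⟨F, rfl⟩ := RationalLocalization.mk_surjective f g a
  have h1 := (RationalLocalization.hasSum_lift (of A h) (continuous_of h) (unit h)
    (isPowerBoundedUnit_unit h).val (of_mul_unit h) F).tendsto_sum_nat
  change Tendsto _ atTop (𝓝 (fst A h (RationalLocalization.mk f g F))) at h1
  set z := fst A h (RationalLocalization.mk f g F)
  have h2 : Tendsto (fun N => z - ∑ k ∈ Finset.range N,
      of A h (F.coeff (Finsupp.single 0 k)) * (unit h : Overlap h) ^ k) atTop (𝓝 0) := by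
    simpa using h1.const_sub z
  filter_upwards [h2 hW] with N hN
  refine ⟨RationalLocalization.of A g f (∑ k ∈ Finset.range N,
    F.coeff (Finsupp.single 0 k) * (f ^ k * g ^ (N - k))) +
      RationalLocalization.of A g f (g ^ N) * b, _, hN, ?_⟩
  rw [map_add, map_mul, snd_of, snd_of, map_sum, map_pow, mul_sub, Finset.mul_sum]
  have h3 : ∀ k ∈ Finset.range N, of A h (F.coeff (Finsupp.single 0 k) * (f ^ k * g ^ (N - k)))
      = of A h g ^ N * (of A h (F.coeff (Finsupp.single 0 k)) * (unit h : Overlap h) ^ k) := by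
    intro k hk
    have h4 : N = N - k + k := by have := Finset.mem_range.1 hk; omega
    rw [map_mul, map_mul, map_pow, map_pow, ← of_mul_unit]
    conv_rhs => rw [h4]
    ring
  rw [Finset.sum_congr rfl h3]
  ring

theorem Overlap.isUnit_of (h : StrictPair f g) (hfg : IsCoprime f g) : IsUnit (of A h g) := by
  obtain ⟨a, b, hab⟩ := hfg
  refine IsUnit.of_mul_eq_one (of A h a * unit h + of A h b) ?_
  rw [mul_add, mul_left_comm, of_mul_unit, ← map_mul, ← map_mul, ← map_add, ← map_one (of A h), ← hab]
  ring_nf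

theorem LocallyBdd.tateAlgebra {P : Subring A} (hR : LocallyBdd P R) (m : ℕ) :
    LocallyBdd P (TateAlgebra m R) := by
  obtain ⟨Q, hQ, hQb⟩ := hR
  refine ⟨{ carrier := {F | ∀ k, F.coeff k ∈ Q}
            zero_mem' := fun k => by rw [TateAlgebra.coeff_zero]; exact zero_mem Q
            add_mem' := fun hF hG k => by rw [TateAlgebra.coeff_add]; exact add_mem (hF k) (hG k)
            smul_mem' := fun p F hF k => by
              exact (congrArg (· ∈ Q) (TateAlgebra.coeff_smul (p : A) F k)).mpr
                (Q.smul_mem p (hF k)) }, ?_, ?_⟩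
  · obtain ⟨W, hW⟩ := NonarchimedeanAddGroup.is_nonarchimedean _ hQ
    exact mem_of_superset (TateAlgebra.basicSubgroup_mem_nhds W) fun F hF k => hW (hF k)
  · intro U hU
    obtain ⟨W, _, hW⟩ := TateAlgebra.nhds_hasBasis.mem_iff.1 hU
    obtain ⟨V, hV, hVW⟩ := hQb W W.mem_nhds_zero
    refine ⟨V, hV, fun a ha F hF => hW fun k => ?_⟩
    rw [TateAlgebra.coeff_smul]
    exact hVW a ha _ (hF k)

theorem LocallyBdd.rationalLocalization {P : Subring A} (hR : LocallyBdd P R) (f g : R) :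
    LocallyBdd P (RationalLocalization f g) :=
  (hR.tateAlgebra 1).of_isOpenMap (RationalLocalization.mkₐ A f g).toLinearMap
    (RationalLocalization.continuous_mk f g) (RationalLocalization.isOpenMap_mk f g)

variable [IsTopologicalRing A] [FirstCountableTopology A] [ContinuousSMul A R]
  {B : Type*} [CommRing B] [TopologicalSpace B] [NonarchimedeanRing B] [NullComplete B]
  [Algebra A B] [ContinuousSMul A B] (φ : R →ₐ[A] B) (hφ : Continuous φ)
  {f' g' : B} (hf : φ f = f') (hg : φ g = g')

include hφ in
/-- A map is surjective if it is surjective with finitely generated kernel over both pieces of the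
covering. Two lifts of a section differ on the overlap by an element of the kernel there, which is
the sum of elements of the kernels over the two pieces. -/
theorem surjective_of_surjective_map {P : Subring A} {J : Ideal P} (hJ : IsAdicPair P J)
    (hA : NhdsSpanTop A) (hR : LocallyBdd P R) (hfg : IsCoprime f g)
    (h : StrictPair f g) (h' : StrictPair f' g')
    (hs₁ : Function.Surjective (RationalLocalization.map φ hφ hf hg))
    (hk₁ : (RingHom.ker (RationalLocalization.map φ hφ hf hg)).FG)
    (hs₂ : Function.Surjective (RationalLocalization.map φ hφ hg hf))
    (hk₂ : (RingHom.ker (RationalLocalization.map φ hφ hg hf)).FG) :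
    Function.Surjective φ := by
  intro b
  obtain ⟨r, v, hv⟩ := Submodule.fg_iff_exists_fin_generating_family.1 hk₁
  obtain ⟨q, w, hw⟩ := Submodule.fg_iff_exists_fin_generating_family.1 hk₂
  have hv0 : ∀ i, RationalLocalization.map φ hφ hf hg (v i) = 0 := fun i => by
    rw [← RingHom.mem_ker, ← hv]; exact Ideal.subset_span ⟨i, rfl⟩
  have hw0 : ∀ i, RationalLocalization.map φ hφ hg hf (w i) = 0 := fun i => by
    rw [← RingHom.mem_ker, ← hw]; exact Ideal.subset_span ⟨i, rfl⟩
  have h1 : Ideal.span (Set.range fun i => Overlap.fst A h (v i))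
      = RingHom.ker (Overlap.map φ hφ hf hg h h') := by
    refine le_antisymm (Ideal.span_le.2 ?_) fun x hx =>
      Overlap.mem_span_fst_of_map_eq_zero φ hφ hf hg h h' hA hs₁ v hv.symm hx
    rintro _ ⟨i, rfl⟩
    change Overlap.map φ hφ hf hg h h' (Overlap.fst A h (v i)) = 0
    rw [Overlap.map_fst, hv0, map_zero]
  have h2 : Ideal.span (Set.range fun i => Overlap.snd A h (w i))
      = RingHom.ker (Overlap.map φ hφ hf hg h h') := by
    refine le_antisymm (Ideal.span_le.2 ?_) fun x hx =>
      Overlap.mem_span_snd_of_map_eq_zero φ hφ hf hg h h' hA hs₂ w hw.symm hx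
    rintro _ ⟨i, rfl⟩
    change Overlap.map φ hφ hf hg h h' (Overlap.snd A h (w i)) = 0
    rw [Overlap.map_snd, hw0, map_zero]
  have hc : IsClosed (Ideal.span (Set.range fun i => Overlap.fst A h (v i)) : Set (Overlap h)) := by
    rw [h1]
    exact isClosed_singleton.preimage (Overlap.continuous_map φ hφ hf hg h h')
  obtain ⟨p₁, hp₁⟩ := hs₁ (RationalLocalization.of A f' g' b)
  obtain ⟨p₂, hp₂⟩ := hs₂ (RationalLocalization.of A g' f' b)
  have hx : Overlap.fst A h p₁ - Overlap.snd A h p₂ ∈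
      Ideal.span (Set.range fun i => Overlap.fst A h (v i)) := by
    rw [h1]
    change Overlap.map φ hφ hf hg h h' _ = 0
    rw [map_sub, Overlap.map_fst, Overlap.map_snd, hp₁, hp₂, Overlap.fst_of, Overlap.snd_of,
      sub_self]
  obtain ⟨d, e, hde⟩ := exists_add_of_mem_span (Overlap.fst A h) (Overlap.continuous_fst h)
    (Overlap.snd A h) (Overlap.continuous_snd h) hJ hA (hR.rationalLocalization f g)
    (hR.rationalLocalization g f) (Overlap.exists_fst_add_snd h)
    (γ₁ := RationalLocalization.of A f g g) (Overlap.fst_of h g) (Overlap.isUnit_of h hfg)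
    (fun x W hW => Overlap.eventually_exists_snd_add h x hW) (h1.trans h2.symm) hc hx
  have hglue : Overlap.fst A h (p₁ - ∑ i, d i * v i) = Overlap.snd A h (p₂ + ∑ j, e j * w j) := by
    simp only [map_sub, map_add, map_sum, map_mul]
    linear_combination hde
  obtain ⟨z, hz₁, hz₂⟩ := Overlap.exists_of_fst_eq_snd h hglue
  refine ⟨z, sub_eq_zero.1 (Overlap.eq_zero_of_of_eq_zero (A := A) h' ?_ ?_)⟩
  · rw [map_sub, ← RationalLocalization.map_of φ hφ hf hg, hz₁, map_sub, hp₁, map_sum]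
    simp [hv0]
  · rw [map_sub, ← RationalLocalization.map_of φ hφ hg hf, hz₂, map_add, hp₂, map_sum]
    simp [hw0]

end Gluing

/-! ### Power series with coefficients in a subring -/

section Plus

namespace TateAlgebra

variable {m : ℕ} {X : Type*} [CommRing X] [TopologicalSpace X] [NonarchimedeanRing X]
  {O : Subring X}

theorem monomial_mem_plus {a : X} (ha : a ∈ O) (k) : monomial k a ∈ plus m O := fun l => by
  rw [coeff_monomial]
  split_ifs
  exacts [ha, zero_mem O]

theorem var_mem_plus (i : Fin m) : var i ∈ plus m O := by
  rw [var_eq_monomial]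
  exact monomial_mem_plus (one_mem O) _

theorem plus_mem_nhds (hO : (O : Set X) ∈ 𝓝 0) : (plus m O : Set (TateAlgebra m X)) ∈ 𝓝 0 := by
  obtain ⟨W, hW⟩ := NonarchimedeanRing.is_nonarchimedean _ hO
  exact mem_of_superset (basicSubgroup_mem_nhds W) fun F hF k => hW (hF k)

theorem isBoundedSubset_plus (hO : IsBoundedSubset (O : Set X)) :
    IsBoundedSubset (plus m O : Set (TateAlgebra m X)) := by
  intro U hU
  obtain ⟨W, _, hW⟩ := nhds_hasBasis.mem_iff.1 hU
  obtain ⟨V, hV, hVW⟩ := hO W W.mem_nhds_zero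
  obtain ⟨V', hV'⟩ := NonarchimedeanRing.is_nonarchimedean V hV
  refine ⟨_, basicSubgroup_mem_nhds V', ?_⟩
  rintro _ ⟨F, hF, G, hG, rfl⟩
  refine hW fun k => ?_
  rw [coeff_mul]
  exact sum_mem fun p _ => hVW (Set.mul_mem_mul (hV' (hF _)) (hG _))

/-- A continuous ring homomorphism maps `O⟨T₁, …, Tₘ⟩` into a closed subring that contains the
images of `O` and of the variables. -/
theorem map_mem_of_mem_plus {Y : Type*} [CommRing Y] [TopologicalSpace Y]
    (θ : TateAlgebra m X →+* Y) (hθ : Continuous θ) {D : Subring Y} (hD : IsClosed (D : Set Y))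
    (hO : ∀ a ∈ O, θ (monomial 0 a) ∈ D) (hv : ∀ i, θ (var i) ∈ D) {F : TateAlgebra m X}
    (hF : F ∈ plus m O) : θ F ∈ D := by
  refine hD.mem_of_tendsto ((hasSum_monomial F).map θ hθ) (Eventually.of_forall fun s => ?_)
  refine sum_mem fun k _ => ?_
  rw [Function.comp_apply, monomial_eq_mul, map_mul, map_prod]
  refine mul_mem (hO _ (hF k)) (prod_mem fun i _ => ?_)
  rw [map_pow]
  exact pow_mem (hv i) _

end TateAlgebra

/-- A subring of an `A`-algebra that contains the image of the subring `P` of `A`, as a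
`P`-submodule. -/
def Subring.asSubmodule {A X : Type*} [CommRing A] [CommRing X] [Algebra A X] (O : Subring X)
    (P : Subring A) (h : ∀ p ∈ P, algebraMap A X p ∈ O) : Submodule P X where
  carrier := O
  zero_mem' := O.zero_mem
  add_mem' := O.add_mem
  smul_mem' p x hx := by
    change (p : A) • x ∈ O
    rw [Algebra.smul_def]
    exact O.mul_mem (h p p.2) hx

@[simp] theorem Subring.coe_asSubmodule {A X : Type*} [CommRing A] [CommRing X] [Algebra A X]
    (O : Subring X) (P : Subring A) (h : ∀ p ∈ P, algebraMap A X p ∈ O) :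
    (O.asSubmodule P h : Set X) = O := rfl

end Plus

/-! ### Integral elements modulo an ideal -/

section IntegralMod

open Polynomial

/-- An element that is integral over `O` is integral modulo `I` over every ring `D` that contains
the coefficients of an integral equation up to elements of `I`. -/
theorem isIntegralElem_mod_of_approx {O C D : Type*} [CommRing O] [CommRing C] [CommRing D]
    (i : O →+* C) (ρ : D →+* C) (I : Ideal C) {x : C} {p : O[X]} (hp : p.Monic)
    (hx : p.eval₂ i x = 0) (h : ∀ k, ∃ d, i (p.coeff k) - ρ d ∈ I) :
    ((Ideal.Quotient.mk I).comp ρ).IsIntegralElem (Ideal.Quotient.mk I x) := by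
  have h1 : p.map ((Ideal.Quotient.mk I).comp i) ∈ lifts ((Ideal.Quotient.mk I).comp ρ) := by
    rw [lifts_iff_coeff_lifts]
    intro k
    obtain ⟨d, hd⟩ := h k
    refine ⟨d, ?_⟩
    rw [coeff_map, RingHom.comp_apply, RingHom.comp_apply, eq_comm, Ideal.Quotient.eq]
    exact hd
  obtain ⟨q, hq, -, hqm⟩ := lifts_and_natDegree_eq_and_monic h1 (hp.map _)
  refine ⟨q, hqm, ?_⟩
  rw [eval₂_eq_eval_map, hq, ← eval₂_eq_eval_map, ← hom_eval₂, hx, map_zero]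

/-- Finitely many elements that are integral modulo `I` generate a finite module modulo `I`. -/
theorem exists_finite_generators_mod {C D : Type*} [CommRing C] [CommRing D] (ρ : D →+* C)
    (I : Ideal C) {n : ℕ} (x : Fin n → C)
    (hx : ∀ i, ((Ideal.Quotient.mk I).comp ρ).IsIntegralElem (Ideal.Quotient.mk I (x i))) :
    ∃ (r : ℕ) (t : Fin r → C), ∀ z ∈ Subring.closure (Set.range ρ ∪ Set.range x),
      ∃ d : Fin r → D, z - ∑ j, ρ (d j) * t j ∈ I := by
  let := ((Ideal.Quotient.mk I).comp ρ).toAlgebra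
  have h1 := fg_adjoin_of_finite (R := D) (Set.finite_range fun i => Ideal.Quotient.mk I (x i))
    (by rintro _ ⟨i, rfl⟩; exact hx i)
  obtain ⟨r, t', ht'⟩ := Submodule.fg_iff_exists_fin_generating_family.1 h1
  choose t ht using fun j => Ideal.Quotient.mk_surjective (t' j)
  refine ⟨r, t, fun z hz => ?_⟩
  have h2 : Subring.closure (Set.range ρ ∪ Set.range x) ≤
      (Algebra.adjoin D (Set.range fun i => Ideal.Quotient.mk I (x i))).toSubring.comap
        (Ideal.Quotient.mk I) := by
    refine Subring.closure_le.2 (Set.union_subset ?_ ?_)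
    · rintro _ ⟨d, rfl⟩
      exact (Algebra.adjoin D (Set.range fun i => Ideal.Quotient.mk I (x i))).algebraMap_mem d
    · rintro _ ⟨i, rfl⟩
      exact Algebra.subset_adjoin ⟨i, rfl⟩
  have h3 : Ideal.Quotient.mk I z ∈ Submodule.span D (Set.range t') := by
    rw [ht']
    exact h2 hz
  obtain ⟨d, hd⟩ := (Submodule.mem_span_range_iff_exists_fun D).1 h3
  refine ⟨d, ?_⟩
  rw [← Ideal.Quotient.eq, ← hd, map_sum]
  refine Finset.sum_congr rfl fun j _ => ?_
  rw [map_mul, ht, Algebra.smul_def]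
  rfl

end IntegralMod

/-! ### Approximation of the ring of integral elements -/

section Approximants

variable {C : Type*} [CommRing C]

theorem exists_finite_mem_subring_closure {G S : Set C} {c : C}
    (hc : c ∈ Subring.closure (G ∪ S)) :
    ∃ E : Set C, E.Finite ∧ E ⊆ S ∧ c ∈ Subring.closure (G ∪ E) := by
  have mono : ∀ {E E' : Set C}, E ⊆ E' → Subring.closure (G ∪ E) ≤ Subring.closure (G ∪ E') :=
    fun h => Subring.closure_mono (Set.union_subset_union_right _ h)
  induction hc using Subring.closure_induction with
  | mem c hc =>
    rcases hc with hc | hc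
    · exact ⟨∅, Set.finite_empty, Set.empty_subset _, Subring.subset_closure (Or.inl hc)⟩
    · exact ⟨{c}, Set.finite_singleton c, Set.singleton_subset_iff.2 hc,
        Subring.subset_closure (Or.inr rfl)⟩
  | zero => exact ⟨∅, Set.finite_empty, Set.empty_subset _, zero_mem _⟩
  | one => exact ⟨∅, Set.finite_empty, Set.empty_subset _, one_mem _⟩
  | add c d _ _ hc hd =>
    obtain ⟨E, hE, hES, hcE⟩ := hc
    obtain ⟨E', hE', hES', hcE'⟩ := hd
    exact ⟨E ∪ E', hE.union hE', Set.union_subset hES hES', add_mem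
      (mono Set.subset_union_left hcE) (mono Set.subset_union_right hcE')⟩
  | neg c _ hc =>
    obtain ⟨E, hE, hES, hcE⟩ := hc
    exact ⟨E, hE, hES, neg_mem hcE⟩
  | mul c d _ _ hc hd =>
    obtain ⟨E, hE, hES, hcE⟩ := hc
    obtain ⟨E', hE', hES', hcE'⟩ := hd
    exact ⟨E ∪ E', hE.union hE', Set.union_subset hES hES', mul_mem
      (mono Set.subset_union_left hcE) (mono Set.subset_union_right hcE')⟩

variable [TopologicalSpace C] [NonarchimedeanRing C]

theorem exists_finite_approx {G S : Set C} {c : C}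
    (hc : c ∈ closure (Subring.closure (G ∪ S) : Set C)) {W : Set C} (hW : W ∈ 𝓝 0) :
    ∃ E : Set C, E.Finite ∧ E ⊆ S ∧ ∃ c' ∈ Subring.closure (G ∪ E), c - c' ∈ W := by
  have h1 : {y | c - y ∈ W} ∈ 𝓝 c :=
    ((continuous_const.sub continuous_id).tendsto' c 0 (sub_self c)) hW
  obtain ⟨c', hc'W, hc'⟩ := mem_closure_iff_nhds.1 hc _ h1
  obtain ⟨E, hE, hES, hcE⟩ := exists_finite_mem_subring_closure hc'
  exact ⟨E, hE, hES, c', hcE, hc'W⟩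

/-- Over an analytic ring, approximation extends from a bounded open subring to the whole ring at
the cost of scalars. -/
theorem exists_finite_approx_span {A : Type*} [CommRing A] [TopologicalSpace A]
    [IsTopologicalRing A] [Algebra A C] [ContinuousSMul A C] (hA : NhdsSpanTop A) {G S : Set C}
    {Cb : Subring C} (hCb : IsOpen (Cb : Set C))
    (hd : (Cb : Set C) ⊆ closure (Subring.closure (G ∪ S))) (c : C) {W : Set C} (hW : W ∈ 𝓝 0) :
    ∃ E : Set C, E.Finite ∧ E ⊆ S ∧
      ∃ c' ∈ Submodule.span A (Subring.closure (G ∪ E) : Set C), c - c' ∈ W := by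
  have h1 : c ∈ Submodule.span A (Cb : Set C) := by
    rw [hA.eq_top_of_mem_nhds (mem_of_superset (hCb.mem_nhds (zero_mem Cb)) Submodule.subset_span)]
    trivial
  induction h1 using Submodule.span_induction generalizing W with
  | mem c hc =>
    obtain ⟨E, hE, hES, c', hc', h⟩ := exists_finite_approx (hd hc) hW
    exact ⟨E, hE, hES, c', Submodule.subset_span hc', h⟩
  | zero => exact ⟨∅, Set.finite_empty, Set.empty_subset _, 0, zero_mem _, by
      simpa using mem_of_mem_nhds hW⟩
  | add c d _ _ hc hd =>
    obtain ⟨U, hU, hUW⟩ := exists_nhds_zero_half hW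
    obtain ⟨E, hE, hES, c', hcE, h⟩ := hc hU
    obtain ⟨E', hE', hES', d', hdE', h'⟩ := hd hU
    refine ⟨E ∪ E', hE.union hE', Set.union_subset hES hES', c' + d', add_mem ?_ ?_, ?_⟩
    · exact Submodule.span_mono (Subring.closure_mono
        (Set.union_subset_union_right _ Set.subset_union_left)) hcE
    · exact Submodule.span_mono (Subring.closure_mono
        (Set.union_subset_union_right _ Set.subset_union_right)) hdE'
    · rw [add_sub_add_comm]
      exact hUW _ h _ h'
  | smul a c _ hc =>
    have h2 : {y | a • y ∈ W} ∈ 𝓝 (0 : C) :=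
      ((continuous_const_smul a).tendsto' (0 : C) 0 (smul_zero a)) hW
    obtain ⟨E, hE, hES, c', hcE, h⟩ := hc h2
    exact ⟨E, hE, hES, a • c', Submodule.smul_mem _ a hcE, by rw [← smul_sub]; exact h⟩

end Approximants

/-! ### Surjectivity onto an algebra of finite type -/

section Surjectivity

variable {A : Type*} [CommRing A] [TopologicalSpace A] [IsTopologicalRing A]
  {C : Type*} [CommRing C] [TopologicalSpace C] [NonarchimedeanRing C] [NullComplete C]
  [Algebra A C] [ContinuousSMul A C]

set_option maxHeartbeats 800000 in
/-- Let `V` be a bounded open submodule in which the polynomials in the `x i` are dense. The `x i`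
satisfy integral equations with coefficients in `Cb`; up to elements of `J • V` these have
coefficients in the subring generated by `G` and a finite subset `E` of `S`, so that all polynomials
in the `x i` are, up to elements of `J • V`, combinations of finitely many elements `t j`, which can
also be approximated. -/
theorem exists_finite_generators_mod_smul (hA : NhdsSpanTop A) {P : Subring A} {J : Ideal P}
    (hJ : IsAdicPair P J) {Cb : Subring C} (hCbo : IsOpen (Cb : Set C))
    (hCb : IsBoundedSubset (Cb : Set C)) {G S : Set C} (hG : G ⊆ Cb) (hS : S ⊆ Cb)
    (hd : (Cb : Set C) ⊆ closure (Subring.closure (G ∪ S))) {n : ℕ} {x : Fin n → C}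
    (hx : ∀ i, IsIntegral Cb (x i)) {V : Submodule P C} (hV : (V : Set C) ∈ 𝓝 0)
    (hVd : (V : Set C) ⊆ closure (Subring.closure (G ∪ Set.range x))) :
    ∃ E : Set C, E.Finite ∧ E ⊆ S ∧ ∃ (r : ℕ) (t : Fin r → C),
      (∀ j, t j ∈ Submodule.span A (Subring.closure (G ∪ E) : Set C)) ∧
      ∀ v ∈ V, ∃ d : Fin r → C, (∀ j, d j ∈ Subring.closure (G ∪ E)) ∧
        v - ∑ j, d j * t j ∈ J • V := by
  have mono : ∀ {E E' : Set C}, E ⊆ E' → Subring.closure (G ∪ E) ≤ Subring.closure (G ∪ E') :=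
    fun h => Subring.closure_mono (Set.union_subset_union_right _ h)
  have hle : ∀ {E : Set C}, E ⊆ S → Subring.closure (G ∪ E) ≤ Cb := fun h =>
    Subring.closure_le.2 (Set.union_subset hG (h.trans hS))
  let C' := Algebra.adjoin Cb (Set.range x)
  have hC'b : IsBoundedSubset (C' : Set C) :=
    hCb.adjoin (Set.finite_range x) (by rintro _ ⟨i, rfl⟩; exact hx i)
  have hCbC' : ∀ c ∈ Cb, c ∈ C' := fun c hc => C'.algebraMap_mem ⟨c, hc⟩
  have hJV : ((J • V : Submodule P C) : Set C) ∈ 𝓝 0 := hJ.smul_mem_nhds hA hV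
  obtain ⟨W, hW, hWV⟩ := hC'b _ hJV
  replace hWV : ∀ w ∈ W, ∀ c ∈ C', w * c ∈ J • V := fun w hw c hc =>
    hWV (Set.mul_mem_mul hw hc)
  -- the conductor of `C'` into `J • V`
  let I : Ideal C' :=
    { carrier := {c | ∀ d : C', (c : C) * d ∈ J • V}
      zero_mem' := fun d => by simp
      add_mem' := fun ha hb d => by
        rw [Subalgebra.coe_add, add_mul]
        exact add_mem (ha d) (hb d)
      smul_mem' := fun c a ha d => by
        have := ha (c * d)
        rw [Subalgebra.coe_mul] at this
        rw [smul_eq_mul, Subalgebra.coe_mul]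
        convert this using 1
        ring }
  have hWI : ∀ c : C', (c : C) ∈ W → c ∈ I := fun c hc d => hWV c hc d d.2
  have hIV : ∀ c ∈ I, (c : C) ∈ J • V := fun c hc => by simpa using hc 1
  -- integral equations over `Cb`, and approximations of their coefficients
  choose p hpm hp using hx
  choose E hE hES β hβ hβW using fun i k => exists_finite_approx (hd ((p i).coeff k).2) hW
  let E₁ : Set C := ⋃ i, ⋃ k ∈ (p i).support, E i k
  have hEsub : ∀ i, ∀ k ∈ (p i).support, E i k ⊆ E₁ := fun i k hk y hy =>
    Set.mem_iUnion.2 ⟨i, Set.mem_iUnion₂.2 ⟨k, hk, hy⟩⟩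
  have hE₁ : E₁.Finite := Set.finite_iUnion fun i => (p i).support.finite_toSet.biUnion
    fun k _ => hE i k
  have hE₁S : E₁ ⊆ S := Set.iUnion_subset fun i => Set.iUnion₂_subset fun k _ => hES i k
  let D := Subring.closure (G ∪ E₁)
  let ρ : D →+* C' := D.subtype.codRestrict C' fun d => hCbC' _ (hle hE₁S d.2)
  let x' : Fin n → C' := fun i => ⟨x i, Algebra.subset_adjoin ⟨i, rfl⟩⟩
  have hint : ∀ i, ((Ideal.Quotient.mk I).comp ρ).IsIntegralElem (Ideal.Quotient.mk I (x' i)) := by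
    intro i
    refine isIntegralElem_mod_of_approx (algebraMap Cb C') ρ I (hpm i) ?_ fun k => ?_
    · refine Subtype.ext ?_
      have := Polynomial.hom_eval₂ (p i) (algebraMap Cb C') C'.val.toRingHom (x' i)
      exact this.trans (hp i)
    · by_cases hk : k ∈ (p i).support
      · have hmem : β i k ∈ D := mono (hEsub i k hk) (hβ i k)
        exact ⟨⟨β i k, hmem⟩, hWI _ (hβW i k)⟩
      · rw [Polynomial.notMem_support_iff] at hk
        exact ⟨0, by rw [hk, map_zero, map_zero, sub_zero]; exact zero_mem I⟩
  obtain ⟨r, t, ht⟩ := exists_finite_generators_mod ρ I x' hint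
  choose E₂ hE₂ hE₂S t' ht' htW using fun j => exists_finite_approx_span hA hCbo hd (t j : C) hW
  refine ⟨E₁ ∪ ⋃ j, E₂ j, hE₁.union (Set.finite_iUnion hE₂),
    Set.union_subset hE₁S (Set.iUnion_subset hE₂S), r, t', fun j => ?_, fun v hv => ?_⟩
  · exact Submodule.span_mono (mono (Set.subset_union_of_subset_right
      (Set.subset_iUnion_of_subset j subset_rfl) _)) (ht' j)
  · obtain ⟨z, hzV, hz⟩ := mem_closure_iff_nhds.1 (hVd hv) {y | v - y ∈ (J • V : Submodule P C)}
      (((continuous_const.sub continuous_id).tendsto' v 0 (sub_self v)) hJV)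
    have h1 : Subring.closure (G ∪ Set.range x) ≤
        (Subring.closure (Set.range ρ ∪ Set.range x')).map C'.val.toRingHom := by
      refine Subring.closure_le.2 (Set.union_subset (fun c hc => ?_) ?_)
      · exact ⟨ρ ⟨c, Subring.subset_closure (Or.inl hc)⟩,
          Subring.subset_closure (Or.inl ⟨_, rfl⟩), rfl⟩
      · rintro _ ⟨i, rfl⟩
        exact ⟨x' i, Subring.subset_closure (Or.inr ⟨i, rfl⟩), rfl⟩
    obtain ⟨z', hz', rfl⟩ := h1 hz
    obtain ⟨d, hd'⟩ := ht z' hz'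
    refine ⟨fun j => d j, fun j => mono Set.subset_union_left (d j).2, ?_⟩
    have h2 := hIV _ hd'
    have h3 : ∀ j, (d j : C) * (t j - t' j) ∈ J • V := fun j => by
      rw [mul_comm]
      exact hWV _ (htW j) _ (ρ (d j)).2
    have h4 : v - ∑ j, (d j : C) * t' j = (v - z') + ((z' - ∑ j, ρ (d j) * t j : C') : C)
        + ∑ j, (d j : C) * (t j - t' j) := by
      rw [Subalgebra.coe_sub, AddSubmonoidClass.coe_finsetSum]
      have : ∀ j, ((ρ (d j) * t j : C') : C) = d j * t j := fun _ => rfl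
      simp only [this, mul_sub, Finset.sum_sub_distrib]
      ring
    rw [h4]
    exact add_mem (add_mem hzV h2) (sum_mem fun j _ => h3 j)

/-- A continuous map `T` is surjective if, up to elements of `J • V`, a bounded open submodule `V` is
contained in the `D`-module generated by finitely many `t j` in the `A`-span of `D`, where `D` is a
subring of the image of a bounded subring. -/
theorem surjective_of_finite_generators_mod_smul (hA : NhdsSpanTop A) {P : Subring A} {J : Ideal P}
    (hJ : IsAdicPair P J) {V : Submodule P C} (hV : (V : Set C) ∈ 𝓝 0)
    (hVb : BddOver A (V : Set C)) {D : Subring C} {r : ℕ} {t : Fin r → C}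
    (ht : ∀ j, t j ∈ Submodule.span A (D : Set C))
    (hd : ∀ v ∈ V, ∃ d : Fin r → C, (∀ j, d j ∈ D) ∧ v - ∑ j, d j * t j ∈ J • V)
    {X : Type*} [CommRing X] [TopologicalSpace X] [NonarchimedeanRing X] [NullComplete X]
    [Algebra A X] [ContinuousSMul A X] (T : X →ₐ[A] C) (hT : Continuous T) {Xb : Subring X}
    (hXb : IsBoundedSubset (Xb : Set X)) (hP : ∀ p ∈ P, algebraMap A X p ∈ Xb)
    (hD : D ≤ Xb.map T.toRingHom) : Function.Surjective T := by
  have h1 : ∀ j, ∃ ζ, T ζ = t j := fun j => by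
    have h2 : Submodule.span A (D : Set C) ≤ T.toLinearMap.range :=
      Submodule.span_le.2 fun c hc => by
        obtain ⟨y, _, hy⟩ := hD hc
        exact ⟨y, hy⟩
    exact h2 (ht j)
  choose ζ hζ using h1
  let Q : Submodule P X := (Submodule.pi Set.univ fun _ : Fin r => Xb.asSubmodule P hP).map
    ((sumMul A ζ).restrictScalars P)
  have hQ : BddOver A (Q : Set X) := by
    refine BddOver.image (BddOver.mono (hXb.bddOver.pi (r := Fin r)) ?_) (sumMul A ζ)
      (continuous_sumMul ζ)
    exact fun c hc i => hc i trivial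
  refine hJ.surjective_of_le_sup hA T.toLinearMap hT V hV hVb Q hQ fun v hv => ?_
  obtain ⟨d, hdD, hdv⟩ := hd v hv
  choose y hy hyd using fun j => hD (hdD j)
  refine Submodule.mem_sup.2 ⟨∑ j, d j * t j, ⟨_, ⟨y, fun j _ => hy j, rfl⟩, ?_⟩, _, hdv, by ring⟩
  change T (∑ j, y j * ζ j) = _
  rw [map_sum]
  refine Finset.sum_congr rfl fun j _ => ?_
  rw [map_mul, hζ, ← hyd j]
  rfl

/-- A map is surjective if the image of a bounded subring is dense in a bounded open subring. -/
theorem surjective_of_dense (hA : NhdsSpanTop A) {P : Subring A} {J : Ideal P}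
    (hJ : IsAdicPair P J) {O : Subring C} (hO : (O : Set C) ∈ 𝓝 0)
    (hOb : IsBoundedSubset (O : Set C)) (hPO : ∀ p ∈ P, algebraMap A C p ∈ O)
    {X : Type*} [CommRing X] [TopologicalSpace X] [NonarchimedeanRing X] [NullComplete X]
    [Algebra A X] [ContinuousSMul A X] (T : X →ₐ[A] C) (hT : Continuous T) {Xb : Subring X}
    (hXb : IsBoundedSubset (Xb : Set X)) (hP : ∀ p ∈ P, algebraMap A X p ∈ Xb)
    (hD : (O : Set C) ⊆ closure (Xb.map T.toRingHom)) : Function.Surjective T := by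
  refine surjective_of_finite_generators_mod_smul hA hJ (V := O.asSubmodule P hPO) hO hOb.bddOver
    (D := Xb.map T.toRingHom) (t := fun _ : Fin 1 => 1) (fun j => Submodule.subset_span (one_mem _))
    (fun v hv => ?_) T hT hXb hP le_rfl
  have hJV := hJ.smul_mem_nhds hA (V := O.asSubmodule P hPO) hO
  obtain ⟨z, hzV, hz⟩ := mem_closure_iff_nhds.1 (hD hv)
    {y | v - y ∈ (J • O.asSubmodule P hPO : Submodule P C)}
    (((continuous_const.sub continuous_id).tendsto' v 0 (sub_self v)) hJV)
  exact ⟨fun _ => z, fun _ => hz, by simpa using hzV⟩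

end Surjectivity

/-! ### The kernel of an evaluation map -/

section EvalKernel

namespace TateAlgebra

variable {A : Type*} [CommRing A] {m : ℕ}
  {Q : Type*} [CommRing Q] [TopologicalSpace Q] [NonarchimedeanRing Q] [NullComplete Q] [Algebra A Q]
  {C : Type*} [CommRing C] [TopologicalSpace C] [NonarchimedeanRing C] [NullComplete C] [Algebra A C]

/-- The map `Q⟨T₁, …, Tₘ⟩ → C⟨T₁, …, Tₘ⟩` that applies `s` to the coefficients. -/
noncomputable def map (m : ℕ) (s : Q →ₐ[A] C) (hs : Continuous s) :
    TateAlgebra m Q →ₐ[A] TateAlgebra m C :=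
  eval ((constHom m A C).comp s) ((continuous_constHom (A := A)).comp hs) var
    (isBoundedSubset_monomials_var m C)

section map

variable (s : Q →ₐ[A] C) (hs : Continuous s)

theorem continuous_map : Continuous (map m s hs) := continuous_eval _ _ _ _

@[simp] theorem map_monomial_zero (a : Q) : map m s hs (monomial 0 a) = monomial 0 (s a) :=
  eval_monomial_zero _ _ _ _ _

@[simp] theorem map_var (i : Fin m) : map m s hs (var i) = var i := eval_var _ _ _ _ _

theorem coeff_map (F : TateAlgebra m Q) (k) : (map m s hs F).coeff k = s (F.coeff k) := by
  classical
  refine DFunLike.congr_fun (addHom_ext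
    (S := (coeffHom k).comp (map m s hs : TateAlgebra m Q →+ TateAlgebra m C))
    (T := (s : Q →+ C).comp (coeffHom k)) ((continuous_coeff k).comp (continuous_map s hs))
    (hs.comp (continuous_coeff k)) fun l a => ?_) F
  simp only [AddMonoidHom.comp_apply, AddMonoidHom.coe_coe, coeffHom_apply]
  rw [monomial_eq_mul, map_mul, map_monomial_zero, map_prod]
  simp only [map_pow, map_var]
  rw [prod_var_pow, monomial_mul, prod_var_pow, monomial_mul, coeff_monomial, coeff_monomial,
    apply_ite s]
  simp

end map

/-- The kernel of the evaluation `C⟨T₁, …, Tₘ⟩ → C` at `e` is generated by the `Tⱼ - e j`: for a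
bounded subring `Cb` containing `e`, the coefficients in an expression of `T ^ α - e ^ α` by these
elements can be chosen in the bounded subring `Cb⟨T₁, …, Tₘ⟩`. -/
theorem exists_sub_eval_eq_sum {Cb : Subring C} (hCb : IsBoundedSubset (Cb : Set C)) {e : Fin m → C}
    (he : ∀ j, e j ∈ Cb) (hy : IsBoundedSubset (monomials e)) (F : TateAlgebra m C) :
    ∃ H : Fin m → TateAlgebra m C, F - monomial 0 (eval (AlgHom.id A C) continuous_id e hy F)
      = ∑ j, H j * (var j - monomial 0 (e j)) := by
  let O := plus m Cb
  let v : Fin m → O := fun j => ⟨var j, var_mem_plus j⟩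
  let w : Fin m → O := fun j => ⟨monomial 0 (e j), monomial_mem_plus (he j) 0⟩
  have h1 : ∀ α : Fin m →₀ ℕ, ∃ h : Fin m → O,
      ∑ j, h j * (v j - w j) = ∏ j, v j ^ α j - ∏ j, w j ^ α j := fun α => by
    refine Ideal.mem_span_range_iff_exists_fun.1 ?_
    rw [← Ideal.Quotient.eq, map_prod, map_prod]
    refine Finset.prod_congr rfl fun j _ => ?_
    rw [map_pow, map_pow]
    congr 1
    rw [Ideal.Quotient.eq]
    exact Ideal.subset_span ⟨j, rfl⟩
  choose h hh using h1
  have hval : ∀ α, ∑ j, (h α j : TateAlgebra m C) * (var j - monomial 0 (e j))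
      = monomial α 1 - monomial 0 (∏ j, e j ^ α j) := fun α => by
    have h2 := congrArg O.subtype (hh α)
    rw [map_sum, map_sub, map_prod, map_prod] at h2
    simp only [map_mul, map_sub, map_pow] at h2
    have h3 : (monomial 0 (∏ j, e j ^ α j) : TateAlgebra m C) = ∏ j, monomial 0 (e j) ^ α j := by
      change constHom m A C _ = ∏ j, constHom m A C (e j) ^ α j
      rw [map_prod]
      exact Finset.prod_congr rfl fun j _ => map_pow _ _ _
    rw [h3, ← prod_var_pow]
    exact h2
  have hb : ∀ j, IsBoundedSubset (Set.range fun α => (h α j : TateAlgebra m C)) := fun j =>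
    (isBoundedSubset_plus hCb).mono (by rintro _ ⟨α, rfl⟩; exact (h α j).2)
  have hs : ∀ j, Summable fun α => monomial 0 (F.coeff α) * (h α j : TateAlgebra m C) := fun j =>
    NullComplete.summable ((equicont_of_bounded (continuous_monomial 0) (hb j)).null (toC0 m C F))
  choose H hH using hs
  refine ⟨H, ?_⟩
  have h4 : HasSum (fun α => ∑ j, monomial 0 (F.coeff α) * (h α j : TateAlgebra m C)
      * (var j - monomial 0 (e j))) (∑ j, H j * (var j - monomial 0 (e j))) :=
    hasSum_sum (s := Finset.univ) fun j _ => (hH j).mul_right _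
  have h5 := (hasSum_monomial F).sub
    ((hasSum_eval (AlgHom.id A C) continuous_id e hy F).map (monomial 0) (continuous_monomial 0))
  refine h5.unique ?_
  have h6 : (fun α => ∑ j, monomial 0 (F.coeff α) * (h α j : TateAlgebra m C)
      * (var j - monomial 0 (e j))) = fun α => monomial α (F.coeff α) -
        monomial 0 (AlgHom.id A C (F.coeff α) * ∏ j, e j ^ α j) := by
    ext1 α
    simp only [mul_assoc, ← Finset.mul_sum]
    rw [hval, mul_sub, monomial_mul, monomial_mul, zero_add, mul_one, zero_add]
    rfl
  rw [h6] at h4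
  exact h4

variable [TopologicalSpace A] [IsTopologicalRing A] [FirstCountableTopology A]
  [ContinuousSMul A Q] [ContinuousSMul A C]

/-- If `s : Q → C` is surjective with finitely generated kernel, then so is the kernel of its
extension to `Q⟨T₁, …, Tₘ⟩`. -/
theorem ker_eval_fg (hA : NhdsSpanTop A) (s : Q →ₐ[A] C) (hs : Continuous s)
    (hsurj : Function.Surjective s) (hk : (RingHom.ker s).FG) {Cb : Subring C}
    (hCb : IsBoundedSubset (Cb : Set C)) {e : Fin m → C} (he : ∀ j, e j ∈ Cb)
    (hy : IsBoundedSubset (monomials e)) : (RingHom.ker (eval s hs e hy)).FG := by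
  obtain ⟨r, k, hkr⟩ := Submodule.fg_iff_exists_fin_generating_family.1 hk
  replace hkr : Ideal.span (Set.range k) = RingHom.ker s := hkr
  have hk0 : ∀ i, s (k i) = 0 := fun i => by
    rw [← RingHom.mem_ker, ← hkr]; exact Ideal.subset_span ⟨i, rfl⟩
  choose e' he' using fun j => hsurj (e j)
  have hcomp : ∀ F, eval (AlgHom.id A C) continuous_id e hy (map m s hs F) = eval s hs e hy F := by
    refine fun F => DFunLike.congr_fun (algHom_ext
      (s := (eval (AlgHom.id A C) continuous_id e hy).comp (map m s hs)) (t := eval s hs e hy)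
      ((continuous_eval (AlgHom.id A C) continuous_id e hy).comp (continuous_map s hs))
      (continuous_eval s hs e hy)
      (fun a => ?_) (fun i => ?_)) F
    · rw [AlgHom.comp_apply, map_monomial_zero, eval_monomial_zero]
      exact eval_monomial_zero _ _ _ _ _
    · rw [AlgHom.comp_apply, map_var, eval_var]
      exact eval_var _ _ _ _ _
  let gen : Fin m ⊕ Fin r → TateAlgebra m Q :=
    Sum.elim (fun j => var j - monomial 0 (e' j)) (fun i => monomial 0 (k i))
  refine ⟨(Set.finite_range gen).toFinset, ?_⟩
  rw [Set.Finite.coe_toFinset]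
  refine le_antisymm (Ideal.span_le.2 ?_) fun F hF => ?_
  · rintro _ ⟨j | i, rfl⟩
    · change eval s hs e hy (var j - monomial 0 (e' j)) = 0
      rw [map_sub, eval_var, eval_monomial_zero, he', sub_self]
    · change eval s hs e hy (monomial 0 (k i)) = 0
      rw [eval_monomial_zero, hk0]
  · obtain ⟨H, hH⟩ := exists_sub_eval_eq_sum (A := A) hCb he hy (map m s hs F)
    rw [hcomp, (hF : eval s hs e hy F = 0), map_zero, sub_zero] at hH
    have hlift : ∀ j, ∃ H' : TateAlgebra m Q, map m s hs H' = H j := fun j => by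
      obtain ⟨x, hx, hxs⟩ := (OpenOntoRange.of_isOpenMap (T := s.toLinearMap.toAddMonoidHom)
        (hA.isOpenMap s.toLinearMap hs hsurj)).exists_null_lift (toC0 m C (H j)).null
        (fun α => hsurj _)
      refine ⟨(toC0 m Q).symm (C0.mk x hx), TateAlgebra.ext fun α => ?_⟩
      rw [coeff_map]
      exact hxs α
    choose H' hH' using hlift
    -- the coefficients of the difference lie in the kernel of `s`
    set D := F - ∑ j, H' j * (var j - monomial 0 (e' j)) with hD
    have hmapD : map m s hs D = 0 := by
      rw [hD, map_sub, hH, map_sum, ← Finset.sum_sub_distrib]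
      refine Finset.sum_eq_zero fun j _ => ?_
      rw [map_mul, map_sub, map_var, map_monomial_zero, hH', he', sub_self]
    have hDk : ∀ α, D.coeff α ∈ Ideal.span (Set.range k) := fun α => by
      rw [hkr]
      change s _ = 0
      rw [← coeff_map s hs, hmapD, coeff_zero]
    have hcl : IsClosed (Ideal.span (Set.range k) : Set Q) := by
      rw [hkr]
      exact isClosed_singleton.preimage hs
    obtain ⟨c, hc, hck⟩ := hA.exists_null_coeff k hcl D.coeff_null hDk
    let c' : Fin r → TateAlgebra m Q := fun i => (toC0 m Q).symm (C0.mk (fun α => c α i)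
      (((continuous_apply i).tendsto _).comp hc))
    have hDsum : D = ∑ i, c' i * monomial 0 (k i) := by
      refine TateAlgebra.ext fun α => ?_
      rw [← hck α, ← coeffHom_apply, map_sum]
      refine Finset.sum_congr rfl fun i _ => ?_
      rw [mul_comm (c' i), coeffHom_apply, coeff_monomial_zero_mul, mul_comm]
      rfl
    have hF' : F = ∑ j, H' j * (var j - monomial 0 (e' j)) + ∑ i, c' i * monomial 0 (k i) := by
      rw [← hDsum, hD]; ring
    rw [hF']
    exact add_mem (sum_mem fun j _ => Ideal.mul_mem_left _ _ (Ideal.subset_span ⟨Sum.inl j, rfl⟩))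
      (sum_mem fun i _ => Ideal.mul_mem_left _ _ (Ideal.subset_span ⟨Sum.inr i, rfl⟩))

end TateAlgebra

end EvalKernel

/-! ### Adjoining roots of monic polynomials -/

section Roots

open Polynomial

universe u v

/-- The algebra obtained by adjoining roots of finitely many monic polynomials. -/
theorem exists_finite_free_roots {X : Type u} [CommRing X] {n : ℕ} (p : Fin n → X[X])
    (hp : ∀ i, (p i).Monic) :
    ∃ (D : Type u) (_ : CommRing D) (_ : Algebra X D) (y : Fin n → D),
      Module.Finite X D ∧ Module.Free X D ∧ Algebra.FinitePresentation X D ∧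
      (∀ i, aeval (y i) (p i) = 0) ∧ Algebra.adjoin X (Set.range y) = ⊤ ∧
      ∀ (E : Type v) [CommRing E] [Algebra X E] (x : Fin n → E), (∀ i, aeval (x i) (p i) = 0) →
        ∃ ψ : D →ₐ[X] E, ∀ i, ψ (y i) = x i := by
  induction n with
  | zero =>
    exact ⟨X, inferInstance, inferInstance, fun i => i.elim0, inferInstance, inferInstance,
      inferInstance, fun i => i.elim0, Subsingleton.elim _ _,
      fun E _ _ x _ => ⟨Algebra.ofId X E, fun i => i.elim0⟩⟩
  | succ n ih =>
    obtain ⟨D, _, _, y, hfin, hfree, hfp, hy, hadj, hlift⟩ := ih (fun i => p i.succ) fun i => hp _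
    let q := (p 0).map (algebraMap X D)
    have hq : q.Monic := (hp 0).map _
    have := hq.free_adjoinRoot
    have := hq.finite_adjoinRoot
    let y' : Fin (n + 1) → AdjoinRoot q := Fin.cons (AdjoinRoot.root q) fun i => AdjoinRoot.of q (y i)
    refine ⟨AdjoinRoot q, inferInstance, inferInstance, y', Module.Finite.trans D _,
      Module.Free.trans (S := D), inferInstance, ?_, ?_, ?_⟩
    · intro i
      refine Fin.cases ?_ (fun i => ?_) i
      · have := AdjoinRoot.eval₂_root q
        rw [eval₂_map] at this
        exact this
      · have := congrArg (AdjoinRoot.of q) (hy i)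
        rw [aeval_def, hom_eval₂, map_zero] at this
        exact this
    · rw [eq_top_iff]
      intro z _
      have hz : z ∈ Algebra.adjoin D {AdjoinRoot.root q} := by
        rw [AdjoinRoot.adjoinRoot_eq_top]; trivial
      induction hz using Algebra.adjoin_induction with
      | mem z hz =>
        rw [Set.mem_singleton_iff.1 hz]
        exact Algebra.subset_adjoin ⟨0, rfl⟩
      | algebraMap d =>
        have hd : d ∈ Algebra.adjoin X (Set.range y) := by rw [hadj]; trivial
        have h1 : Algebra.adjoin X (Set.range y) ≤
            (Algebra.adjoin X (Set.range y')).comap (IsScalarTower.toAlgHom X D (AdjoinRoot q)) := by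
          refine Algebra.adjoin_le ?_
          rintro _ ⟨i, rfl⟩
          exact Algebra.subset_adjoin ⟨i.succ, rfl⟩
        exact h1 hd
      | add a b _ _ ha hb => exact add_mem (ha trivial) (hb trivial)
      | mul a b _ _ ha hb => exact mul_mem (ha trivial) (hb trivial)
    · intro E _ _ x hx
      obtain ⟨ψ, hψ⟩ := hlift E (fun i => x i.succ) fun i => hx _
      have h0 : q.eval₂ (ψ : D →+* E) (x 0) = 0 := by
        rw [eval₂_map]
        have : (ψ : D →+* E).comp (algebraMap X D) = algebraMap X E := ψ.comp_algebraMap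
        rw [this]
        exact hx 0
      refine ⟨AdjoinRoot.liftAlgHom q ψ (x 0) h0, fun i => ?_⟩
      refine Fin.cases ?_ (fun i => ?_) i
      · exact AdjoinRoot.lift_root h0
      · exact (AdjoinRoot.lift_of h0).trans (hψ i)

/-- The same algebra with the module topology. -/
theorem exists_complete_finite_roots {X : Type u} [CommRing X] [TopologicalSpace X]
    [NonarchimedeanRing X] [NullComplete X] {n : ℕ} (p : Fin n → X[X]) (hp : ∀ i, (p i).Monic) :
    ∃ (D : Type u) (_ : CommRing D) (_ : Algebra X D) (_ : TopologicalSpace D)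
      (_ : NonarchimedeanRing D) (_ : NullComplete D) (y : Fin n → D),
      Continuous (algebraMap X D) ∧ Algebra.FinitePresentation X D ∧
      (∀ i, aeval (y i) (p i) = 0) ∧ Algebra.adjoin X (Set.range y) = ⊤ ∧
      ∀ (E : Type v) [CommRing E] [Algebra X E] [TopologicalSpace E] [IsTopologicalRing E]
        (x : Fin n → E), Continuous (algebraMap X E) → (∀ i, aeval (x i) (p i) = 0) →
        ∃ ψ : D →ₐ[X] E, Continuous ψ ∧ ∀ i, ψ (y i) = x i := by
  obtain ⟨D, _, _, y, hfin, hfree, hfp, hy, hadj, hlift⟩ := exists_finite_free_roots.{u, v} p hp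
  let : TopologicalSpace D := moduleTopology X D
  have : IsModuleTopology X D := ⟨rfl⟩
  have : IsTopologicalRing D := IsModuleTopology.isTopologicalRing X D
  let b := Module.Free.chooseBasis X D
  have hN : NullComplete D := NullComplete.of_continuousAddEquiv b.equivFun.symm.toAddEquiv
    (IsModuleTopology.continuous_of_linearMap b.equivFun.symm.toLinearMap)
    (IsModuleTopology.continuous_of_linearMap b.equivFun.toLinearMap)
  refine ⟨D, _, _, _, ⟨hN.is_nonarchimedean⟩, hN, y, ?_, hfp, hy, hadj, ?_⟩
  · exact IsModuleTopology.continuous_of_linearMap (Algebra.linearMap X D)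
  · intro E _ _ _ _ x hc hx
    obtain ⟨ψ, hψ⟩ := hlift E x hx
    have : ContinuousSMul X E := continuousSMul_of_algebraMap _ _ hc
    exact ⟨ψ, IsModuleTopology.continuous_of_linearMap ψ.toLinearMap, hψ⟩

end Roots

/-! ### Finite generation of kernels -/

section KernelFG

universe u v

variable {A : Type*} [CommRing A] [TopologicalSpace A] [IsTopologicalRing A]
  [FirstCountableTopology A]
  {X : Type u} [CommRing X] [TopologicalSpace X] [NonarchimedeanRing X] [NullComplete X]
  {C : Type v} [CommRing C] [TopologicalSpace C] [NonarchimedeanRing C] [NullComplete C]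
  {Q : Type*} [CommRing Q] [TopologicalSpace Q] [NonarchimedeanRing Q] [NullComplete Q]
  [Algebra A X] [Algebra A C] [Algebra A Q]
  [ContinuousSMul A X] [ContinuousSMul A C] [ContinuousSMul A Q]

theorem IsBoundedSubset.monomials_of_mem {n : ℕ} {O : Subring X}
    (hO : IsBoundedSubset (O : Set X)) {y : Fin n → X} (hy : ∀ i, y i ∈ O) :
    IsBoundedSubset (TateAlgebra.monomials y) :=
  hO.mono (by rintro _ ⟨α, rfl⟩; exact prod_mem fun i _ => pow_mem (hy i) _)

set_option maxHeartbeats 800000 in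
/-- Let `s : Q⟨X₁, …, Xₙ⟩ → C` be surjective with finitely generated kernel and `T : X → C`
surjective, where `X` is a quotient of `Q⟨S₁, …, Sₘ⟩`. If the images of the `Xᵢ` satisfy integral
equations with coefficients in a bounded subring of `X`, then the kernel of `T` is finitely
generated: with the algebra `D` obtained from `X` by adjoining roots of these equations,
`Q⟨X₁, …, Xₙ⟩⟨S₁, …, Sₘ⟩ → D → C` shows that `C` is finitely presented over `D`, hence over `X`. -/
theorem ker_fg_of_isIntegral (hA : NhdsSpanTop A) (T : X →ₐ[A] C) (hT : Continuous T)
    (hTs : Function.Surjective T) {n m : ℕ} (s : TateAlgebra n Q →ₐ[A] C) (hs : Continuous s)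
    (hsurj : Function.Surjective s) (hk : (RingHom.ker s).FG) (σ : TateAlgebra m Q →ₐ[A] X)
    (hσ : Continuous σ) (hσs : Function.Surjective σ)
    (hcompat : ∀ a, T (σ (TateAlgebra.monomial 0 a)) = s (TateAlgebra.monomial 0 a))
    {Cb : Subring C} (hCb : IsBoundedSubset (Cb : Set C))
    (he : ∀ j, T (σ (TateAlgebra.var j)) ∈ Cb) {Xb : Subring X}
    (hXb : IsBoundedSubset (Xb : Set X)) {p : Fin n → Polynomial Xb} (hp : ∀ i, (p i).Monic)
    (hroot : ∀ i, (p i).eval₂ (T.toRingHom.comp Xb.subtype) (s (TateAlgebra.var i)) = 0) :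
    (RingHom.ker T).FG := by
  let : Algebra X C := T.toRingHom.toAlgebra
  obtain ⟨D, _, _, _, _, _, y, hXD, hfp, hy, hadj, hlift⟩ :=
    exists_complete_finite_roots.{u, v} (fun i => (p i).map Xb.subtype) fun i => (hp i).map _
  obtain ⟨π, hπ, hπy⟩ := hlift C (fun i => s (TateAlgebra.var i)) hT fun i => by
    rw [Polynomial.aeval_def, Polynomial.eval₂_map]
    exact hroot i
  let : Algebra A D := ((algebraMap X D).comp (algebraMap A X)).toAlgebra
  let α : X →ₐ[A] D := { algebraMap X D with commutes' := fun _ => rfl }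
  have hα : Continuous α := hXD
  have : ContinuousSMul A D := continuousSMul_of_algebraMap _ _
    (hXD.comp (continuous_algebraMap A X))
  have hπα : ∀ x, π (α x) = T x := fun x => π.commutes x
  let πA : D →ₐ[A] C := { π.toRingHom with
    commutes' := fun a => (hπα (algebraMap A X a)).trans (T.commutes a) }
  -- a bounded subring of `D` containing the `y i`
  have hO : IsBoundedSubset ((Xb.map (algebraMap X D) : Subring D) : Set D) := by
    rw [Subring.coe_map]
    exact hXb.image hA α hα
  have hyint : ∀ i, IsIntegral (Xb.map (algebraMap X D) : Subring D) (y i) := fun i => by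
    let ρ : Xb →+* (Xb.map (algebraMap X D) : Subring D) :=
      ((algebraMap X D).comp Xb.subtype).codRestrict _ fun x => ⟨x, x.2, rfl⟩
    refine ⟨(p i).map ρ, (hp i).map ρ, ?_⟩
    have := hy i
    rw [Polynomial.aeval_def, Polynomial.eval₂_map] at this
    rw [Polynomial.eval₂_map]
    exact this
  have hyb : IsBoundedSubset (TateAlgebra.monomials y) :=
    (hO.adjoin (Set.finite_range y) (by rintro _ ⟨i, rfl⟩; exact hyint i)).mono (by
      rintro _ ⟨k, rfl⟩
      have hyi : ∀ i, y i ∈ Algebra.adjoin (Xb.map (algebraMap X D) : Subring D) (Set.range y) :=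
        fun i => Algebra.subset_adjoin (Set.mem_range_self i)
      exact prod_mem fun i _ => pow_mem (hyi i) _)
  have hvb : IsBoundedSubset (TateAlgebra.monomials fun j => α (σ (TateAlgebra.var j))) := by
    refine ((isBoundedSubset_monomials_var m Q).image hA (α.comp σ) (hα.comp hσ)).mono ?_
    rintro _ ⟨k, rfl⟩
    refine ⟨_, ⟨k, rfl⟩, ?_⟩
    change (α.comp σ) _ = _
    rw [map_prod]
    exact Finset.prod_congr rfl fun j _ => map_pow _ _ _
  have h0c : Continuous ((α.comp σ).comp (TateAlgebra.constHom m A Q)) :=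
    (hα.comp hσ).comp (TateAlgebra.continuous_constHom (n := m) (A := A) (Q := Q))
  let Ψ₀ : TateAlgebra n Q →ₐ[A] D :=
    TateAlgebra.eval ((α.comp σ).comp (TateAlgebra.constHom m A Q)) h0c y hyb
  have hΨ₀ : Continuous Ψ₀ := TateAlgebra.continuous_eval _ _ _ _
  let Ψ : TateAlgebra m (TateAlgebra n Q) →ₐ[A] D :=
    TateAlgebra.eval Ψ₀ hΨ₀ (fun j => α (σ (TateAlgebra.var j))) hvb
  have hΨ : Continuous Ψ := TateAlgebra.continuous_eval _ _ _ _
  have hcc : Continuous (TateAlgebra.constHom n A Q) :=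
    TateAlgebra.continuous_constHom (n := n) (A := A) (Q := Q)
  have hΨσ : ∀ F, Ψ (TateAlgebra.map m (TateAlgebra.constHom n A Q) hcc F) = α (σ F) := fun F =>
    DFunLike.congr_fun (TateAlgebra.algHom_ext
      (s := Ψ.comp (TateAlgebra.map m (TateAlgebra.constHom n A Q) hcc)) (t := α.comp σ)
      (hΨ.comp (TateAlgebra.continuous_map _ hcc)) (hα.comp hσ)
      (fun a => by
        rw [AlgHom.comp_apply, TateAlgebra.map_monomial_zero]
        refine (TateAlgebra.eval_monomial_zero _ _ _ _ _).trans ?_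
        exact TateAlgebra.eval_monomial_zero _ _ _ _ _)
      (fun j => by
        rw [AlgHom.comp_apply, TateAlgebra.map_var]
        exact TateAlgebra.eval_var _ _ _ _ _)) F
  have hΨs : Function.Surjective Ψ := fun d => by
    have hd : d ∈ Algebra.adjoin X (Set.range y) := by rw [hadj]; trivial
    induction hd using Algebra.adjoin_induction with
    | mem d hd =>
      obtain ⟨i, rfl⟩ := hd
      refine ⟨TateAlgebra.monomial 0 (TateAlgebra.var i), ?_⟩
      exact (TateAlgebra.eval_monomial_zero _ _ _ _ _).trans (TateAlgebra.eval_var _ _ _ _ _)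
    | algebraMap x =>
      obtain ⟨F, rfl⟩ := hσs x
      exact ⟨_, hΨσ F⟩
    | add a b _ _ ha hb =>
      obtain ⟨a, rfl⟩ := ha
      obtain ⟨b, rfl⟩ := hb
      exact ⟨a + b, map_add _ _ _⟩
    | mul a b _ _ ha hb =>
      obtain ⟨a, rfl⟩ := ha
      obtain ⟨b, rfl⟩ := hb
      exact ⟨a * b, map_mul _ _ _⟩
  have heb : IsBoundedSubset (TateAlgebra.monomials fun j => T (σ (TateAlgebra.var j))) :=
    hCb.monomials_of_mem he
  have hΘ := TateAlgebra.ker_eval_fg hA s hs hsurj hk hCb he heb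
  have hπΨ : ∀ F, π (Ψ F) = TateAlgebra.eval s hs (fun j => T (σ (TateAlgebra.var j))) heb F := by
    have h1 : πA.comp Ψ₀ = s := by
      refine TateAlgebra.algHom_ext (s := πA.comp Ψ₀) (t := s) (hπ.comp hΨ₀) hs (fun a => ?_)
        fun i => ?_
      · rw [← hcompat, ← hπα]
        exact congrArg π (TateAlgebra.eval_monomial_zero _ h0c _ hyb a)
      · exact (congrArg π (TateAlgebra.eval_var _ h0c _ hyb i)).trans (hπy i)
    refine fun F => DFunLike.congr_fun (TateAlgebra.algHom_ext (s := πA.comp Ψ)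
      (t := TateAlgebra.eval s hs (fun j => T (σ (TateAlgebra.var j))) heb) (hπ.comp hΨ)
      (TateAlgebra.continuous_eval s hs _ heb) (fun a => ?_) fun j => ?_) F
    · rw [TateAlgebra.eval_monomial_zero]
      refine (congrArg π (TateAlgebra.eval_monomial_zero _ hΨ₀ _ hvb a)).trans ?_
      exact DFunLike.congr_fun h1 a
    · rw [TateAlgebra.eval_var]
      exact (congrArg π (TateAlgebra.eval_var _ hΨ₀ _ hvb j)).trans (hπα _)
  have hker : (RingHom.ker π.toRingHom).FG := by
    have h1 : RingHom.ker π.toRingHom = (RingHom.ker (TateAlgebra.eval s hs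
        (fun j => T (σ (TateAlgebra.var j))) heb)).map Ψ.toRingHom := by
      refine le_antisymm (fun d hd => ?_) (Ideal.map_le_iff_le_comap.2 fun F hF => ?_)
      · obtain ⟨F, rfl⟩ := hΨs d
        refine Ideal.mem_map_of_mem Ψ.toRingHom ?_
        change TateAlgebra.eval s hs _ heb F = 0
        rw [← hπΨ]
        exact hd
      · change π (Ψ F) = 0
        rw [hπΨ]
        exact hF
    rw [h1]
    exact hΘ.map _
  have hπs : Function.Surjective π := fun c => by
    obtain ⟨x, rfl⟩ := hTs c
    exact ⟨α x, hπα x⟩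
  have : Algebra.FinitePresentation X C := Algebra.FinitePresentation.of_surjective hπs hker
  exact Algebra.FinitePresentation.ker_fG_of_surjective (Algebra.ofId X C) hTs

end KernelFG

/-! ### Finitely presented algebras with prescribed integral generators -/

section FinitePresentation

universe u

variable {A : Type*} [CommRing A] [TopologicalSpace A] [IsTopologicalRing A]
  [FirstCountableTopology A]
  {C : Type*} [CommRing C] [TopologicalSpace C] [NonarchimedeanRing C] [NullComplete C]
  {Q : Type*} [CommRing Q] [TopologicalSpace Q] [NonarchimedeanRing Q] [NullComplete Q]
  [Algebra A C] [Algebra A Q] [ContinuousSMul A C] [ContinuousSMul A Q]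

theorem Subring.exists_submodule_coe_eq_image {A X C : Type*} [CommRing A] [CommRing X] [CommRing C]
    [Algebra A X] [Algebra A C] (O : Subring X) (P : Subring A)
    (h : ∀ p ∈ P, algebraMap A X p ∈ O) (T : X →ₐ[A] C) :
    ∃ V : Submodule P C, (V : Set C) = T '' (O : Set X) :=
  ⟨(O.asSubmodule P h).map (T.toLinearMap.restrictScalars P), by
    rw [Submodule.map_coe, Subring.coe_asSubmodule]
    rfl⟩

/-- Let `C` be a quotient of `Q⟨X₁, …, Xₙ⟩` such that the images of the variables are integral over
`Cb`. Then finitely many elements `E` of `S` suffice: every continuous map `T : X → C` whose values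
on a bounded subring include `G` and `E` is surjective. -/
theorem exists_finite_forall_surjective (hA : NhdsSpanTop A) {P : Subring A} {J : Ideal P}
    (hJ : IsAdicPair P J) {Cb : Subring C} (hCbo : IsOpen (Cb : Set C))
    (hCb : IsBoundedSubset (Cb : Set C)) {G S : Set C} (hG : G ⊆ Cb) (hS : S ⊆ Cb)
    (hd : (Cb : Set C) ⊆ closure (Subring.closure (G ∪ S))) {n : ℕ}
    (s : TateAlgebra n Q →ₐ[A] C) (hs : Continuous s) (hsurj : Function.Surjective s)
    (hx : ∀ i, IsIntegral Cb (s (TateAlgebra.var i))) {Qb : Subring Q} (hQo : (Qb : Set Q) ∈ 𝓝 0)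
    (hQb : IsBoundedSubset (Qb : Set Q)) (hPQ : ∀ p ∈ P, algebraMap A Q p ∈ Qb)
    (hQG : ∀ a ∈ Qb, s (TateAlgebra.monomial 0 a) ∈ closure (Subring.closure G : Set C)) :
    ∃ E : Set C, E.Finite ∧ E ⊆ S ∧ ∀ (X : Type u) [CommRing X] [TopologicalSpace X]
      [NonarchimedeanRing X] [NullComplete X] [Algebra A X] [ContinuousSMul A X] (T : X →ₐ[A] C),
      Continuous T → ∀ Xb : Subring X, IsBoundedSubset (Xb : Set X) →
      (∀ p ∈ P, algebraMap A X p ∈ Xb) → Subring.closure (G ∪ E) ≤ Xb.map T.toRingHom →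
      Function.Surjective T := by
  have hPn : ∀ p ∈ P, algebraMap A (TateAlgebra n Q) p ∈ TateAlgebra.plus n Qb := fun p hp => by
    rw [TateAlgebra.algebraMap_eq_const]
    exact TateAlgebra.monomial_mem_plus (hPQ p hp) 0
  obtain ⟨V, hVe⟩ := (TateAlgebra.plus n Qb).exists_submodule_coe_eq_image P hPn s
  have hso : IsOpenMap s := hA.isOpenMap s.toLinearMap hs hsurj
  have hV : (V : Set C) ∈ 𝓝 0 := by
    rw [hVe, ← map_zero s]
    exact hso.image_mem_nhds (TateAlgebra.plus_mem_nhds hQo)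
  have hVb : BddOver A (V : Set C) := by
    rw [hVe]
    exact (TateAlgebra.isBoundedSubset_plus hQb).bddOver.image s.toLinearMap hs
  have hVd : (V : Set C) ⊆
      closure (Subring.closure (G ∪ Set.range fun i => s (TateAlgebra.var i)) : Set C) := by
    rw [hVe]
    rintro _ ⟨F, hF, rfl⟩
    refine TateAlgebra.map_mem_of_mem_plus s.toRingHom hs
      (D := (Subring.closure (G ∪ Set.range fun i => s (TateAlgebra.var i))).topologicalClosure)
      (Subring.isClosed_topologicalClosure _) (fun a ha => ?_) (fun i => ?_) hF
    · exact closure_mono (Subring.closure_mono Set.subset_union_left) (hQG a ha)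
    · exact subset_closure (Subring.subset_closure (Or.inr ⟨i, rfl⟩))
  obtain ⟨E, hE, hES, r, t, ht, htV⟩ :=
    exists_finite_generators_mod_smul hA hJ hCbo hCb hG hS hd hx hV hVd
  refine ⟨E, hE, hES, fun X _ _ _ _ _ _ T hT Xb hXb hP hD => ?_⟩
  exact surjective_of_finite_generators_mod_smul hA hJ hV hVb ht htV T hT hXb hP hD

/-- In the situation of `exists_finite_forall_surjective`, suppose that the subring generated by `G`
and a finite subset `E₀` of `S` is dense in an open subring. Then after enlarging `E₀` the
coefficients of the integral equations can be lifted along `T`, whose kernel is therefore finitely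
generated. -/
theorem exists_finite_forall_ker_fg (hA : NhdsSpanTop A) {Cb : Subring C}
    (hCb : IsBoundedSubset (Cb : Set C)) {G S : Set C}
    (hd : (Cb : Set C) ⊆ closure (Subring.closure (G ∪ S))) {n : ℕ}
    (s : TateAlgebra n Q →ₐ[A] C) (hs : Continuous s) (hsurj : Function.Surjective s)
    (hk : (RingHom.ker s).FG) (hx : ∀ i, IsIntegral Cb (s (TateAlgebra.var i)))
    {E₀ : Set C} (hE₀ : E₀.Finite) (hE₀S : E₀ ⊆ S)
    (hE₀n : closure (Subring.closure (G ∪ E₀) : Set C) ∈ 𝓝 0) :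
    ∃ E : Set C, E.Finite ∧ E ⊆ S ∧ E₀ ⊆ E ∧ ∀ (X : Type u) [CommRing X] [TopologicalSpace X]
      [NonarchimedeanRing X] [NullComplete X] [Algebra A X] [ContinuousSMul A X] (T : X →ₐ[A] C),
      Continuous T → Function.Surjective T → ∀ (m : ℕ) (σ : TateAlgebra m Q →ₐ[A] X),
      Continuous σ → Function.Surjective σ →
      (∀ a, T (σ (TateAlgebra.monomial 0 a)) = s (TateAlgebra.monomial 0 a)) →
      (∀ j, T (σ (TateAlgebra.var j)) ∈ Cb) → ∀ Xb : Subring X, (Xb : Set X) ∈ 𝓝 0 →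
      IsBoundedSubset (Xb : Set X) → Subring.closure (G ∪ E) ≤ Xb.map T.toRingHom →
      (RingHom.ker T).FG := by
  choose p hpm hp using hx
  choose E hE hES β hβ hβE using fun i k =>
    exists_finite_approx (hd ((p i).coeff k).2) hE₀n
  let E₁ : Set C := E₀ ∪ ⋃ i, ⋃ k ∈ (p i).support, E i k
  refine ⟨E₁, hE₀.union (Set.finite_iUnion fun i => (p i).support.finite_toSet.biUnion
    fun k _ => hE i k), Set.union_subset hE₀S (Set.iUnion_subset fun i => Set.iUnion₂_subset
    fun k _ => hES i k), Set.subset_union_left, ?_⟩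
  intro X _ _ _ _ _ _ T hT hTs m σ hσ hσs hcompat he Xb hXo hXb hD
  -- the image of `Xb` is open, hence closed, and contains all coefficients
  have hTo : IsOpenMap T := hA.isOpenMap T.toLinearMap hT hTs
  have hTX : (Xb.map T.toRingHom : Set C) ∈ 𝓝 0 := by
    rw [Subring.coe_map, ← map_zero T]
    exact hTo.image_mem_nhds hXo
  have hcl : IsClosed (Xb.map T.toRingHom : Set C) :=
    AddSubgroup.isClosed_of_isOpen (Xb.map T.toRingHom).toAddSubgroup
      (AddSubgroup.isOpen_of_mem_nhds _ hTX)
  have hEE : ∀ i, ∀ k ∈ (p i).support, E i k ⊆ E₁ := fun i k hk c hc =>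
    Or.inr (Set.mem_iUnion.2 ⟨i, Set.mem_iUnion₂.2 ⟨k, hk, hc⟩⟩)
  have hcoeff : ∀ i k, ((p i).coeff k : C) ∈ Xb.map T.toRingHom := fun i k => by
    by_cases hk : k ∈ (p i).support
    · have h1 : β i k ∈ Xb.map T.toRingHom := hD (Subring.closure_mono
        (Set.union_subset_union_right _ (hEE i k hk)) (hβ i k))
      have h2 : ((p i).coeff k : C) - β i k ∈ Xb.map T.toRingHom :=
        closure_minimal (fun c hc => hD (Subring.closure_mono
          (Set.union_subset_union_right _ Set.subset_union_left) hc)) hcl (hβE i k)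
      simpa using add_mem h2 h1
    · rw [Polynomial.notMem_support_iff.1 hk]
      exact zero_mem _
  let ρ : Xb →+* C := T.toRingHom.comp Xb.subtype
  have hq : ∀ i, ∃ q : Polynomial Xb, q.map ρ = (p i).map Cb.subtype ∧ q.Monic := fun i => by
    have hl : (p i).map Cb.subtype ∈ Polynomial.lifts ρ := by
      rw [Polynomial.lifts_iff_coeff_lifts]
      intro k
      obtain ⟨x, hx, hxk⟩ := hcoeff i k
      exact ⟨⟨x, hx⟩, by rw [Polynomial.coeff_map]; exact hxk⟩
    obtain ⟨q, hq, -, hqm⟩ := Polynomial.lifts_and_natDegree_eq_and_monic hl ((hpm i).map _)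
    exact ⟨q, hq, hqm⟩
  choose q hq hqm using hq
  refine ker_fg_of_isIntegral hA T hT hTs s hs hsurj hk σ hσ hσs hcompat hCb he hXb hqm
    fun i => ?_
  have := hp i
  rw [Polynomial.eval₂_eq_eval_map] at this ⊢
  rw [← this]
  exact congrArg _ (hq i)

end FinitePresentation

/-! ### Pieces of the covering as finitely presented algebras -/

section Pieces

variable {A : Type*} [CommRing A] [TopologicalSpace A] [NonarchimedeanRing A] [NullComplete A]
  {B : Type*} [CommRing B] [TopologicalSpace B] [NonarchimedeanRing B] [NullComplete B]
  [Algebra A B] [ContinuousSMul A B]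

namespace RationalLocalization

/-- The image of `O⟨T⟩` in `X⟨f/g⟩`. -/
noncomputable def integers {X : Type*} [CommRing X] [TopologicalSpace X] [NonarchimedeanRing X]
    (f g : X) (O : Subring X) : Subring (RationalLocalization f g) :=
  (TateAlgebra.plus 1 O).map (mk f g)

section

variable {X : Type*} [CommRing X] [TopologicalSpace X] [NonarchimedeanRing X] {f g : X}
  {O : Subring X}

theorem quot_mem_integers : quot f g ∈ integers f g O := ⟨_, TateAlgebra.var_mem_plus 0, rfl⟩

theorem of_mem_integers [Algebra A X] {x : X} (hx : x ∈ O) : of A f g x ∈ integers f g O :=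
  ⟨_, TateAlgebra.monomial_mem_plus hx 0, rfl⟩

theorem integers_mem_nhds (hO : (O : Set X) ∈ 𝓝 0) : (integers f g O : Set (RationalLocalization f g)) ∈ 𝓝 0 := by
  rw [integers, Subring.coe_map, ← map_zero (mk f g)]
  exact (isOpenMap_mk f g).image_mem_nhds (TateAlgebra.plus_mem_nhds hO)

theorem isBoundedSubset_integers (hO : IsBoundedSubset (O : Set X)) :
    IsBoundedSubset (integers f g O : Set (RationalLocalization f g)) :=
  (TateAlgebra.isBoundedSubset_plus hO).image_of_isOpenMap (mk f g) (continuous_mk f g)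
    (isOpenMap_mk f g)

theorem map_mem_of_mem_integers [Algebra A X] {Y : Type*} [CommRing Y] [TopologicalSpace Y]
    (θ : RationalLocalization f g →+* Y) (hθ : Continuous θ) {D : Subring Y}
    (hD : IsClosed (D : Set Y)) (hO : ∀ a ∈ O, θ (of A f g a) ∈ D) (hq : θ (quot f g) ∈ D)
    {x : RationalLocalization f g} (hx : x ∈ integers f g O) : θ x ∈ D := by
  obtain ⟨F, hF, rfl⟩ := hx
  refine TateAlgebra.map_mem_of_mem_plus (θ.comp (mk f g)) (hθ.comp (continuous_mk f g)) hD hO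
    (fun i => ?_) hF
  rw [Subsingleton.elim i 0]
  exact hq

end

end RationalLocalization

open RationalLocalization

/-- The evaluation homomorphism `A⟨T₁, …, Tₘ⟩ → B` at a tuple with bounded monomials. -/
noncomputable def evalBase {m : ℕ} (e : Fin m → B)
    (he : IsBoundedSubset (TateAlgebra.monomials e)) : TateAlgebra m A →ₐ[A] B :=
  TateAlgebra.eval (Algebra.ofId A B) (continuous_algebraMap A B) e he

section

variable {m : ℕ} (e : Fin m → B) (he : IsBoundedSubset (TateAlgebra.monomials e))

theorem continuous_evalBase : Continuous (evalBase (A := A) e he) :=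
  TateAlgebra.continuous_eval _ _ _ _

theorem evalBase_var (i) : evalBase (A := A) e he (TateAlgebra.var i) = e i :=
  TateAlgebra.eval_var _ _ _ _ _

theorem evalBase_monomial_zero (a) :
    evalBase (A := A) e he (TateAlgebra.monomial 0 a) = algebraMap A B a :=
  TateAlgebra.eval_monomial_zero _ _ _ _ _

variable (f g : A)

/-- The homomorphism `A⟨T₁, …, Tₘ⟩⟨f/g⟩ → B⟨f/g⟩` induced by evaluation at a tuple. -/
noncomputable def evalPiece :
    RationalLocalization (algebraMap A (TateAlgebra m A) f) (algebraMap A (TateAlgebra m A) g)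
      →ₐ[A] RationalLocalization (algebraMap A B f) (algebraMap A B g) :=
  RationalLocalization.map (evalBase e he) (continuous_evalBase e he)
    ((evalBase e he).commutes f) ((evalBase e he).commutes g)

theorem continuous_evalPiece : Continuous (evalPiece e he f g) :=
  RationalLocalization.continuous_map _ _ _ _

theorem evalPiece_of (F) : evalPiece e he f g (of A _ _ F) = of A _ _ (evalBase e he F) :=
  map_of _ _ _ _ _

theorem evalPiece_quot : evalPiece e he f g (quot _ _) = quot _ _ := map_quot _ _ _ _

end

variable (f g : A)

/-- The generators over `ℤ`, up to closure, of the image of `P⟨T⟩` in `B⟨f/g⟩`. -/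
def baseGenerators (P : Subring A) :
    Set (RationalLocalization (algebraMap A B f) (algebraMap A B g)) :=
  insert (quot _ _) (algebraMap A _ '' P)

variable {f g} {P : Subring A} {Bp : Subring B} (hP : IsBoundedSubset (P : Set A))
  {m : ℕ} {e : Fin m → B} (he : IsBoundedSubset (TateAlgebra.monomials e))

theorem closure_le_map_integers :
    Subring.closure (baseGenerators f g P ∪ of A _ _ '' Set.range e) ≤
      (integers (algebraMap A (TateAlgebra m A) f) (algebraMap A (TateAlgebra m A) g)
        (TateAlgebra.plus m P)).map (evalPiece e he f g).toRingHom := by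
  refine Subring.closure_le.2 ?_
  rintro _ ((rfl | ⟨p, hp, rfl⟩) | ⟨_, ⟨i, rfl⟩, rfl⟩)
  · exact ⟨_, quot_mem_integers, evalPiece_quot e he f g⟩
  · refine ⟨of A _ _ (algebraMap A _ p), of_mem_integers ?_, ?_⟩
    · rw [TateAlgebra.algebraMap_eq_const]
      exact TateAlgebra.monomial_mem_plus hp 0
    · change evalPiece e he f g _ = _
      rw [AlgHom.commutes, AlgHom.commutes]
  · refine ⟨of A _ _ (TateAlgebra.var i), of_mem_integers (TateAlgebra.var_mem_plus i), ?_⟩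
    exact (evalPiece_of e he f g _).trans (congrArg _ (evalBase_var e he i))

theorem evalPiece_mem_closure {x} (hx : x ∈ integers (algebraMap A (TateAlgebra m A) f)
      (algebraMap A (TateAlgebra m A) g) (TateAlgebra.plus m P)) :
    evalPiece e he f g x ∈
      closure (Subring.closure (baseGenerators f g P ∪ of A _ _ '' Set.range e) : Set _) := by
  refine map_mem_of_mem_integers (A := A) (evalPiece e he f g).toRingHom
    (continuous_evalPiece e he f g)
    (D := (Subring.closure (baseGenerators f g P ∪ of A _ _ '' Set.range e)).topologicalClosure)
    (Subring.isClosed_topologicalClosure _) (fun F hF => ?_) ?_ hx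
  · have h1 : (evalPiece e he f g).toRingHom (of A _ _ F) = of A _ _ (evalBase e he F) :=
      evalPiece_of e he f g F
    rw [h1]
    refine TateAlgebra.map_mem_of_mem_plus ((of A _ _).comp (evalBase e he)).toRingHom
      ((continuous_of _ _).comp (continuous_evalBase e he))
      (Subring.isClosed_topologicalClosure _) (fun a ha => ?_) (fun i => ?_) hF
    · refine subset_closure (Subring.subset_closure (Or.inl (Or.inr ⟨a, ha, ?_⟩)))
      rw [← TateAlgebra.algebraMap_self_eq]
      exact (((of A _ _).comp (evalBase e he)).commutes a).symm
    · refine subset_closure (Subring.subset_closure (Or.inr ⟨_, ⟨i, rfl⟩, ?_⟩))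
      exact congrArg (of A _ _) (evalBase_var e he i).symm
  · exact subset_closure (Subring.subset_closure (Or.inl (Or.inl (evalPiece_quot e he f g))))

end Pieces

section PiecePresentation

open RationalLocalization

variable {A : Type*} [CommRing A] [TopologicalSpace A] [NonarchimedeanRing A] [NullComplete A]
  {B : Type*} [CommRing B] [TopologicalSpace B] [NonarchimedeanRing B] [NullComplete B]
  [Algebra A B] [ContinuousSMul A B] {f g : A}

theorem RationalLocalization.of_eq_algebraMap (x : A) :
    of A f g x = algebraMap A (RationalLocalization f g) x := (of A f g).commutes x

/-- Every homomorphism `A⟨f/g⟩ → Y` takes the fraction `f/g` to any given solution of `g y = f`. -/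
theorem RationalLocalization.algHom_quot {Y : Type*} [CommRing Y] [Algebra A Y]
    (hfg : IsCoprime f g) (ψ : RationalLocalization f g →ₐ[A] Y) {y : Y}
    (hy : algebraMap A Y g * y = algebraMap A Y f) : ψ (quot f g) = y := by
  refine eq_of_mul_eq_of_isCoprime (hfg.map (algebraMap A Y)) ?_ hy
  have h := congrArg ψ (of_mul_quot (A := A) f g)
  rwa [map_mul, of_eq_algebraMap, of_eq_algebraMap, AlgHom.commutes, AlgHom.commutes] at h

theorem algebraMap_mul_quot (Y : Type*) [CommRing Y] [TopologicalSpace Y] [NonarchimedeanRing Y]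
    [Algebra A Y] : algebraMap A (RationalLocalization (algebraMap A Y f) (algebraMap A Y g)) g *
      quot (algebraMap A Y f) (algebraMap A Y g)
        = algebraMap A (RationalLocalization (algebraMap A Y f) (algebraMap A Y g)) f := by
  have h := of_mul_quot (A := A) (algebraMap A Y f) (algebraMap A Y g)
  rwa [AlgHom.commutes, AlgHom.commutes] at h

section

variable (f g) (m : ℕ)

/-- The homomorphism `A⟨f/g⟩ → A⟨T₁, …, Tₘ⟩⟨f/g⟩`. -/
noncomputable def constPiece : RationalLocalization f g →ₐ[A]
    RationalLocalization (algebraMap A (TateAlgebra m A) f) (algebraMap A (TateAlgebra m A) g) :=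
  RationalLocalization.map (Algebra.ofId A (TateAlgebra m A))
    (continuous_algebraMap A (TateAlgebra m A)) rfl rfl

theorem continuous_constPiece : Continuous (constPiece f g m) :=
  RationalLocalization.continuous_map _ _ _ _

theorem constPiece_quot : constPiece f g m (quot f g) = quot _ _ := map_quot _ _ _ _

variable {m}

theorem isBoundedSubset_monomials_of_var (hA : NhdsSpanTop A) :
    IsBoundedSubset (TateAlgebra.monomials fun j : Fin m =>
      of A (algebraMap A (TateAlgebra m A) f) (algebraMap A (TateAlgebra m A) g)
        (TateAlgebra.var j)) := by
  refine ((isBoundedSubset_monomials_var m A).image hA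
    (of A (algebraMap A (TateAlgebra m A) f) (algebraMap A (TateAlgebra m A) g))
    (continuous_of _ _)).mono ?_
  rintro _ ⟨k, rfl⟩
  refine ⟨_, ⟨k, rfl⟩, ?_⟩
  rw [map_prod]
  exact Finset.prod_congr rfl fun j _ => map_pow _ _ _

variable (hA : NhdsSpanTop A)

variable (m) in
/-- The homomorphism `A⟨f/g⟩⟨T₁, …, Tₘ⟩ → A⟨T₁, …, Tₘ⟩⟨f/g⟩`. -/
noncomputable def commPiece : TateAlgebra m (RationalLocalization f g) →ₐ[A]
    RationalLocalization (algebraMap A (TateAlgebra m A) f) (algebraMap A (TateAlgebra m A) g) :=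
  TateAlgebra.eval (constPiece f g m) (continuous_constPiece f g m)
    (fun j => of A _ _ (TateAlgebra.var j)) (isBoundedSubset_monomials_of_var f g hA)

theorem continuous_commPiece : Continuous (commPiece f g m hA) :=
  TateAlgebra.continuous_eval _ _ _ _

theorem commPiece_monomial_zero (a) :
    commPiece f g m hA (TateAlgebra.monomial 0 a) = constPiece f g m a :=
  TateAlgebra.eval_monomial_zero _ _ _ _ _

theorem commPiece_var (j) : commPiece f g m hA (TateAlgebra.var j) = of A _ _ (TateAlgebra.var j) :=
  TateAlgebra.eval_var _ _ _ _ _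

variable {f g}

theorem surjective_commPiece {P : Subring A} {J : Ideal P} (hJ : IsAdicPair P J)
    (hPo : (P : Set A) ∈ 𝓝 0) (hP : IsBoundedSubset (P : Set A)) :
    Function.Surjective (commPiece f g m hA) := by
  have hPm : ∀ p ∈ P, algebraMap A (TateAlgebra m A) p ∈ TateAlgebra.plus m P := fun p hp => by
    rw [TateAlgebra.algebraMap_self_eq]
    exact TateAlgebra.monomial_mem_plus hp 0
  have hPQ : ∀ p ∈ P, algebraMap A (RationalLocalization f g) p ∈ integers f g P := fun p hp => by
    rw [← of_eq_algebraMap]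
    exact of_mem_integers hp
  have hPn : ∀ p ∈ P, algebraMap A (TateAlgebra m (RationalLocalization f g)) p ∈
      TateAlgebra.plus m (integers f g P) := fun p hp => by
    rw [TateAlgebra.algebraMap_eq_const]
    exact TateAlgebra.monomial_mem_plus (hPQ p hp) 0
  refine surjective_of_dense hA hJ
    (O := integers (algebraMap A (TateAlgebra m A) f) (algebraMap A (TateAlgebra m A) g)
      (TateAlgebra.plus m P))
    (integers_mem_nhds (TateAlgebra.plus_mem_nhds hPo))
    (isBoundedSubset_integers (TateAlgebra.isBoundedSubset_plus hP)) (fun p hp => ?_)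
    (commPiece f g m hA) (continuous_commPiece f g hA)
    (Xb := TateAlgebra.plus m (integers f g P))
    (TateAlgebra.isBoundedSubset_plus (isBoundedSubset_integers hP)) hPn fun x hx => ?_
  · rw [← (of A (algebraMap A (TateAlgebra m A) f) (algebraMap A (TateAlgebra m A) g)).commutes]
    exact of_mem_integers (hPm p hp)
  · let D := ((TateAlgebra.plus m (integers f g P)).map
      (commPiece f g m hA).toRingHom).topologicalClosure
    refine map_mem_of_mem_integers (A := A) (RingHom.id _) continuous_id (D := D)
      (Subring.isClosed_topologicalClosure _) (fun F hF => ?_) ?_ hx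
    · refine TateAlgebra.map_mem_of_mem_plus (of A (algebraMap A (TateAlgebra m A) f)
        (algebraMap A (TateAlgebra m A) g)).toRingHom (continuous_of _ _) (D := D)
        (Subring.isClosed_topologicalClosure _) (fun a ha => ?_) (fun j => ?_) hF
      · refine subset_closure ⟨algebraMap A _ a, hPn a ha, ?_⟩
        rw [← TateAlgebra.algebraMap_self_eq]
        exact ((commPiece f g m hA).commutes a).trans ((of A _ _).commutes a).symm
      · exact subset_closure ⟨_, TateAlgebra.var_mem_plus j, commPiece_var f g hA j⟩
    · exact subset_closure ⟨_, TateAlgebra.monomial_mem_plus quot_mem_integers 0,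
        (commPiece_monomial_zero f g hA _).trans (constPiece_quot f g m)⟩

end

section

variable {P : Subring A} {Bp : Subring B}

theorem baseGenerators_subset (hPB : ∀ p ∈ P, algebraMap A B p ∈ Bp) :
    baseGenerators (B := B) f g P ⊆ integers (algebraMap A B f) (algebraMap A B g) Bp := by
  rintro _ (rfl | ⟨p, hp, rfl⟩)
  · exact quot_mem_integers
  · rw [← (of A (algebraMap A B f) (algebraMap A B g)).commutes]
    exact of_mem_integers (hPB p hp)

theorem integers_subset_closure :
    (integers (algebraMap A B f) (algebraMap A B g) Bp : Set _) ⊆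
      closure (Subring.closure (baseGenerators f g P ∪ of A _ _ '' (Bp : Set B)) : Set
        (RationalLocalization (algebraMap A B f) (algebraMap A B g))) := fun x hx =>
  map_mem_of_mem_integers (A := A) (RingHom.id _) continuous_id
    (D := (Subring.closure (baseGenerators f g P ∪ of A _ _ '' (Bp : Set B))).topologicalClosure)
    (Subring.isClosed_topologicalClosure _)
    (fun b hb => subset_closure (Subring.subset_closure (Or.inr ⟨b, hb, rfl⟩)))
    (subset_closure (Subring.subset_closure (Or.inl (Or.inl rfl)))) hx

theorem algHom_mem_closure_baseGenerators (hfg : IsCoprime f g)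
    (ψ : RationalLocalization f g →ₐ[A]
      RationalLocalization (algebraMap A B f) (algebraMap A B g)) (hψ : Continuous ψ)
    {a} (ha : a ∈ integers f g P) :
    ψ a ∈ closure (Subring.closure (baseGenerators (B := B) f g P) : Set _) :=
  map_mem_of_mem_integers (A := A) ψ.toRingHom hψ
    (D := (Subring.closure (baseGenerators f g P)).topologicalClosure)
    (Subring.isClosed_topologicalClosure _)
    (fun p hp => subset_closure (Subring.subset_closure (Or.inr ⟨p, hp, by
      rw [of_eq_algebraMap]; exact (ψ.commutes p).symm⟩)))
    (subset_closure (Subring.subset_closure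
      (Or.inl (algHom_quot hfg ψ (algebraMap_mul_quot B))))) ha

end

end PiecePresentation

section PieceFinite

open RationalLocalization

universe u v

variable {A : Type u} [CommRing A] [TopologicalSpace A] [NonarchimedeanRing A] [NullComplete A]
  {B : Type v} [CommRing B] [TopologicalSpace B] [NonarchimedeanRing B] [NullComplete B]
  [Algebra A B] [ContinuousSMul A B] {f g : A}

/-- If `B⟨f/g⟩` is the quotient of a Tate algebra over `A⟨f/g⟩` by a finitely generated ideal, and
the images of the variables are integral over the image of `Bp⟨T⟩`, then every large enough finite
family of elements of `Bp` presents `B⟨f/g⟩` in the same way. -/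
theorem exists_finite_evalPiece (hA : NhdsSpanTop A) {P : Subring A} {J : Ideal P}
    (hJ : IsAdicPair P J) (hPo : (P : Set A) ∈ 𝓝 0) (hP : IsBoundedSubset (P : Set A))
    {Bp : Subring B} (hBo : (Bp : Set B) ∈ 𝓝 0) (hB : IsBoundedSubset (Bp : Set B))
    (hPB : ∀ p ∈ P, algebraMap A B p ∈ Bp) (hfg : IsCoprime f g) {n : ℕ}
    (s : TateAlgebra n (RationalLocalization f g) →ₐ[A]
      RationalLocalization (algebraMap A B f) (algebraMap A B g))
    (hs : Continuous s) (hsurj : Function.Surjective s) (hk : (RingHom.ker s).FG)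
    (hx : ∀ i, IsIntegral (integers (algebraMap A B f) (algebraMap A B g) Bp)
      (s (TateAlgebra.var i))) :
    ∃ E : Set B, E.Finite ∧ E ⊆ Bp ∧ ∀ (m : ℕ) (e : Fin m → B)
      (he : IsBoundedSubset (TateAlgebra.monomials e)), (∀ j, e j ∈ Bp) → E ⊆ Set.range e →
      Function.Surjective (evalPiece e he f g) ∧ (RingHom.ker (evalPiece e he f g)).FG := by
  classical
  have hCn := integers_mem_nhds (f := algebraMap A B f) (g := algebraMap A B g) hBo
  have hCo : IsOpen (integers (algebraMap A B f) (algebraMap A B g) Bp :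
      Set (RationalLocalization (algebraMap A B f) (algebraMap A B g))) :=
    AddSubgroup.isOpen_of_mem_nhds
      (integers (algebraMap A B f) (algebraMap A B g) Bp).toAddSubgroup hCn
  have hCb := isBoundedSubset_integers (f := algebraMap A B f) (g := algebraMap A B g) hB
  let G := baseGenerators (B := B) f g P
  let S : Set (RationalLocalization (algebraMap A B f) (algebraMap A B g)) :=
    of A _ _ '' (Bp : Set B)
  have hG : G ⊆ integers (algebraMap A B f) (algebraMap A B g) Bp := baseGenerators_subset hPB
  have hS : S ⊆ integers (algebraMap A B f) (algebraMap A B g) Bp := by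
    rintro _ ⟨b, hb, rfl⟩
    exact of_mem_integers hb
  have hd : (integers (algebraMap A B f) (algebraMap A B g) Bp :
      Set (RationalLocalization (algebraMap A B f) (algebraMap A B g))) ⊆
      closure (Subring.closure (G ∪ S)) := integers_subset_closure
  have hPQ : ∀ p ∈ P, algebraMap A (RationalLocalization f g) p ∈ integers f g P := fun p hp => by
    rw [← of_eq_algebraMap]
    exact of_mem_integers hp
  -- facts about the ring on which `evalPiece` is defined
  have hXn : ∀ m, (integers (algebraMap A (TateAlgebra m A) f) (algebraMap A (TateAlgebra m A) g)
      (TateAlgebra.plus m P) :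
      Set (RationalLocalization (algebraMap A (TateAlgebra m A) f)
        (algebraMap A (TateAlgebra m A) g))) ∈ 𝓝 (0 : RationalLocalization
        (algebraMap A (TateAlgebra m A) f) (algebraMap A (TateAlgebra m A) g)) := fun m =>
    integers_mem_nhds (TateAlgebra.plus_mem_nhds hPo)
  have hXb : ∀ m, IsBoundedSubset (integers (algebraMap A (TateAlgebra m A) f)
      (algebraMap A (TateAlgebra m A) g) (TateAlgebra.plus m P) :
      Set (RationalLocalization (algebraMap A (TateAlgebra m A) f)
        (algebraMap A (TateAlgebra m A) g))) := fun m =>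
    isBoundedSubset_integers (TateAlgebra.isBoundedSubset_plus hP)
  have hXP : ∀ m, ∀ p ∈ P, algebraMap A (RationalLocalization (algebraMap A (TateAlgebra m A) f)
      (algebraMap A (TateAlgebra m A) g)) p ∈ integers (algebraMap A (TateAlgebra m A) f)
      (algebraMap A (TateAlgebra m A) g) (TateAlgebra.plus m P) := fun m p hp => by
    rw [← (of A (algebraMap A (TateAlgebra m A) f) (algebraMap A (TateAlgebra m A) g)).commutes]
    refine of_mem_integers ?_
    rw [TateAlgebra.algebraMap_self_eq]
    exact TateAlgebra.monomial_mem_plus hp 0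
  have hsc : Continuous (s.comp (TateAlgebra.constHom n A (RationalLocalization f g))) :=
    hs.comp (TateAlgebra.continuous_constHom (n := n) (A := A))
  -- lifting finite subsets of `S`
  have hlift : ∀ E ⊆ S, E.Finite → ∃ E' : Finset B, (E' : Set B) ⊆ Bp ∧ of A _ _ '' (E' : Set B) = E :=
    fun E hES hE => by
      obtain ⟨E, rfl⟩ := hE.exists_finset_coe
      obtain ⟨E', h1, h2⟩ := Finset.subset_set_image_iff.1 hES
      exact ⟨E', h1, by rw [← h2, Finset.coe_image]⟩
  have hmono : ∀ {E : Set (RationalLocalization (algebraMap A B f) (algebraMap A B g))} {E' : Set B},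
      of A _ _ '' E' = E → ∀ {m : ℕ} {e : Fin m → B}, E' ⊆ Set.range e →
      Subring.closure (G ∪ E) ≤ Subring.closure (G ∪ of A _ _ '' Set.range e) := by
    rintro _ E' rfl m e he
    exact Subring.closure_mono (Set.union_subset_union_right _ (Set.image_mono he))
  obtain ⟨E₀, hE₀, hE₀S, h₀⟩ := exists_finite_forall_surjective hA hJ hCo hCb hG hS hd s hs hsurj hx
    (integers_mem_nhds hPo) (isBoundedSubset_integers hP) hPQ fun a ha =>
      algHom_mem_closure_baseGenerators hfg (s.comp (TateAlgebra.constHom n A _))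
        hsc ha
  -- a family enumerating `E₀` shows that `E₀` and `G` generate a dense subring of an open subring
  have hE₀n : closure (Subring.closure (G ∪ E₀) :
      Set (RationalLocalization (algebraMap A B f) (algebraMap A B g))) ∈ 𝓝 (0 :
      RationalLocalization (algebraMap A B f) (algebraMap A B g)) := by
    obtain ⟨E', hE', rfl⟩ := hlift E₀ hE₀S hE₀
    let e : Fin E'.card → B := fun j => E'.equivFin.symm j
    have hr : Set.range e = E' := by
      ext b
      refine ⟨?_, fun hb => ⟨E'.equivFin ⟨b, hb⟩, by simp [e]⟩⟩
      rintro ⟨j, rfl⟩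
      exact (E'.equivFin.symm j).2
    have he : IsBoundedSubset (TateAlgebra.monomials e) :=
      hB.monomials_of_mem fun j => hE' (E'.equivFin.symm j).2
    have hsur := h₀ _ (evalPiece e he f g) (continuous_evalPiece e he f g) _ (hXb _) (hXP _)
      ((hmono rfl hr.ge).trans (closure_le_map_integers he))
    have ho : IsOpenMap (evalPiece e he f g) :=
      hA.isOpenMap (evalPiece e he f g).toLinearMap (continuous_evalPiece e he f g) hsur
    have h1 := ho.image_mem_nhds (hXn E'.card)
    rw [map_zero] at h1
    refine mem_of_superset h1 ?_
    rintro _ ⟨x, hx, rfl⟩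
    rw [← hr]
    exact evalPiece_mem_closure he hx
  obtain ⟨E₁, hE₁, hE₁S, hE₀₁, h₁⟩ := exists_finite_forall_ker_fg hA hCb hd s hs hsurj hk hx hE₀ hE₀S
    hE₀n
  obtain ⟨E', hE', hE'E⟩ := hlift E₁ hE₁S hE₁
  refine ⟨E', E'.finite_toSet, hE', fun m e he heB hEe => ?_⟩
  have hD := (hmono hE'E hEe).trans (closure_le_map_integers (f := f) (g := g) (P := P) he)
  have hsur : Function.Surjective (evalPiece e he f g) :=
    h₀ _ _ (continuous_evalPiece e he f g) _ (hXb m) (hXP m)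
      ((Subring.closure_mono (Set.union_subset_union_right _ hE₀₁)).trans hD)
  refine ⟨hsur, h₁ _ _ (continuous_evalPiece e he f g) hsur m (commPiece f g m hA)
    (continuous_commPiece f g hA) (surjective_commPiece hA hJ hPo hP) (fun a => ?_) (fun j => ?_) _
    (hXn m) (hXb m) hD⟩
  · -- a continuous homomorphism of `A`-algebras from `A⟨f/g⟩` to `B⟨f/g⟩` is unique
    have h2 : ((evalPiece e he f g).comp (commPiece f g m hA)).comp (TateAlgebra.constHom m A _)
        = s.comp (TateAlgebra.constHom n A _) :=
      RationalLocalization.algHom_ext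
        (((continuous_evalPiece e he f g).comp (continuous_commPiece f g hA)).comp
          (TateAlgebra.continuous_constHom (n := m) (A := A))) hsc
        (fun x => by rw [of_eq_algebraMap, AlgHom.commutes, AlgHom.commutes])
        ((algHom_quot hfg _ (algebraMap_mul_quot B)).trans
          (algHom_quot hfg _ (algebraMap_mul_quot B)).symm)
    exact DFunLike.congr_fun h2 a
  · have h2 : evalPiece e he f g (commPiece f g m hA (TateAlgebra.var j)) = of A _ _ (e j) := by
      rw [commPiece_var]
      exact (evalPiece_of e he f g _).trans (congrArg _ (evalBase_var e he j))
    rw [h2]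
    exact of_mem_integers (heB j)

end PieceFinite

/-! ### The descent of surjectivity -/

theorem IsHuberRing.firstCountableTopology (A : Type*) [CommRing A] [TopologicalSpace A]
    [IsHuberRing A] : FirstCountableTopology A := by
  obtain ⟨A₀, I, hA₀, -, hI⟩ := IsHuberRing.exists_pair_of_definition (A := A)
  have h0 : (𝓝 (0 : A)).IsCountablyGenerated := by
    have h1 := (HasCountableBasis.mk hI.hasBasis_nhds_zero
      (Set.to_countable _)).isCountablyGenerated
    have h2 := hA₀.isOpenEmbedding_subtypeVal.map_nhds_eq 0
    rw [← ZeroMemClass.coe_zero A₀, ← h2]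
    infer_instance
  refine ⟨fun a => ?_⟩
  rw [show 𝓝 a = map (a + ·) (𝓝 0) by simp]
  infer_instance

theorem mainTheorem2
    {A B : Type*} [CommRing A] [CommRing B]
    [UniformSpace A] [IsUniformAddGroup A] [CompleteSpace A] [T2Space A] [IsHuberRing A]
    [UniformSpace B] [IsUniformAddGroup B] [CompleteSpace B] [T2Space B] [IsHuberRing B]
    (hA_analytic : IsAnalyticRing A) (hA_uniform : IsUniformRing A)
    (hB_analytic : IsAnalyticRing B) (hB_uniform : IsUniformRing B)
    (Aplus : Subring A) (hAplus : IsRingOfIntegralElements Aplus)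
    (Bplus : Subring B) (hBplus : IsRingOfIntegralElements Bplus)
    [Algebra A B] (hcont : Continuous (algebraMap A B))
    (hplus : ∀ a ∈ Aplus, algebraMap A B a ∈ Bplus)
    (f g : A) (hfg : Ideal.span {f, g} = (⊤ : Ideal A))
    (n : ℕ)
    (s₁ : TateAlgebra n (RationalLocalization f g) →ₐ[A]
      RationalLocalization (algebraMap A B f) (algebraMap A B g))
    (hs₁_cont : Continuous s₁)
    (hs₁_plus : ∀ F ∈ TateAlgebra.plus n (RationalLocalization.plus f g Aplus),
      s₁ F ∈ RationalLocalization.plus (algebraMap A B f) (algebraMap A B g) Bplus)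
    (hs₁_surj : Function.Surjective s₁)
    (hs₁_ker : (RingHom.ker s₁).FG)
    (s₂ : TateAlgebra n (RationalLocalization g f) →ₐ[A]
      RationalLocalization (algebraMap A B g) (algebraMap A B f))
    (hs₂_cont : Continuous s₂)
    (hs₂_plus : ∀ F ∈ TateAlgebra.plus n (RationalLocalization.plus g f Aplus),
      s₂ F ∈ RationalLocalization.plus (algebraMap A B g) (algebraMap A B f) Bplus)
    (hs₂_surj : Function.Surjective s₂)
    (hs₂_ker : (RingHom.ker s₂).FG) :
    ∃ (n' : ℕ) (s : TateAlgebra n' A →ₐ[A] B),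
      Continuous s ∧ (∀ F ∈ TateAlgebra.plus n' Aplus, s F ∈ Bplus) ∧ Function.Surjective s := by
  classical
  have := IsHuberRing.firstCountableTopology A
  have := IsHuberRing.firstCountableTopology B
  have : NullComplete A := NullComplete.of_completeSpace A
  have : NullComplete B := NullComplete.of_completeSpace B
  have : ContinuousSMul A B := continuousSMul_of_algebraMap _ _ hcont
  have hA := hA_analytic.nhdsSpanTop
  have hB := hB_analytic.nhdsSpanTop
  obtain ⟨P, J, hPA, hJ⟩ := exists_isAdicPair Aplus hAplus.isOpen
  have hPo : (P : Set A) ∈ 𝓝 0 :=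
    mem_of_superset hJ.image_mem_nhds (by rintro _ ⟨p, -, rfl⟩; exact p.2)
  -- by uniformity, subrings consisting of power-bounded elements are bounded
  have hPb : IsBoundedSubset (P : Set A) :=
    hA_uniform.mono fun a ha => hAplus.powerBounded a (hPA ha)
  have hBo : (Bplus : Set B) ∈ 𝓝 0 := hBplus.isOpen.mem_nhds (zero_mem _)
  have hBb : IsBoundedSubset (Bplus : Set B) := hB_uniform.mono hBplus.powerBounded
  have hPB : ∀ p ∈ P, algebraMap A B p ∈ Bplus := fun p hp => hplus p (hPA hp)
  have hcop : IsCoprime f g := by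
    rwa [← Ideal.isCoprime_span_singleton_iff, Ideal.isCoprime_iff_sup_eq, ← Ideal.span_union,
      Set.singleton_union]
  have hfgB : Ideal.span {algebraMap A B f, algebraMap A B g} = (⊤ : Ideal B) := by
    have h := congrArg (Ideal.map (algebraMap A B)) hfg
    rwa [Ideal.map_span, Set.image_pair, Ideal.map_top] at h
  have hstrA : StrictPair f g := strictPair_of_isUniformRing hA hA_uniform hAplus hfg
  have hstrB : StrictPair (algebraMap A B f) (algebraMap A B g) :=
    strictPair_of_isUniformRing hB hB_uniform hBplus hfgB
  obtain ⟨E₁, hE₁, hE₁B, h₁⟩ := exists_finite_evalPiece hA hJ hPo hPb hBo hBb hPB hcop s₁ hs₁_cont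
    hs₁_surj hs₁_ker fun i => hs₁_plus _ (TateAlgebra.var_mem_plus i)
  obtain ⟨E₂, hE₂, hE₂B, h₂⟩ := exists_finite_evalPiece hA hJ hPo hPb hBo hBb hPB hcop.symm s₂
    hs₂_cont hs₂_surj hs₂_ker fun i => hs₂_plus _ (TateAlgebra.var_mem_plus i)
  obtain ⟨E, hE⟩ := (hE₁.union hE₂).exists_finset_coe
  have hEB : ∀ b ∈ E, b ∈ Bplus := fun b hb => by
    have hb' : b ∈ E₁ ∪ E₂ := hE ▸ hb
    exact hb'.elim (fun h => hE₁B h) fun h => hE₂B h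
  -- one family that is large enough for both pieces
  let e : Fin E.card → B := fun j => E.equivFin.symm j
  have heB : ∀ j, e j ∈ Bplus := fun j => hEB _ (E.equivFin.symm j).2
  have hr : E₁ ∪ E₂ ⊆ Set.range e := by
    rw [← hE]
    exact fun b hb => ⟨E.equivFin ⟨b, hb⟩, by simp [e]⟩
  have he : IsBoundedSubset (TateAlgebra.monomials e) := hBb.monomials_of_mem heB
  obtain ⟨hs1, hk1⟩ := h₁ _ e he heB (Set.subset_union_left.trans hr)
  obtain ⟨hs2, hk2⟩ := h₂ _ e he heB (Set.subset_union_right.trans hr)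
  have hR : LocallyBdd P (TateAlgebra E.card A) :=
    LocallyBdd.tateAlgebra ⟨P.asSubmodule P fun p hp => hp, by
      rw [Subring.coe_asSubmodule]; exact hPo, by
      rw [Subring.coe_asSubmodule]; exact hPb.bddOver⟩ _
  have hstrR : StrictPair (algebraMap A (TateAlgebra E.card A) f)
      (algebraMap A (TateAlgebra E.card A) g) := by
    rw [TateAlgebra.algebraMap_self_eq, TateAlgebra.algebraMap_self_eq]
    exact hstrA.tateAlgebra _
  refine ⟨E.card, evalBase e he, continuous_evalBase (A := A) e he, fun F hF => ?_, ?_⟩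
  · refine TateAlgebra.map_mem_of_mem_plus (evalBase e he).toRingHom (continuous_evalBase (A := A) e he)
      (AddSubgroup.isClosed_of_isOpen Bplus.toAddSubgroup hBplus.isOpen) (fun a ha => ?_)
      (fun j => ?_) hF
    · exact (evalBase_monomial_zero (A := A) e he a).symm ▸ hplus a ha
    · exact (evalBase_var (A := A) e he j).symm ▸ heB j
  · exact surjective_of_surjective_map (evalBase e he) (continuous_evalBase (A := A) e he)
      ((evalBase e he).commutes f) ((evalBase e he).commutes g) hJ hA hR
      (hcop.map (algebraMap A (TateAlgebra E.card A))) hstrR hstrB hs1 hk1 hs2 hk2
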